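/- Let $\mathcal G$ be the belt buckle (two vertices joined by three edges), and let $A$ be the transition matrix on its six directed edges: $A(e,e')=1$ if $e'$ begins where $e$ ends and $e'\neq\bar e$, and $A(e,e')=0$ otherwise. For $l=(l_1,l_2,l_3)\in\mathbb R_{>0}^3$, viewed as edge lengths, let $h(l)=\lim_{T\to\infty}\frac1T\log\#\{\gamma:\ l(\gamma)<T\}$, where $\gamma$ runs over closed cycles of directed edges without backtracking, and let $\mathcal M^1=\{l\in\mathbb R_{>0}^3: h(l)=1\}$. Let $\Sigma_A^+$ be the one-sided subshift of finite type of $A$ with shift $\sigma$; a function $\varphi$ on the edges is viewed as the function $\varphi(\underline e)=\varphi(e_0)$ on $\Sigma_A^+$. For a potential $f$ of pressure zero let $m_f=v\mu/\int v\,d\mu$ be its equilibrium state, where $v>0$ is continuous with $\mathcal L_fv=v$, $\mu$ is a probability measure with $\mathcal L_f^*\mu=\mu$, and $\mathcal L_fw(\underline x)=\sum_{\sigma\underline y=\underline x}e^{f(\underline y)}w(\underline y)$. The pressure metric is $$\|\varphi\|_P^2=\mathrm{Var}(\varphi,m_{-l})=\lim_{n\to\infty}\frac1n\int\Big(\sum_{i<n}\varphi\circ\sigma^i-n\int\varphi\,dm_{-l}\Big)^2dm_{-l}$$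 for tangent vectors $\varphi$ at $l$, i.e. functions on the edges with $\int\varphi\,dm_{-l}=0$; $d_P$ is the infimum of the $\|\cdot\|_P$-lengths of $C^1$ curves in $\mathcal M^1$. For $x,y>0$ put $S(x,y)=-\log\frac{e^{x+y}-1}{e^x+e^y+2}$ and $l(x,y)=(x,y,S(x,y))$. 1. $\mathcal M^1=\{l(x,y): x,y>0,\ e^{x+y}<3+e^x+e^y\}$. For all $x,y>0$ (also where $S(x,y)\le 0$) the potential $-l(x,y)$ has a unique equilibrium state, the limit defining $\|\varphi\|_P^2$ exists for every function $\varphi$ on the edges, $\partial_xl$ and $\partial_yl$ are tangent vectors, and the first fundamental form of $\|\cdot\|_P$ in the coordinates $(x,y)$ is a smooth Riemannian metric on $\{x,y>0\}$. Let $K_P(x,y)$ denote its Gaussian curvature. 2. There are constants $0<c_0\le c_1$ such that $c_0\le K_P\le c_1$ on all of $\mathcal M^1$. 3. For all $x,y>0$, with $a=e^x$ and $b=e^y$, $K_P(x,y)=\dfrac{N(a,b)}{4(a+1)^2(b+1)^2(3ab+a^2b+ab^2-1)}$, where $$\begin{aligned}N(a,b)={}&5+6a+3a^2+6b+3b^2+3ab+45a^2b^2+19a^3b^3+11a^2b+9a^3b+3a^4b+11ab^2\\&+33a^3b^2+8a^4b^2+9ab^3+33a^2b^3+3a^4b^3+3ab^4+8a^2b^4+3a^3b^4.\end{aligned}$$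 Moreover $K_P(x,y)\to\frac34$ as $x\to\infty$ and $y\to\infty$. 4. $(\mathcal M^1,d_P)$ is incomplete. The diagonal points $c(x)=l(x,x)$ lie in $\mathcal M^1$ for $0<x<\log 3$, the path $c$ leaves every compact subset of $\mathcal M^1$ as $x\to0^+$, and $\int_0^1\|\dot c(x)\|_P\,dx<\infty$. -/

import Mathlib

open Filter Set MeasureTheory
open scoped Topology ENNReal

noncomputable section

/-! ## Finite metric graphs and their entropy -/

/-- A finite undirected multigraph with vertices `V` and edges numbered by `Fin k`. Each edge is
given a reference orientation, from `src` to `tgt`; loops and multiple edges are allowed. -/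
structure FiniteGraph (V : Type*) (k : ℕ) where
  src : Fin k → V
  tgt : Fin k → V

namespace FiniteGraph

variable {V : Type*} {k : ℕ}

/-- A directed edge is `(e, true)`, the edge `e` with its reference orientation, or `(e, false)`,
the edge `e` with the opposite orientation. This is its initial vertex. -/
def init (G : FiniteGraph V k) (d : Fin k × Bool) : V := if d.2 then G.src d.1 else G.tgt d.1

/-- The terminal vertex of a directed edge. -/
def term (G : FiniteGraph V k) (d : Fin k × Bool) : V := if d.2 then G.tgt d.1 else G.src d.1

/-- `A(d, d') = 1`: the directed edge `d'` begins where `d` ends, and `d'` is not the reverse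
of `d` (no backtracking). -/
def Follows (G : FiniteGraph V k) (d d' : Fin k × Bool) : Prop :=
  G.init d' = G.term d ∧ d' ≠ (d.1, !d.2)

/-- The closed cycles `(e₀, e₁, …, eₙ, e₀)` of directed edges without backtracking
(indices are taken modulo `n + 1`) of total length less than `T`. -/
def closedCycles (G : FiniteGraph V k) (l : Fin k → ℝ) (T : ℝ) :
    Set (Σ n : ℕ, Fin (n + 1) → Fin k × Bool) :=
  {c | (∀ i, G.Follows (c.2 i) (c.2 (i + 1))) ∧ ∑ i, l (c.2 i).1 < T}

/-- The metric graph `(G, l)` has entropy `h = lim_{T → ∞} (1/T) log #{γ : l(γ) < T}`. -/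
def HasEntropy (G : FiniteGraph V k) (l : Fin k → ℝ) (h : ℝ) : Prop :=
  Tendsto (fun T : ℝ => 1 / T * Real.log ((G.closedCycles l T).ncard : ℝ)) atTop (𝓝 h)

/-- The moduli space `M¹_G` of edge lengths on `G` with entropy `1`. -/
def moduliSpace (G : FiniteGraph V k) : Set (Fin k → ℝ) :=
  {l | (∀ i, 0 < l i) ∧ G.HasEntropy l 1}

/-! ## The subshift of finite type, equilibrium states and the variance -/

/-- The one-sided subshift of finite type `Σ_A⁺`, with the topology and the Borel σ-algebra
of the product `(directed edges)^ℕ`. -/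
def shiftSpace (G : FiniteGraph V k) : Set (ℕ → Fin k × Bool) :=
  {x | ∀ n, G.Follows (x n) (x (n + 1))}

/-- The shift map. -/
def shift (G : FiniteGraph V k) (x : G.shiftSpace) : G.shiftSpace :=
  ⟨fun n => x.1 (n + 1), fun n => x.2 (n + 1)⟩

/-- A function on the edges, as a locally constant function on the shift space:
`φ(x) = φ(x₀)`. -/
def edgeFun (G : FiniteGraph V k) (φ : Fin k → ℝ) (x : G.shiftSpace) : ℝ := φ (x.1 0).1

/-- The transfer operator `(L_f w)(x) = ∑_{σ y = x} e^{f(y)} w(y)`. -/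
def transfer (G : FiniteGraph V k) (f w : G.shiftSpace → ℝ) (x : G.shiftSpace) : ℝ :=
  ∑ᶠ (y : G.shiftSpace) (_ : G.shift y = x), Real.exp (f y) * w y

/-- `m` is the equilibrium state of a potential `f` of pressure zero (leading eigenvalue `1` of
the transfer operator): `m = v μ / ∫ v dμ`, where `v` is a continuous, strictly positive
eigenfunction, `L_f v = v`, and `μ` is a probability measure with `L_f^* μ = μ`. -/
def IsEquilibriumState (G : FiniteGraph V k) (f : G.shiftSpace → ℝ)
    (m : Measure G.shiftSpace) : Prop :=
  ∃ (v : C(G.shiftSpace, ℝ)) (μ : Measure G.shiftSpace),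
    IsProbabilityMeasure μ ∧ (∀ x, 0 < v x) ∧ (∀ x, G.transfer f v x = v x) ∧
    (∀ w : C(G.shiftSpace, ℝ), ∫ x, G.transfer f w x ∂μ = ∫ x, w x ∂μ) ∧
    m = (ENNReal.ofReal (∫ x, v x ∂μ))⁻¹ • μ.withDensity (fun x => ENNReal.ofReal (v x))

/-- The equilibrium state of a potential of pressure zero. -/
def equilibriumState (G : FiniteGraph V k) (f : G.shiftSpace → ℝ) : Measure G.shiftSpace :=
  Classical.epsilon (G.IsEquilibriumState f)

/-- `(1/n) ∫ (wⁿ - n ∫ w dm)² dm`, where `wⁿ = ∑_{i < n} w ∘ σⁱ`. -/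
def varianceSeq (G : FiniteGraph V k) (w : G.shiftSpace → ℝ) (m : Measure G.shiftSpace)
    (n : ℕ) : ℝ :=
  1 / (n : ℝ) *
    ∫ x, ((∑ i ∈ Finset.range n, w (G.shift^[i] x)) - (n : ℝ) * ∫ y, w y ∂m) ^ 2 ∂m

/-- The variance `Var(w, m) = lim_n (1/n) ∫ (wⁿ - n ∫ w dm)² dm`. -/
def variance (G : FiniteGraph V k) (w : G.shiftSpace → ℝ) (m : Measure G.shiftSpace) : ℝ :=
  limUnder atTop (G.varianceSeq w m)

/-! ## The pressure metric -/

/-- The equilibrium state `m_{-l}`. -/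
def edgeState (G : FiniteGraph V k) (l : Fin k → ℝ) : Measure G.shiftSpace :=
  G.equilibriumState (fun x => -G.edgeFun l x)

/-- The tangent space at `l`: functions on the edges with `∫ φ dm_{-l} = 0`. -/
def tangentSpace (G : FiniteGraph V k) (l : Fin k → ℝ) : Set (Fin k → ℝ) :=
  {φ | ∫ x, G.edgeFun φ x ∂(G.edgeState l) = 0}

/-- The pressure metric `‖φ‖²_P = Var(φ, m_{-l})`. -/
def pressureNormSq (G : FiniteGraph V k) (l φ : Fin k → ℝ) : ℝ :=
  G.variance (G.edgeFun φ) (G.edgeState l)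

/-- The inner product obtained from `‖·‖²_P` by polarization. -/
def pressureInner (G : FiniteGraph V k) (l φ ψ : Fin k → ℝ) : ℝ :=
  (G.pressureNormSq l (φ + ψ) - G.pressureNormSq l φ - G.pressureNormSq l ψ) / 2

/-- The length `L_P(γ) = ∫₀¹ ‖γ'(t)‖_P dt` of a curve on `[0, 1]`. -/
def pressureLength (G : FiniteGraph V k) (γ : ℝ → Fin k → ℝ) : ℝ≥0∞ :=
  ∫⁻ t in Icc (0 : ℝ) 1,
    ENNReal.ofReal (Real.sqrt (G.pressureNormSq (γ t) (derivWithin γ (Icc 0 1) t)))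

/-- `γ` is a continuously differentiable curve `[0, 1] → M¹_G` from `l₁` to `l₂`. -/
def IsModuliCurve (G : FiniteGraph V k) (γ : ℝ → Fin k → ℝ) (l₁ l₂ : Fin k → ℝ) : Prop :=
  ContDiffOn ℝ 1 γ (Icc 0 1) ∧ MapsTo γ (Icc 0 1) G.moduliSpace ∧ γ 0 = l₁ ∧ γ 1 = l₂

/-- The path distance `d_P(l₁, l₂)`: the infimum of the lengths of continuously differentiable
curves in `M¹_G` from `l₁` to `l₂`. -/
def pressureDist (G : FiniteGraph V k) (l₁ l₂ : Fin k → ℝ) : ℝ≥0∞ :=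
  ⨅ (γ : ℝ → Fin k → ℝ) (_ : G.IsModuliCurve γ l₁ l₂), G.pressureLength γ

/-- `(M¹_G, d_P)` is complete: every Cauchy sequence has a limit in `M¹_G`. -/
def IsPressureComplete (G : FiniteGraph V k) : Prop :=
  ∀ u : ℕ → Fin k → ℝ, (∀ n, u n ∈ G.moduliSpace) →
    (∀ ε : ℝ≥0∞, 0 < ε → ∃ N, ∀ m ≥ N, ∀ n ≥ N, G.pressureDist (u m) (u n) < ε) →
    ∃ l ∈ G.moduliSpace, Tendsto (fun n => G.pressureDist (u n) l) atTop (𝓝 0)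

end FiniteGraph

/-! ## Gaussian curvature of a metric in two coordinates -/

/-- The partial derivative `∂ᵢ f` at `p`. -/
def partialDeriv {F : Type*} [NormedAddCommGroup F] [NormedSpace ℝ F] (i : Fin 2)
    (f : (Fin 2 → ℝ) → F) (p : Fin 2 → ℝ) : F :=
  deriv (fun t => f (Function.update p i t)) (p i)

/-- The Christoffel symbols
`Γᵏᵢⱼ = ½ ∑ₘ gᵏᵐ (∂ᵢ gⱼₘ + ∂ⱼ gᵢₘ - ∂ₘ gᵢⱼ)` of the Levi-Civita connection. -/
def christoffel (g : (Fin 2 → ℝ) → Matrix (Fin 2) (Fin 2) ℝ) (k i j : Fin 2)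
    (p : Fin 2 → ℝ) : ℝ :=
  1 / 2 * ∑ m, (g p)⁻¹ k m * (partialDeriv i (fun q => g q j m) p +
    partialDeriv j (fun q => g q i m) p - partialDeriv m (fun q => g q i j) p)

/-- The `l`-th component of the curvature tensor `R(∂ᵢ, ∂ⱼ)∂ₖ = ∇ᵢ∇ⱼ∂ₖ - ∇ⱼ∇ᵢ∂ₖ`. -/
def riemannTensor (g : (Fin 2 → ℝ) → Matrix (Fin 2) (Fin 2) ℝ) (l i j k : Fin 2)
    (p : Fin 2 → ℝ) : ℝ :=
  partialDeriv i (christoffel g l j k) p - partialDeriv j (christoffel g l i k) p +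
    ∑ m, (christoffel g m j k p * christoffel g l i m p -
      christoffel g m i k p * christoffel g l j m p)

/-- The Gaussian curvature `⟨R(∂₁, ∂₂)∂₂, ∂₁⟩ / det g`. -/
def gaussianCurvature (g : (Fin 2 → ℝ) → Matrix (Fin 2) (Fin 2) ℝ) (p : Fin 2 → ℝ) : ℝ :=
  (∑ l, g p 0 l * riemannTensor g l 0 1 1 p) / (g p).det

/-! ## The belt buckle -/

/-- The belt buckle: two vertices joined by three edges. -/
def beltBuckle : FiniteGraph (Fin 2) 3 where
  src _ := 0
  tgt _ := 1

/-- The parametrization `(x, y) ↦ (x, y, S(x, y))`,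
`S(x, y) = -log ((e^{x+y} - 1) / (e^x + e^y + 2))`. -/
def beltChart (p : Fin 2 → ℝ) : Fin 3 → ℝ :=
  ![p 0, p 1,
    -Real.log ((Real.exp (p 0 + p 1) - 1) / (Real.exp (p 0) + Real.exp (p 1) + 2))]

/-- The first fundamental form of the pressure metric in the coordinates `(x, y)`. -/
def beltMetric (p : Fin 2 → ℝ) : Matrix (Fin 2) (Fin 2) ℝ :=
  Matrix.of fun i j => beltBuckle.pressureInner (beltChart p)
    (partialDeriv i beltChart p) (partialDeriv j beltChart p)

/-- The Gaussian curvature of the pressure metric in the coordinates `(x, y)`. -/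
def beltCurvature (p : Fin 2 → ℝ) : ℝ := gaussianCurvature beltMetric p

/-- The quotient of polynomials in `a = e^x`, `b = e^y` that expresses the curvature. -/
def beltCurvatureFormula (a b : ℝ) : ℝ :=
  (5 + 6 * a + 3 * a ^ 2 + 6 * b + 3 * b ^ 2 + 3 * (a * b) + 45 * (a ^ 2 * b ^ 2)
    + 19 * (a ^ 3 * b ^ 3) + 11 * (a ^ 2 * b) + 9 * (a ^ 3 * b) + 3 * (a ^ 4 * b)
    + 11 * (a * b ^ 2) + 33 * (a ^ 3 * b ^ 2) + 8 * (a ^ 4 * b ^ 2) + 9 * (a * b ^ 3)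
    + 33 * (a ^ 2 * b ^ 3) + 3 * (a ^ 4 * b ^ 3) + 3 * (a * b ^ 4) + 8 * (a ^ 2 * b ^ 4)
    + 3 * (a ^ 3 * b ^ 4)) /
  (4 * (a + 1) ^ 2 * (b + 1) ^ 2 * (3 * (a * b) + a ^ 2 * b + a * b ^ 2 - 1))

/-- The diagonal path `c(x) = (x, x, S(x, x))`. -/
def beltDiagonal (x : ℝ) : Fin 3 → ℝ := beltChart ![x, x]

end

/-! ### The subshift of the belt buckle and its two-to-one shift. -/

noncomputable section

namespace BeltBuckle

/-! Everything becomes explicit in terms of the weights `q_i = 1 / (1 + e^{l_i})`, and the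
pressure-zero condition is `q_0 + q_1 + q_2 = 1`. The sign of the lengths plays no role in the
analysis of the transfer operator, which is why it also covers points with `S(x, y) ≤ 0`.

Equilibrium state. Since `e^{-l_i} (1 - q_i) = q_i` and the two neighbours of an edge `i` have total
weight `1 - q_i`, the function `1 - q_{x_0}` is fixed by the transfer operator. Continuous fixed
functions are unique up to a scalar by a maximum principle (`eigenfunction_unique`). The
eigenmeasure is the law of a Markov chain that passes from `i` to `j` with probability `q_j / (1 -
q_i)` (`isEigenmeasure_eigenmeasure`), and it is unique because its values on cylinders are forced
(`IsEigenmeasure.unique`).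

Variance. A centred edge function is a reverse martingale difference plus a coboundary, both
depending on at most two edges. Hence the variance exists and equals `∑ w_i (1 - 2 q_i) φ_i²` for
centred `φ`, with `w_i` proportional to `q_i (1 - q_i)` (`tendsto_varianceSeq`).

Entropy. The function `q_d e^T` solves the homogeneous part of the renewal recursion for the number
of paths from `d` of length less than `T`. The number of closed cycles is therefore between constant
multiples of `e^T` and `T e^T`, and scaling shows that entropy one is equivalent to `∑ q_i = 1`
(`mem_moduliSpace_iff`).

Curvature. In `a = e^x`, `b = e^y` the metric coefficients are rational functions with a common
denominator, and Brioschi's formula reduces the curvature to one polynomial identity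
(`metricBrioschi_mul`). After `a = 1 + s`, `b = 1 + t` the inequalities behind the bounds and the
limit have only positive coefficients.

Incompleteness. On the diagonal the speed is at most `x^{-1/2}`, so the points with `x → 0` form
Cauchy sequences. The function `2 q_2 (1 - q_2)` is 1-Lipschitz for `d_P`, positive on the moduli
space, and tends to `0` along the diagonal, so no limit exists. -/

/-- The directed edges that may precede, or follow, the directed edge `d`, numbered by `Bool`. -/
def nbr (k : Bool) (d : Fin 3 × Bool) : Fin 3 × Bool := (d.1 + (if k then 1 else 2), !d.2)

lemma follows_iff (d d' : Fin 3 × Bool) :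
    beltBuckle.Follows d d' ↔ d'.1 ≠ d.1 ∧ d'.2 = !d.2 := by
  obtain ⟨i, b⟩ := d
  obtain ⟨j, c⟩ := d'
  cases b <;> cases c <;>
    simp [FiniteGraph.Follows, FiniteGraph.init, FiniteGraph.term, beltBuckle]

instance : DecidableRel beltBuckle.Follows := fun d d' => decidable_of_iff' _ (follows_iff d d')

lemma follows_nbr (k : Bool) (d : Fin 3 × Bool) : beltBuckle.Follows d (nbr k d) := by
  revert k d; decide

lemma nbr_follows (k : Bool) (d : Fin 3 × Bool) : beltBuckle.Follows (nbr k d) d := by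
  revert k d; decide

lemma nbr_not_nbr (k : Bool) (d : Fin 3 × Bool) : nbr (!k) (nbr k d) = d := by
  revert k d; decide

lemma exists_eq_nbr_of_follows {d d' : Fin 3 × Bool} (h : beltBuckle.Follows d d') :
    ∃ k, d = nbr k d' := by
  revert d d'; decide

lemma nbr_ne (d : Fin 3 × Bool) : nbr true d ≠ nbr false d := by
  revert d; decide

/-- The sequences of the subshift. -/
abbrev Path := beltBuckle.shiftSpace

/-- The sequence `e x₀ x₁ …`. -/
def consEdge (e : Fin 3 × Bool) (x : Path) (h : beltBuckle.Follows e (x.1 0)) : Path :=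
  ⟨fun n => Nat.casesOn n e x.1, fun n => by cases n; exacts [h, x.2 _]⟩

/-- The two preimages of `x` under the shift. -/
def prepend (k : Bool) (x : Path) : Path := consEdge (nbr k (x.1 0)) x (nbr_follows _ _)

@[simp] lemma prepend_zero (k x) : (prepend k x).1 0 = nbr k (x.1 0) := rfl
@[simp] lemma shift_prepend (k x) : beltBuckle.shift (prepend k x) = x := rfl

lemma consEdge_shift (x : Path) : consEdge (x.1 0) (beltBuckle.shift x) (x.2 0) = x := by
  apply Subtype.ext
  funext n
  cases n <;> rfl

lemma consEdge_eq_prepend (e x h) : ∃ k, consEdge e x h = prepend k x := by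
  obtain ⟨k, rfl⟩ := exists_eq_nbr_of_follows h
  exact ⟨k, rfl⟩

lemma prepend_injective (x : Path) : Function.Injective fun k => prepend k x := by
  intro k k' h
  have h0 : nbr k (x.1 0) = nbr k' (x.1 0) := congrArg (fun y : Path => y.1 0) h
  have := nbr_ne (x.1 0)
  cases k <;> cases k' <;> first | rfl | (exact absurd h0 this) | (exact absurd h0.symm this)

/-- The fibre of the shift over `x` consists of exactly the two sequences `prepend k x`, so the
`finsum` is a finite sum and does not take its default value. -/
lemma transfer_eq (f w : Path → ℝ) (x : Path) :
    beltBuckle.transfer f w x = ∑ k, Real.exp (f (prepend k x)) * w (prepend k x) := by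
  classical
  have hset : {y : Path | beltBuckle.shift y = x} =
      ↑(Finset.univ.image fun k => prepend k x) := by
    ext y
    simp only [mem_ofPred_eq, Finset.coe_image, Finset.coe_univ, image_univ, mem_range]
    constructor
    · rintro rfl
      obtain ⟨k, hk⟩ := consEdge_eq_prepend (y.1 0) (beltBuckle.shift y) (y.2 0)
      exact ⟨k, by rw [← hk]; exact consEdge_shift y⟩
    · rintro ⟨k, rfl⟩
      rfl
  have : beltBuckle.transfer f w x =
      ∑ᶠ y ∈ {y : Path | beltBuckle.shift y = x}, Real.exp (f y) * w y := rfl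
  rw [this, hset, finsum_mem_coe_finset, Finset.sum_image (fun a _ b _ h => prepend_injective x h)]

instance : CompactSpace Path := by
  rw [← isCompact_iff_compactSpace]
  apply IsClosed.isCompact
  have : beltBuckle.shiftSpace = ⋂ n, {x : ℕ → Fin 3 × Bool | beltBuckle.Follows (x n) (x (n + 1))} := by
    ext; simp [FiniteGraph.shiftSpace]
  rw [Path, this]
  refine isClosed_iInter fun n => ?_
  have hc : Continuous fun x : ℕ → Fin 3 × Bool => (x n, x (n + 1)) := by fun_prop
  exact (isClosed_discrete {d : (Fin 3 × Bool) × (Fin 3 × Bool) | beltBuckle.Follows d.1 d.2}).preimage hc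

lemma continuous_coord (n : ℕ) : Continuous fun x : Path => x.1 n :=
  (continuous_apply n).comp continuous_subtype_val

lemma continuous_of_coord {α : Type*} [TopologicalSpace α] (g : Fin 3 × Bool → α) (n : ℕ) :
    Continuous fun x : Path => g (x.1 n) :=
  continuous_of_discreteTopology.comp (continuous_coord n)

lemma continuous_edgeFun (φ : Fin 3 → ℝ) : Continuous (beltBuckle.edgeFun φ) :=
  continuous_of_coord (fun d => φ d.1) 0

lemma continuous_shift : Continuous (beltBuckle.shift : Path → Path) :=
  Continuous.subtype_mk (continuous_pi fun n => continuous_coord (n + 1)) _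

lemma continuous_prepend (k : Bool) : Continuous (prepend k) := by
  refine Continuous.subtype_mk (continuous_pi fun n => ?_) _
  cases n with
  | zero => exact continuous_of_coord (nbr k) 0
  | succ n => exact continuous_coord n

/-- Any edge can be connected to any other within three steps. -/
lemma exists_connection (d e : Fin 3 × Bool) : beltBuckle.Follows d e ∨
    (∃ a, beltBuckle.Follows d a ∧ beltBuckle.Follows a e) ∨
    ∃ a b, beltBuckle.Follows d a ∧ beltBuckle.Follows a b ∧ beltBuckle.Follows b e := by
  revert d e; decide

instance : Nonempty Path :=
  ⟨⟨fun n => (if Even n then 0 else 1, decide (Even n)), fun n => by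
    rw [follows_iff]
    by_cases h : Even n <;> simp [h, Nat.even_add_one]⟩⟩

/-- A set of sequences that is closed under prepending edges is dense. -/
lemma dense_of_forall_prepend_mem {M : Set Path} (hne : M.Nonempty)
    (hM : ∀ x ∈ M, ∀ k, prepend k x ∈ M) : Dense M := by
  have hcons : ∀ x ∈ M, ∀ e h, consEdge e x h ∈ M := by
    intro x hx e h
    obtain ⟨k, hk⟩ := consEdge_eq_prepend e x h
    exact hk ▸ hM x hx k
  have hstart : ∀ e, ∃ y ∈ M, y.1 0 = e := by
    intro e
    obtain ⟨x, hx⟩ := hne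
    rcases exists_connection e (x.1 0) with h | ⟨a, h1, h2⟩ | ⟨a, b, h1, h2, h3⟩
    · exact ⟨_, hcons x hx e h, rfl⟩
    · exact ⟨_, hcons _ (hcons x hx a h2) e h1, rfl⟩
    · exact ⟨_, hcons _ (hcons _ (hcons x hx b h3) a h2) e h1, rfl⟩
  -- A prescribed prefix is built backwards: a connecting word gives a member of `M` with the right
  -- last letter of the prefix as first edge, and the remaining letters are prepended one at a time.
  have happrox : ∀ N (x : Path), ∃ y ∈ M, ∀ i ≤ N, y.1 i = x.1 i := by
    intro N
    induction N with
    | zero =>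
      intro x
      obtain ⟨y, hy, h⟩ := hstart (x.1 0)
      exact ⟨y, hy, fun i hi => by rw [Nat.le_zero.1 hi, h]⟩
    | succ N ih =>
      intro x
      obtain ⟨y, hy, h⟩ := ih (beltBuckle.shift x)
      have h0 : beltBuckle.Follows (x.1 0) (y.1 0) := by
        rw [h 0 (Nat.zero_le _)]; exact x.2 0
      refine ⟨_, hcons y hy (x.1 0) h0, fun i hi => ?_⟩
      cases i with
      | zero => rfl
      | succ i => exact h i (by omega)
  intro x
  choose y hy h using fun N => happrox N x
  refine mem_closure_of_tendsto (f := y) (b := atTop) ?_ (Eventually.of_forall hy)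
  rw [tendsto_subtype_rng, tendsto_pi_nhds]
  intro i
  refine tendsto_const_nhds.congr' ?_
  filter_upwards [eventually_ge_atTop i] with N hN
  exact (h N i hN).symm

/-- The weight `1 / (1 + e^{l_i})` of an edge. -/
def edgeProb (l : Fin 3 → ℝ) (i : Fin 3) : ℝ := 1 / (1 + Real.exp (l i))

section EdgeProb

variable (l : Fin 3 → ℝ) (i : Fin 3)

lemma edgeProb_pos : 0 < edgeProb l i := by unfold edgeProb; positivity

lemma edgeProb_lt_one : edgeProb l i < 1 := by
  unfold edgeProb
  rw [div_lt_one (by positivity)]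
  linarith [Real.exp_pos (l i)]

lemma one_sub_edgeProb_pos : 0 < 1 - edgeProb l i := sub_pos.2 (edgeProb_lt_one l i)

lemma exp_neg_eq_edgeProb : Real.exp (-l i) = edgeProb l i / (1 - edgeProb l i) := by
  have h := Real.exp_pos (l i)
  rw [Real.exp_neg, eq_div_iff (one_sub_edgeProb_pos l i).ne', edgeProb]
  field_simp
  ring

/-- The algebraic identity behind the eigenfunction, the Markov chain and the path count. -/
lemma exp_neg_mul_one_sub : Real.exp (-l i) * (1 - edgeProb l i) = edgeProb l i := by
  rw [exp_neg_eq_edgeProb, div_mul_cancel₀ _ (one_sub_edgeProb_pos l i).ne']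

end EdgeProb

/-- The two neighbours carry the remaining weight. -/
lemma sum_nbr {φ : Fin 3 → ℝ} (d : Fin 3 × Bool) :
    ∑ k, φ (nbr k d).1 = ∑ i, φ i - φ d.1 := by
  obtain ⟨i, b⟩ := d
  fin_cases i <;> simp [nbr, Fin.sum_univ_three] <;> ring

end BeltBuckle
end

/-! ### Eigenfunctions of the transfer operator and uniqueness of the eigenmeasure. -/

noncomputable section

namespace BeltBuckle

/-- The potential `-l` on the subshift. -/
abbrev potential (l : Fin 3 → ℝ) : Path → ℝ := fun x => -beltBuckle.edgeFun l x

lemma transfer_potential (l : Fin 3 → ℝ) (w : Path → ℝ) (x : Path) :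
    beltBuckle.transfer (potential l) w x =
      ∑ k, Real.exp (-l (nbr k (x.1 0)).1) * w (prepend k x) := transfer_eq _ _ _

/-- The standard eigenfunction of the transfer operator. -/
def eigenfun (l : Fin 3 → ℝ) : C(Path, ℝ) :=
  ⟨fun x => 1 - edgeProb l (x.1 0).1, continuous_of_coord (fun d => 1 - edgeProb l d.1) 0⟩

lemma eigenfun_apply (l : Fin 3 → ℝ) (x : Path) : eigenfun l x = 1 - edgeProb l (x.1 0).1 := rfl

lemma eigenfun_pos (l : Fin 3 → ℝ) (x : Path) : 0 < eigenfun l x := one_sub_edgeProb_pos _ _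

lemma sum_edgeProb_nbr {l : Fin 3 → ℝ} (hl : ∑ i, edgeProb l i = 1) (d : Fin 3 × Bool) :
    ∑ k, edgeProb l (nbr k d).1 = 1 - edgeProb l d.1 := by
  rw [sum_nbr, hl]

lemma transfer_eigenfun {l : Fin 3 → ℝ} (hl : ∑ i, edgeProb l i = 1) (x : Path) :
    beltBuckle.transfer (potential l) (eigenfun l) x = eigenfun l x := by
  rw [transfer_potential, eigenfun_apply, ← sum_edgeProb_nbr hl]
  exact Finset.sum_congr rfl fun k _ => exp_neg_mul_one_sub l _

/-- Maximum principle: the quotient `r` of `v` by the standard eigenfunction is, at each `x`, a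
strictly weighted average of its values at the two preimages of `x`. By compactness `r` attains its
maximum, and the set where it does is closed and stable under prepending, hence dense, hence
everything. -/
theorem eigenfunction_unique {l : Fin 3 → ℝ} (hl : ∑ i, edgeProb l i = 1) (v : C(Path, ℝ))
    (hv : ∀ x, beltBuckle.transfer (potential l) v x = v x) :
    ∃ c, ∀ x, v x = c * eigenfun l x := by
  set r : Path → ℝ := fun x => v x / eigenfun l x with hr
  have hrc : Continuous r := v.continuous.div (eigenfun l).continuous fun x => (eigenfun_pos l x).ne'
  have hvr : ∀ x, v x = r x * eigenfun l x := fun x =>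
    (div_mul_cancel₀ _ (eigenfun_pos l x).ne').symm
  obtain ⟨x₀, -, hx₀⟩ := isCompact_univ.exists_isMaxOn (univ_nonempty (α := Path)) hrc.continuousOn
  have hmax : ∀ x, r x ≤ r x₀ := fun x => hx₀ (mem_univ x)
  have hclosed : IsClosed {x | r x = r x₀} := isClosed_eq hrc continuous_const
  have hdense : Dense {x | r x = r x₀} := by
    refine dense_of_forall_prepend_mem ⟨x₀, rfl⟩ fun x (hx : r x = r x₀) k => ?_
    have h1 : ∑ k, edgeProb l (nbr k (x.1 0)).1 * (r x - r (prepend k x)) = 0 := by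
      have h2 : v x = ∑ k, edgeProb l (nbr k (x.1 0)).1 * r (prepend k x) := by
        rw [← hv x, transfer_potential]
        refine Finset.sum_congr rfl fun k _ => ?_
        rw [hvr, eigenfun_apply, prepend_zero]
        linear_combination r (prepend k x) * exp_neg_mul_one_sub l (nbr k (x.1 0)).1
      simp only [mul_sub, Finset.sum_sub_distrib]
      rw [← h2, ← Finset.sum_mul, sum_edgeProb_nbr hl, hvr, eigenfun_apply]
      ring
    have h3 := (Finset.sum_eq_zero_iff_of_nonneg fun k _ =>
      mul_nonneg (edgeProb_pos l _).le (sub_nonneg.2 (hx ▸ hmax _))).1 h1 k (Finset.mem_univ _)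
    have h4 := (mul_eq_zero.1 h3).resolve_left (edgeProb_pos l _).ne'
    change r (prepend k x) = r x₀
    linarith
  refine ⟨r x₀, fun x => ?_⟩
  have : x ∈ {x | r x = r x₀} := hclosed.closure_eq ▸ hdense x
  rw [hvr x, this]

/-- A probability measure with `L_{-l}^* μ = μ`. -/
structure IsEigenmeasure (l : Fin 3 → ℝ) (μ : Measure Path) : Prop where
  isProbabilityMeasure : IsProbabilityMeasure μ
  integral_transfer : ∀ w : C(Path, ℝ),
    ∫ x, beltBuckle.transfer (potential l) w x ∂μ = ∫ x, w x ∂μ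

/-- The sequences that start like `a`. -/
def cylinder (a : ℕ → Fin 3 × Bool) (N : ℕ) : Set Path := {x | ∀ i ≤ N, x.1 i = a i}

lemma isClopen_cylinder (a : ℕ → Fin 3 × Bool) (N : ℕ) : IsClopen (cylinder a N) := by
  have : cylinder a N = ⋂ i ∈ Finset.range (N + 1), {x : Path | x.1 i = a i} := by
    ext x; simp [cylinder]
  rw [this]
  exact isClopen_biInter_finset fun i _ => (isClopen_discrete {a i}).preimage (continuous_coord i)

lemma measurableSet_cylinder (a : ℕ → Fin 3 × Bool) (N : ℕ) : MeasurableSet (cylinder a N) :=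
  (isClopen_cylinder a N).isOpen.measurableSet

/-- The indicator function of a cylinder. -/
def cylinderFun (a : ℕ → Fin 3 × Bool) (N : ℕ) : C(Path, ℝ) :=
  ⟨(cylinder a N).indicator fun _ => 1, continuous_const.indicator
    fun x hx => by simp [(isClopen_cylinder a N).frontier_eq] at hx⟩

lemma integral_cylinderFun (μ : Measure Path) (a : ℕ → Fin 3 × Bool) (N : ℕ) :
    ∫ x, cylinderFun a N x ∂μ = μ.real (cylinder a N) :=
  integral_indicator_one (measurableSet_cylinder a N)

lemma cylinderFun_apply (a : ℕ → Fin 3 × Bool) (N : ℕ) (x : Path) [Decidable (∀ i ≤ N, x.1 i = a i)] :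
    cylinderFun a N x = if ∀ i ≤ N, x.1 i = a i then 1 else 0 := by
  classical
  change (cylinder a N).indicator (fun _ => (1 : ℝ)) x = _
  rw [indicator_apply]
  congr

lemma integrable_of_continuous (μ : Measure Path) [IsFiniteMeasure μ] {w : Path → ℝ}
    (hw : Continuous w) : Integrable w μ :=
  hw.integrable_of_hasCompactSupport (HasCompactSupport.of_compactSpace w)

namespace IsEigenmeasure

variable {l : Fin 3 → ℝ} {μ ν : Measure Path}

/-- The transfer operator turns the indicator of the longer cylinder into `e^{-l}` times that of the
shortened one: at most one of the two preimages starts with `a 0`, and it does so whenever `x`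
starts with `a 1`. -/
lemma real_cylinder_succ (hμ : IsEigenmeasure l μ) (a : ℕ → Fin 3 × Bool)
    (ha : beltBuckle.Follows (a 0) (a 1)) (N : ℕ) :
    μ.real (cylinder a (N + 1)) =
      Real.exp (-l (a 0).1) * μ.real (cylinder (fun n => a (n + 1)) N) := by
  classical
  rw [← integral_cylinderFun, ← hμ.integral_transfer, ← integral_cylinderFun, ← integral_const_mul]
  congr 1
  funext x
  rw [transfer_potential, cylinderFun_apply]
  have key : ∀ k, cylinderFun a (N + 1) (prepend k x) =
      if (nbr k (x.1 0) = a 0 ∧ ∀ i ≤ N, x.1 i = a (i + 1)) then 1 else 0 := by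
    intro k
    rw [cylinderFun_apply]
    congr 1
    refine propext ⟨fun h => ⟨h 0 (Nat.zero_le _), fun i hi => h (i + 1) (by omega)⟩, ?_⟩
    rintro ⟨h0, h⟩ i hi
    cases i with
    | zero => exact h0
    | succ i => exact h i (by omega)
  simp only [key]
  by_cases hx : ∀ i ≤ N, x.1 i = a (i + 1)
  · obtain ⟨k, hk⟩ := exists_eq_nbr_of_follows ha
    have hx0 : x.1 0 = a 1 := hx 0 (Nat.zero_le _)
    have hne := nbr_ne (a 1)
    simp only [hx0, hk, Fintype.sum_bool]
    cases k <;> simp [hne, hne.symm]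
  · simp [hx]

/-- A sequence has a preimage starting with `d` exactly when its first edge is one of the neighbours
of `d`. This gives a linear system for the law of the first edge. -/
lemma real_cylinder_zero (hμ : IsEigenmeasure l μ) (d : Fin 3 × Bool) :
    μ.real (cylinder (fun _ => d) 0) = Real.exp (-l d.1) *
      ∑ k, μ.real (cylinder (fun _ => nbr k d) 0) := by
  classical
  have := hμ.isProbabilityMeasure
  simp only [← integral_cylinderFun]
  rw [← hμ.integral_transfer, ← integral_finsetSum _ fun k _ =>
    integrable_of_continuous μ (cylinderFun _ 0).continuous, ← integral_const_mul]
  congr 1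
  funext x
  rw [transfer_potential]
  simp only [cylinderFun_apply, Nat.le_zero, forall_eq, prepend_zero]
  generalize x.1 0 = e
  have key : ∀ e d : Fin 3 × Bool, (∀ k, nbr k e = d ↔ e = nbr (!k) d) := by decide
  simp only [Fintype.sum_bool, key]
  have h1 : ∀ k, e = nbr k d → nbr (!k) e = d := by
    rintro k rfl; exact nbr_not_nbr k d
  by_cases ht : e = nbr true d
  · have hf : e ≠ nbr false d := ht ▸ nbr_ne d
    have := (key e d false).2 ht
    simp only [Bool.not_true, Bool.not_false, if_neg hf, if_pos ht, this]
    ring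
  · by_cases hf : e = nbr false d
    · have := (key e d true).2 hf
      simp only [Bool.not_true, Bool.not_false, if_neg ht, if_pos hf, this]
      ring
    · simp [ht, hf]

/-- The first edge has the distribution `edgeProb / 2`. -/
lemma real_cylinder_zero_eq (hμ : IsEigenmeasure l μ) (hl : ∑ i, edgeProb l i = 1)
    (d : Fin 3 × Bool) : μ.real (cylinder (fun _ => d) 0) = edgeProb l d.1 / 2 := by
  classical
  have := hμ.isProbabilityMeasure
  set u : Fin 3 × Bool → ℝ := fun d => μ.real (cylinder (fun _ => d) 0) with hu
  have hrec : ∀ d, u d = Real.exp (-l d.1) * ∑ k, u (nbr k d) := hμ.real_cylinder_zero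
  have htot : ∑ d, u d = 1 := by
    have h1 : ∀ x, ∑ d, cylinderFun (fun _ => d) 0 x = 1 := by
      intro x; simp [cylinderFun_apply]
    simp only [hu, ← integral_cylinderFun]
    rw [← integral_finsetSum _ fun d _ =>
      integrable_of_continuous μ (cylinderFun (fun _ => d) 0).continuous]
    simp [h1]
  have hz : ∀ i, Real.exp (-l i) * (1 - edgeProb l i) = edgeProb l i := exp_neg_mul_one_sub l
  have hq : ∀ i, edgeProb l i * (1 + Real.exp (-l i)) = Real.exp (-l i) := fun i => by
    linear_combination -hz i
  have hq1 : ∀ i, edgeProb l i = Real.exp (-l i) / (1 + Real.exp (-l i)) := fun i => by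
    rw [eq_div_iff (by positivity), hq]
  have hpos : ∀ i, 0 < Real.exp (-l i) := fun i => Real.exp_pos _
  generalize hZ : (fun i => Real.exp (-l i)) = z at *
  have hZ' : ∀ i, Real.exp (-l i) = z i := fun i => congrFun hZ i
  simp only [hZ'] at *
  have hlz := hl
  simp only [hq1, Fin.sum_univ_three] at hlz
  have h0 := hpos 0
  have h1 := hpos 1
  have h2 := hpos 2
  field_simp at hlz
  -- The pressure-zero condition `∑ q_i = 1` in terms of `z_i = e^{-l_i}`.
  have hrel : z 0 * z 1 + z 0 * z 2 + z 1 * z 2 + 2 * (z 0 * z 1 * z 2) = 1 := by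
    linear_combination hlz
  simp only [Fintype.sum_prod_type, Fin.sum_univ_three, Fintype.sum_bool] at htot
  have e0t := hrec (0, true)
  have e0f := hrec (0, false)
  have e1t := hrec (1, true)
  have e1f := hrec (1, false)
  have e2t := hrec (2, true)
  have e2f := hrec (2, false)
  simp [nbr] at e0t e0f e1t e1f e2t e2f
  -- Every step reverses the orientation, so the differences `δ_i = u (i, true) - u (i, false)`
  -- satisfy `δ_i = -z_i (δ_j + δ_k)`. By `hrel` this system has determinant `4 z_0 z_1 z_2 ≠ 0`,
  -- and the multipliers below are cofactors. The sums over both orientations are then fixed by the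
  -- total mass: each equals `z_i / (1 + z_i) = q_i`.
  have hdet : ∀ δ a : ℝ, 0 < a → 4 * a * δ = 0 → δ = 0 := fun δ a ha h => by
    simpa [ha.ne'] using h
  have hzpos : 0 < z 0 * z 1 * z 2 := by positivity
  have hd0 := hdet (u (0, true) - u (0, false)) _ hzpos (by
    linear_combination (1 - z 1 * z 2) * (e0t - e0f) - z 0 * (1 - z 2) * (e1t - e1f)
      - z 0 * (1 - z 1) * (e2t - e2f) + (u (0, true) - u (0, false)) * hrel)
  have hd1 := hdet (u (1, true) - u (1, false)) _ hzpos (by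
    linear_combination (1 - z 0 * z 2) * (e1t - e1f) - z 1 * (1 - z 2) * (e0t - e0f)
      - z 1 * (1 - z 0) * (e2t - e2f) + (u (1, true) - u (1, false)) * hrel)
  have hd2 := hdet (u (2, true) - u (2, false)) _ hzpos (by
    linear_combination (1 - z 1 * z 0) * (e2t - e2f) - z 2 * (1 - z 0) * (e1t - e1f)
      - z 2 * (1 - z 1) * (e0t - e0f) + (u (2, true) - u (2, false)) * hrel)
  change u d = _
  obtain ⟨i, b⟩ := d
  fin_cases i <;> cases b <;> simp only [Fin.zero_eta, Fin.mk_one, Fin.reduceFinMk, hq1] <;>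
    (try rw [eq_div_iff two_ne_zero, eq_div_iff (by positivity)])
  · linear_combination (-1 - z 0) * hd0 + e0t + e0f + z 0 * htot
  · linear_combination (1 + z 0) * hd0 + e0t + e0f + z 0 * htot
  · linear_combination (-1 - z 1) * hd1 + e1t + e1f + z 1 * htot
  · linear_combination (1 + z 1) * hd1 + e1t + e1f + z 1 * htot
  · linear_combination (-1 - z 2) * hd2 + e2t + e2f + z 2 * htot
  · linear_combination (1 + z 2) * hd2 + e2t + e2f + z 2 * htot

/-- The law of the first edge and the recursion for longer words determine the mass of every
cylinder, inadmissible words having empty cylinders. Cylinders give the finite-dimensional marginals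
of the image measures on the full product, and these determine the measures. -/
theorem unique (hμ : IsEigenmeasure l μ) (hν : IsEigenmeasure l ν) (hl : ∑ i, edgeProb l i = 1) :
    μ = ν := by
  classical
  have := hμ.isProbabilityMeasure
  have := hν.isProbabilityMeasure
  have hcyl : ∀ N a, μ (cylinder a N) = ν (cylinder a N) := by
    intro N a
    rw [← measureReal_eq_measureReal_iff]
    induction N generalizing a with
    | zero =>
      have : cylinder a 0 = cylinder (fun _ => a 0) 0 := by ext; simp [cylinder]
      rw [this, hμ.real_cylinder_zero_eq hl, hν.real_cylinder_zero_eq hl]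
    | succ N ih =>
      by_cases ha : beltBuckle.Follows (a 0) (a 1)
      · rw [hμ.real_cylinder_succ a ha, hν.real_cylinder_succ a ha, ih]
      · have : cylinder a (N + 1) = ∅ := by
          refine eq_empty_of_forall_notMem fun x hx => ha ?_
          rw [← hx 0 (by omega), ← hx 1 (by omega)]
          exact x.2 0
        simp [this]
  have hemb : MeasurableEmbedding (Subtype.val : Path → ℕ → Fin 3 × Bool) :=
    MeasurableEmbedding.subtype_coe
      (isCompact_iff_compactSpace.2 (inferInstance : CompactSpace Path)).isClosed.measurableSet
  have hmap : μ.map Subtype.val = ν.map Subtype.val := by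
    have : IsProbabilityMeasure (ν.map (Subtype.val : Path → ℕ → Fin 3 × Bool)) :=
      Measure.isProbabilityMeasure_map hemb.measurable.aemeasurable
    have : IsProbabilityMeasure (μ.map (Subtype.val : Path → ℕ → Fin 3 × Bool)) :=
      Measure.isProbabilityMeasure_map hemb.measurable.aemeasurable
    refine IsProjectiveLimit.unique (P := fun I => (ν.map Subtype.val).map I.restrict) ?_ fun _ => rfl
    refine (isProjectiveLimit_nat_iff' ?_ _ 0).2 fun n _ => ?_
    · intro I J hJI
      change _ = ((ν.map Subtype.val).map I.restrict).map
        (Finset.restrict₂ (π := fun _ => Fin 3 × Bool) hJI)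
      rw [Measure.map_map (by fun_prop) (by fun_prop), Finset.restrict₂_comp_restrict]
    · refine Measure.ext_of_singleton fun b => ?_
      have hb : (fun x : Path => (Finset.Iic n).restrict x.1) ⁻¹' {b} =
          -- The value at indices beyond `n` is arbitrary, since the cylinder only reads indices up
          -- to `n`.
          cylinder (fun i => if h : i ∈ Finset.Iic n then b ⟨i, h⟩ else b ⟨0, by simp⟩) n := by
        ext x
        simp only [mem_preimage, mem_singleton_iff, cylinder, mem_ofPred_eq]
        constructor
        · rintro rfl i hi
          simp [hi]
        · intro h
          funext i
          have := h i.1 (Finset.mem_Iic.1 i.2)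
          simp only [i.2, dif_pos] at this
          exact this
      have hm : Measurable fun x : ℕ → Fin 3 × Bool => (Finset.Iic n).restrict x := by fun_prop
      change (μ.map Subtype.val).map (Finset.Iic n).restrict {b} =
        (ν.map Subtype.val).map (Finset.Iic n).restrict {b}
      rw [Measure.map_map hm hemb.measurable, Measure.map_map hm hemb.measurable,
        Measure.map_apply (hm.comp hemb.measurable) (measurableSet_singleton b),
        Measure.map_apply (hm.comp hemb.measurable) (measurableSet_singleton b)]
      change μ ((fun x : Path => (Finset.Iic n).restrict x.1) ⁻¹' {b}) =
        ν ((fun x : Path => (Finset.Iic n).restrict x.1) ⁻¹' {b})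
      rw [hb]
      exact hcyl _ _
  rw [← hemb.comap_map μ, hmap, hemb.comap_map]

end IsEigenmeasure

end BeltBuckle
end

/-! ### Construction of the eigenmeasure as the law of a Markov chain. -/

noncomputable section

namespace BeltBuckle

/-- Prepending an independent coordinate preserves the infinite power of a measure. -/
lemma map_cons_prod_infinitePi {U : Type*} [MeasurableSpace U] (ρ : Measure U)
    [IsProbabilityMeasure ρ] :
    (ρ.prod (Measure.infinitePi fun _ : ℕ => ρ)).map
      (fun p : U × (ℕ → U) => (fun n => Nat.casesOn n p.1 p.2 : ℕ → U)) =
    Measure.infinitePi fun _ : ℕ => ρ := by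
  have hmeas : Measurable (fun p : U × (ℕ → U) => (fun n => Nat.casesOn n p.1 p.2 : ℕ → U)) := by
    refine measurable_pi_lambda _ fun n => ?_
    cases n with
    | zero => exact measurable_fst
    | succ n => exact (measurable_pi_apply n).comp measurable_snd
  refine Measure.eq_infinitePi _ fun s t ht => ?_
  classical
  set t' : ℕ → Set U := fun n => if n ∈ s then t n else univ with ht'
  have ht'm : ∀ n, MeasurableSet (t' n) := fun n => by
    by_cases h : n ∈ s <;> simp [ht', h, ht n]
  obtain ⟨N, hN⟩ : ∃ N, s ⊆ Finset.range (N + 1) :=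
    ⟨s.sup id, fun n hn => Finset.mem_range.2 (Nat.lt_succ_of_le (Finset.le_sup (f := id) hn))⟩
  have hset : (s : Set ℕ).pi t = (Finset.range (N + 1) : Set ℕ).pi t' := by
    ext x
    simp only [Set.mem_pi, Finset.mem_coe, ht']
    refine ⟨fun h n _ => ?_, fun h n hn => by simpa [hn] using h n (hN hn)⟩
    by_cases hn : n ∈ s <;> simp [hn, h n]
  have hprod : ∏ i ∈ s, ρ (t i) = ∏ i ∈ Finset.range (N + 1), ρ (t' i) := by
    rw [← Finset.prod_subset hN (fun n _ hn => by simp [ht', hn])]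
    exact Finset.prod_congr rfl fun n hn => by simp [ht', hn]
  rw [hset, hprod, Measure.map_apply hmeas
    (MeasurableSet.pi (Finset.countable_toSet _) fun n _ => ht'm n)]
  have hpre : (fun p : U × (ℕ → U) => (fun n => Nat.casesOn n p.1 p.2 : ℕ → U)) ⁻¹'
      (Finset.range (N + 1) : Set ℕ).pi t' =
      t' 0 ×ˢ (Finset.range N : Set ℕ).pi fun n => t' (n + 1) := by
    ext p
    simp only [mem_preimage, Set.mem_pi, Finset.mem_coe, Finset.mem_range, mem_prod]
    refine ⟨fun h => ⟨h 0 (by omega), fun n hn => h (n + 1) (by omega)⟩, ?_⟩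
    rintro ⟨h0, h⟩ n hn
    cases n with
    | zero => exact h0
    | succ n => exact h n (by omega)
  rw [hpre, Measure.prod_prod, Measure.infinitePi_pi _ fun n _ => ht'm (n + 1),
    Finset.prod_range_succ', mul_comm]

/-- The probability of passing from the edge `d` to its neighbour `nbr k d`. -/
def stepProb (l : Fin 3 → ℝ) (d : Fin 3 × Bool) (k : Bool) : ℝ :=
  edgeProb l (nbr k d).1 / (1 - edgeProb l d.1)

lemma stepProb_pos (l : Fin 3 → ℝ) (d : Fin 3 × Bool) (k : Bool) : 0 < stepProb l d k :=
  div_pos (edgeProb_pos _ _) (one_sub_edgeProb_pos _ _)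

lemma sum_stepProb {l : Fin 3 → ℝ} (hl : ∑ i, edgeProb l i = 1) (d : Fin 3 × Bool) :
    ∑ k, stepProb l d k = 1 := by
  simp only [stepProb]
  rw [← Finset.sum_div, sum_edgeProb_nbr hl, div_self (one_sub_edgeProb_pos _ _).ne']

/-- The law of the choice of a neighbour of an edge numbered `i`. -/
def choiceMeasure (l : Fin 3 → ℝ) (i : Fin 3) : Measure Bool :=
  ∑ k, ENNReal.ofReal (stepProb l (i, true) k) • Measure.dirac k

lemma isProbabilityMeasure_choiceMeasure {l : Fin 3 → ℝ} (hl : ∑ i, edgeProb l i = 1)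
    (i : Fin 3) : IsProbabilityMeasure (choiceMeasure l i) := by
  constructor
  simp only [choiceMeasure, Measure.coe_finsetSum, Finset.sum_apply, Measure.smul_apply,
    measure_univ, smul_eq_mul, mul_one]
  rw [← ENNReal.ofReal_sum_of_nonneg fun k _ => (stepProb_pos _ _ _).le, sum_stepProb hl,
    ENNReal.ofReal_one]

lemma integral_choiceMeasure (l : Fin 3 → ℝ) (d : Fin 3 × Bool) (h : Bool → ℝ) :
    ∫ k, h k ∂choiceMeasure l d.1 = ∑ k, stepProb l d k * h k := by
  rw [choiceMeasure, integral_finsetSum_measure fun k _ =>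
    (integrable_dirac (by simp)).smul_measure ENNReal.ofReal_ne_top]
  refine Finset.sum_congr rfl fun k _ => ?_
  rw [integral_smul_measure, integral_dirac, ENNReal.toReal_ofReal (stepProb_pos _ _ _).le]
  rfl

/-- The edge reached from `d` after `n` random choices. -/
def randomEdge (d : Fin 3 × Bool) (ω : ℕ → Fin 3 → Bool) : ℕ → Fin 3 × Bool
  | 0 => d
  | n + 1 => nbr (ω n (randomEdge d ω n).1) (randomEdge d ω n)

/-- The random path that starts with `d`. -/
def randomPath (d : Fin 3 × Bool) (ω : ℕ → Fin 3 → Bool) : Path :=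
  ⟨randomEdge d ω, fun _ => follows_nbr _ _⟩

lemma continuous_randomPath (d : Fin 3 × Bool) : Continuous (randomPath d) := by
  refine Continuous.subtype_mk (continuous_pi fun n => ?_) _
  induction n with
  | zero => exact continuous_const
  | succ n ih =>
    have : Continuous fun ω : ℕ → Fin 3 → Bool => (ω n, randomEdge d ω n) :=
      (continuous_apply n).prodMk ih
    exact (continuous_of_discreteTopology
      (f := fun p : (Fin 3 → Bool) × (Fin 3 × Bool) => nbr (p.1 p.2.1) p.2)).comp this

/-- The chain is driven by independent choices: at each time one choice is drawn for every edge
number, and only the choice for the current edge is used. Splitting off the first draw leaves a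
random path from the second edge; `d` is recovered as the neighbour of that edge with the opposite
label. -/
lemma randomPath_cons (d : Fin 3 × Bool) (u : Fin 3 → Bool) (ω : ℕ → Fin 3 → Bool) :
    randomPath d (fun n => Nat.casesOn n u ω) =
      prepend (!u d.1) (randomPath (nbr (u d.1) d) ω) := by
  have key : ∀ n, randomEdge d (fun n => Nat.casesOn n u ω) (n + 1) =
      randomEdge (nbr (u d.1) d) ω n := by
    intro n
    induction n with
    | zero => rfl
    | succ n ih => rw [randomEdge, ih]; rfl
  apply Subtype.ext
  funext n
  cases n with
  | zero => exact (nbr_not_nbr _ _).symm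
  | succ n => exact key n

section RandomMeasure

variable {l : Fin 3 → ℝ}

/-- The law of one random choice for each of the three edges. -/
def choicesMeasure (l : Fin 3 → ℝ) : Measure (Fin 3 → Bool) := Measure.pi (choiceMeasure l)

/-- The expectation of `w` along the random path from `d`. -/
def pathIntegral (l : Fin 3 → ℝ) (d : Fin 3 × Bool) (w : Path → ℝ) : ℝ :=
  ∫ ω, w (randomPath d ω) ∂Measure.infinitePi fun _ : ℕ => choicesMeasure l

/-- First-step decomposition: the product measure is invariant under prepending an independent draw,
and Fubini integrates over that draw first. -/
lemma pathIntegral_eq (hl : ∑ i, edgeProb l i = 1) (d : Fin 3 × Bool) {w : Path → ℝ}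
    (hw : Continuous w) : pathIntegral l d w =
      ∑ k, stepProb l d k * pathIntegral l (nbr k d) fun x => w (prepend (!k) x) := by
  have := isProbabilityMeasure_choiceMeasure hl
  have : IsProbabilityMeasure (choicesMeasure l) := by unfold choicesMeasure; infer_instance
  have hcons : Continuous (fun p : (Fin 3 → Bool) × (ℕ → Fin 3 → Bool) =>
      (fun n => Nat.casesOn n p.1 p.2 : ℕ → Fin 3 → Bool)) := by
    refine continuous_pi fun n => ?_
    cases n with
    | zero => exact continuous_fst
    | succ n => exact (continuous_apply n).comp continuous_snd
  have hwc : Continuous fun ω => w (randomPath d ω) := hw.comp (continuous_randomPath d)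
  rw [pathIntegral, ← map_cons_prod_infinitePi, integral_map hcons.aemeasurable
    hwc.aestronglyMeasurable, integral_prod]
  · have hG : ∫ k, pathIntegral l (nbr k d) (fun x => w (prepend (!k) x)) ∂choiceMeasure l d.1 =
        ∫ u, pathIntegral l (nbr (u d.1) d) (fun x => w (prepend (!u d.1) x))
          ∂choicesMeasure l := by
      rw [← (measurePreserving_eval (choiceMeasure l) d.1).map_eq]
      exact integral_map (measurable_pi_apply _).aemeasurable
        continuous_of_discreteTopology.aestronglyMeasurable
    rw [← integral_choiceMeasure, hG]
    exact integral_congr_ae (.of_forall fun u => integral_congr_ae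
      (.of_forall fun ω => congrArg w (randomPath_cons d u ω)))
  · exact (hwc.comp hcons).integrable_of_hasCompactSupport (HasCompactSupport.of_compactSpace _)

/-- The eigenmeasure of `L_{-l}`, as the law of a random path. -/
def eigenmeasure (l : Fin 3 → ℝ) : Measure Path :=
  ∑ d : Fin 3 × Bool, ENNReal.ofReal (edgeProb l d.1 / 2) •
    (Measure.infinitePi fun _ : ℕ => choicesMeasure l).map (randomPath d)

lemma isEigenmeasure_eigenmeasure (hl : ∑ i, edgeProb l i = 1) :
    IsEigenmeasure l (eigenmeasure l) := by
  have := isProbabilityMeasure_choiceMeasure hl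
  have : IsProbabilityMeasure (choicesMeasure l) := by unfold choicesMeasure; infer_instance
  have hprob : ∀ d, IsProbabilityMeasure
      ((Measure.infinitePi fun _ : ℕ => choicesMeasure l).map (randomPath d)) := fun d =>
    Measure.isProbabilityMeasure_map (continuous_randomPath d).aemeasurable
  have hint : ∀ w : Path → ℝ, Continuous w → ∫ x, w x ∂eigenmeasure l =
      ∑ d : Fin 3 × Bool, edgeProb l d.1 / 2 * pathIntegral l d w := by
    intro w hw
    rw [eigenmeasure, integral_finsetSum_measure fun d _ =>
      (integrable_of_continuous _ hw).smul_measure ENNReal.ofReal_ne_top]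
    refine Finset.sum_congr rfl fun d _ => ?_
    rw [integral_smul_measure, integral_map (continuous_randomPath d).aemeasurable
      hw.aestronglyMeasurable, ENNReal.toReal_ofReal (half_pos (edgeProb_pos _ _)).le]
    rfl
  refine ⟨⟨?_⟩, fun w => ?_⟩
  · simp only [eigenmeasure, Measure.coe_finsetSum, Finset.sum_apply, Measure.smul_apply,
      measure_univ, smul_eq_mul, mul_one]
    rw [← ENNReal.ofReal_sum_of_nonneg fun d _ => (half_pos (edgeProb_pos _ _)).le]
    have h2 : ∀ x, 2 * (edgeProb l x / 2) = edgeProb l x := fun x => by ring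
    simp [Fintype.sum_prod_type, h2, hl]
  · have hL : Continuous fun x : Path => beltBuckle.transfer (potential l) w x := by
      simp only [transfer_potential]
      exact continuous_finsetSum _ fun k _ =>
        (continuous_of_coord (fun d => Real.exp (-l (nbr k d).1)) 0).mul
          (w.continuous.comp (continuous_prepend k))
    rw [hint _ hL, hint _ w.continuous]
    have h1 : ∀ d, pathIntegral l d (fun x => beltBuckle.transfer (potential l) w x) =
        ∑ k, Real.exp (-l (nbr k d).1) * pathIntegral l d fun x => w (prepend k x) := by
      intro d
      simp only [pathIntegral, transfer_potential]
      rw [integral_finsetSum]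
      · refine Finset.sum_congr rfl fun k _ => ?_
        rw [← integral_const_mul]
        rfl
      · intro k _
        refine Continuous.integrable_of_hasCompactSupport ?_ (HasCompactSupport.of_compactSpace _)
        change Continuous fun ω => Real.exp (-l (nbr k d).1) * w (prepend k (randomPath d ω))
        exact continuous_const.mul ((w.continuous.comp (continuous_prepend k)).comp
          (continuous_randomPath d))
    simp only [h1, pathIntegral_eq hl _ w.continuous, Finset.mul_sum]
    rw [← Fintype.sum_prod_type', ← Fintype.sum_prod_type']
    -- Reversing the step from `d` to `nbr k d` matches the two double sums term by term. The terms
    -- agree because, with `i` and `j` the numbers of `d` and `nbr k d`, both coefficients are `q_i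
    -- q_j / (2 (1 - q_j))`.
    have hinv : Function.Involutive fun p : (Fin 3 × Bool) × Bool => (nbr p.2 p.1, !p.2) :=
      fun p => by simp [nbr_not_nbr]
    refine Fintype.sum_equiv hinv.toPerm _ _ fun p => ?_
    obtain ⟨d, k⟩ := p
    simp only [Function.Involutive.coe_toPerm, nbr_not_nbr, Bool.not_not, stepProb]
    rw [exp_neg_eq_edgeProb]
    ring

end RandomMeasure

end BeltBuckle
end

/-! ### The equilibrium state and the variance of edge functions. -/

noncomputable section

namespace BeltBuckle

variable {l : Fin 3 → ℝ}

/-- The equilibrium state of `-l`, for `l` of pressure zero. -/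
def stdState (l : Fin 3 → ℝ) : Measure Path :=
  (ENNReal.ofReal (∫ x, eigenfun l x ∂eigenmeasure l))⁻¹ •
    (eigenmeasure l).withDensity fun x => ENNReal.ofReal (eigenfun l x)

/-- The normalising constant `∑ qᵢ (1 - qᵢ)`. -/
def totalWeight (l : Fin 3 → ℝ) : ℝ := ∑ i, edgeProb l i * (1 - edgeProb l i)

lemma totalWeight_pos (l : Fin 3 → ℝ) : 0 < totalWeight l :=
  Finset.sum_pos (fun i _ => mul_pos (edgeProb_pos l i) (one_sub_edgeProb_pos l i))
    Finset.univ_nonempty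

lemma integral_edgeFun_eigenmeasure (hl : ∑ i, edgeProb l i = 1) (φ : Fin 3 → ℝ) :
    ∫ x, φ (x.1 0).1 ∂eigenmeasure l = ∑ i, edgeProb l i * φ i := by
  classical
  have hμ := isEigenmeasure_eigenmeasure hl
  have := hμ.isProbabilityMeasure
  have h1 : ∀ x : Path, φ (x.1 0).1 = ∑ d, φ d.1 * cylinderFun (fun _ => d) 0 x := by
    intro x; simp [cylinderFun_apply]
  simp only [h1]
  rw [integral_finsetSum _ fun d _ => (integrable_of_continuous _
    (cylinderFun (fun _ => d) 0).continuous).const_mul _]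
  simp only [integral_const_mul, integral_cylinderFun, hμ.real_cylinder_zero_eq hl,
    Fintype.sum_prod_type, Fintype.sum_bool]
  exact Finset.sum_congr rfl fun i _ => by ring

lemma integral_eigenfun (hl : ∑ i, edgeProb l i = 1) :
    ∫ x, eigenfun l x ∂eigenmeasure l = totalWeight l :=
  integral_edgeFun_eigenmeasure hl fun i => 1 - edgeProb l i

lemma isEquilibriumState_stdState (hl : ∑ i, edgeProb l i = 1) :
    beltBuckle.IsEquilibriumState (potential l) (stdState l) :=
  ⟨eigenfun l, eigenmeasure l, (isEigenmeasure_eigenmeasure hl).isProbabilityMeasure,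
    eigenfun_pos l, transfer_eigenfun hl, (isEigenmeasure_eigenmeasure hl).integral_transfer, rfl⟩

/-- The eigenmeasure is unique and the eigenfunction is unique up to a positive factor, which
cancels in the normalisation. -/
theorem eq_stdState_of_isEquilibriumState (hl : ∑ i, edgeProb l i = 1) {m : Measure Path}
    (hm : beltBuckle.IsEquilibriumState (potential l) m) : m = stdState l := by
  obtain ⟨v, μ, hμp, hvpos, hv, hμ, rfl⟩ := hm
  obtain rfl : μ = eigenmeasure l :=
    IsEigenmeasure.unique ⟨hμp, hμ⟩ (isEigenmeasure_eigenmeasure hl) hl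
  obtain ⟨c, hc⟩ := eigenfunction_unique hl v hv
  have hc0 : 0 < c := by
    have x : Path := Classical.arbitrary _
    have := hvpos x
    rw [hc] at this
    exact pos_of_mul_pos_left this (eigenfun_pos l x).le
  have hV := totalWeight_pos l
  simp only [hc, integral_const_mul, ENNReal.ofReal_mul hc0.le, stdState, integral_eigenfun hl]
  have : (fun x => ENNReal.ofReal c * ENNReal.ofReal (eigenfun l x)) =
      ENNReal.ofReal c • fun x => ENNReal.ofReal (eigenfun l x) := rfl
  rw [this, withDensity_smul _ (eigenfun l).continuous.measurable.ennreal_ofReal, smul_smul,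
    ENNReal.mul_inv (.inr ENNReal.ofReal_ne_top) (.inl ENNReal.ofReal_ne_top), mul_comm,
    ← mul_assoc, ENNReal.mul_inv_cancel (by simpa using hc0) ENNReal.ofReal_ne_top, one_mul]

theorem existsUnique_isEquilibriumState (hl : ∑ i, edgeProb l i = 1) :
    ∃! m, beltBuckle.IsEquilibriumState (potential l) m :=
  ⟨_, isEquilibriumState_stdState hl, fun _ hm => eq_stdState_of_isEquilibriumState hl hm⟩

/-- Existence makes the `epsilon` choice an equilibrium state, and uniqueness identifies it. -/
lemma edgeState_eq (hl : ∑ i, edgeProb l i = 1) : beltBuckle.edgeState l = stdState l :=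
  eq_stdState_of_isEquilibriumState hl
    (Classical.epsilon_spec ⟨_, isEquilibriumState_stdState hl⟩)

lemma integral_stdState (hl : ∑ i, edgeProb l i = 1) (F : Path → ℝ) :
    ∫ x, F x ∂stdState l = (∫ x, eigenfun l x * F x ∂eigenmeasure l) / totalWeight l := by
  rw [stdState, integral_smul_measure, integral_eigenfun hl,
    integral_withDensity_eq_integral_toReal_smul
      (eigenfun l).continuous.measurable.ennreal_ofReal (by simp)]
  simp only [ENNReal.toReal_inv, ENNReal.toReal_ofReal (totalWeight_pos l).le,
    ENNReal.toReal_ofReal (eigenfun_pos l _).le, smul_eq_mul]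
  rw [div_eq_inv_mul]

lemma isProbabilityMeasure_stdState (hl : ∑ i, edgeProb l i = 1) :
    IsProbabilityMeasure (stdState l) := by
  have hμ := (isEigenmeasure_eigenmeasure hl).isProbabilityMeasure
  constructor
  rw [stdState, Measure.smul_apply, withDensity_apply _ MeasurableSet.univ,
    Measure.restrict_univ, ← ofReal_integral_eq_lintegral_ofReal
      (integrable_of_continuous _ (eigenfun l).continuous)
      (.of_forall fun x => (eigenfun_pos l x).le), smul_eq_mul]
  refine ENNReal.inv_mul_cancel ?_ ENNReal.ofReal_ne_top
  rw [integral_eigenfun hl]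
  simpa using totalWeight_pos l

/-- The distribution of the first edge under the equilibrium state. -/
def edgeWeight (l : Fin 3 → ℝ) (i : Fin 3) : ℝ :=
  edgeProb l i * (1 - edgeProb l i) / totalWeight l

lemma sum_edgeWeight (l : Fin 3 → ℝ) : ∑ i, edgeWeight l i = 1 := by
  simp only [edgeWeight]
  rw [← Finset.sum_div]
  exact div_self (totalWeight_pos l).ne'

lemma integral_edgeFun (hl : ∑ i, edgeProb l i = 1) (φ : Fin 3 → ℝ) :
    ∫ x, beltBuckle.edgeFun φ x ∂stdState l = ∑ i, edgeWeight l i * φ i := by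
  rw [integral_stdState hl]
  have : (fun x : Path => eigenfun l x * beltBuckle.edgeFun φ x) =
      fun x => (fun i => (1 - edgeProb l i) * φ i) (x.1 0).1 := rfl
  rw [this, integral_edgeFun_eigenmeasure hl (fun i => (1 - edgeProb l i) * φ i), Finset.sum_div]
  exact Finset.sum_congr rfl fun i _ => by rw [edgeWeight]; ring

/-- The normalised transfer operator is the dual of the composition with the shift. -/
lemma integral_mul_comp_shift (hl : ∑ i, edgeProb l i = 1) {w u : Path → ℝ} (hw : Continuous w)
    (hu : Continuous u) : ∫ x, w x * u (beltBuckle.shift x) ∂stdState l =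
      ∫ x, (∑ k, stepProb l (x.1 0) k * w (prepend k x)) * u x ∂stdState l := by
  rw [integral_stdState hl, integral_stdState hl]
  congr 1
  refine ((isEigenmeasure_eigenmeasure hl).integral_transfer
    ⟨fun x => eigenfun l x * (w x * u (beltBuckle.shift x)),
      (eigenfun l).continuous.mul (hw.mul (hu.comp continuous_shift))⟩).symm.trans ?_
  congr 1
  funext x
  rw [transfer_potential]
  simp only [ContinuousMap.coe_mk, eigenfun_apply, prepend_zero, shift_prepend, Finset.mul_sum,
    Finset.sum_mul, stepProb]
  refine Finset.sum_congr rfl fun k _ => ?_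
  have h1 := exp_neg_mul_one_sub l (nbr k (x.1 0)).1
  have h2 := (one_sub_edgeProb_pos l (x.1 0).1).ne'
  field_simp
  linear_combination w (prepend k x) * u x * h1

lemma integral_comp_shift (hl : ∑ i, edgeProb l i = 1) {u : Path → ℝ} (hu : Continuous u) :
    ∫ x, u (beltBuckle.shift x) ∂stdState l = ∫ x, u x ∂stdState l := by
  have := integral_mul_comp_shift hl (w := fun _ => 1) continuous_const hu
  simpa only [mul_one, one_mul, sum_stepProb hl] using this

/-- Birkhoff sums. -/
def ergodicSum (D : Path → ℝ) (n : ℕ) (x : Path) : ℝ :=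
  ∑ i ∈ Finset.range n, D (beltBuckle.shift^[i] x)

lemma continuous_ergodicSum {D : Path → ℝ} (hD : Continuous D) (n : ℕ) : Continuous (ergodicSum D n) :=
  continuous_finsetSum _ fun i _ => hD.comp (continuous_shift.iterate i)

lemma ergodicSum_succ (D : Path → ℝ) (n : ℕ) (x : Path) :
    ergodicSum D (n + 1) x = D x + ergodicSum D n (beltBuckle.shift x) := by
  rw [ergodicSum, Finset.sum_range_succ', add_comm]
  rfl

/-- The Birkhoff sums of a reverse martingale difference have linearly growing second moments. -/
lemma integral_ergodicSum_sq (hl : ∑ i, edgeProb l i = 1) {D : Path → ℝ} (hD : Continuous D)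
    (hker : ∀ x, ∑ k, stepProb l (x.1 0) k * D (prepend k x) = 0)
    (n : ℕ) : ∫ x, ergodicSum D n x ^ 2 ∂stdState l = n * ∫ x, D x ^ 2 ∂stdState l := by
  have := isProbabilityMeasure_stdState hl
  induction n with
  | zero => simp [ergodicSum]
  | succ n ih =>
    have hM := continuous_ergodicSum hD n
    have hMs := hM.comp continuous_shift
    have h1 : ∀ x, ergodicSum D (n + 1) x ^ 2 = D x ^ 2 +
        (2 * (D x * ergodicSum D n (beltBuckle.shift x)) +
          (fun y => ergodicSum D n y ^ 2) (beltBuckle.shift x)) := fun x => by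
      rw [ergodicSum_succ]; ring
    simp only [h1]
    have hsh := continuous_shift
    rw [integral_add, integral_add, integral_const_mul, integral_mul_comp_shift hl hD hM,
      integral_comp_shift hl (u := fun y => ergodicSum D n y ^ 2) (hM.pow 2), ih]
    rotate_left
    iterate 4 exact integrable_of_continuous _ (by fun_prop)
    -- The cross term vanishes: `D` is orthogonal to every continuous function of the shifted
    -- sequence, as its image under the normalised transfer operator is zero.
    simp only [hker, zero_mul, integral_zero]
    push_cast
    ring

/-- Functions whose sums differ from martingale sums by a bounded function have the same variance. -/
lemma tendsto_variance_of_bounded {m : Measure Path} [IsProbabilityMeasure m] {M R : ℕ → Path → ℝ}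
    {s B : ℝ} (hM : ∀ n, Continuous (M n)) (hR : ∀ n, Continuous (R n))
    (hMs : ∀ n : ℕ, ∫ x, M n x ^ 2 ∂m = n * s) (hRB : ∀ n x, |R n x| ≤ B) :
    Tendsto (fun n : ℕ => 1 / (n : ℝ) * ∫ x, (M n x + R n x) ^ 2 ∂m) atTop (𝓝 s) := by
  have hR2 : ∀ n x, R n x ^ 2 ≤ B ^ 2 := fun n x => sq_le_sq' (abs_le.1 (hRB n x)).1 (abs_le.1 (hRB n x)).2
  have hlim : Tendsto (fun n : ℕ => (s + 2 * B ^ 2) * (Real.sqrt n)⁻¹) atTop (𝓝 0) := by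
    simpa using (tendsto_inv_atTop_zero.comp
      (Real.tendsto_sqrt_atTop.comp tendsto_natCast_atTop_atTop)).const_mul (s + 2 * B ^ 2)
  rw [tendsto_iff_norm_sub_tendsto_zero]
  refine squeeze_zero' (.of_forall fun n => norm_nonneg _) ?_ hlim
  filter_upwards [eventually_ge_atTop 1] with n hn
  have hn1 : (1 : ℝ) ≤ n := by exact_mod_cast hn
  -- The cross term is split by `2 |M R| ≤ M² / r + r R²`. As `∫ M² = n s`, the choice `r = √n`
  -- makes both contributions of order `√n`, which is negligible after division by `n`.
  set r := Real.sqrt n with hr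
  have hr1 : 1 ≤ r := Real.one_le_sqrt.2 hn1
  have hr0 : 0 < r := by linarith
  have hrn : r * r = n := Real.mul_self_sqrt (by linarith)
  have key : |∫ x, (2 * (M n x * R n x) + R n x ^ 2) ∂m| ≤ r * s + (r + 1) * B ^ 2 := by
    have h1 : ∀ x, |2 * (M n x * R n x) + R n x ^ 2| ≤ r⁻¹ * M n x ^ 2 + (r + 1) * B ^ 2 := by
      intro x
      have h2 := hR2 n x
      have h3 : |2 * (M n x * R n x)| ≤ r⁻¹ * M n x ^ 2 + r * R n x ^ 2 := by
        have h4 : r⁻¹ * M n x ^ 2 + r * R n x ^ 2 =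
            r⁻¹ * (M n x - r * R n x) ^ 2 + 2 * (M n x * R n x) := by field_simp; ring
        have h5 : r⁻¹ * M n x ^ 2 + r * R n x ^ 2 =
            r⁻¹ * (M n x + r * R n x) ^ 2 - 2 * (M n x * R n x) := by field_simp; ring
        have h6 : 0 ≤ r⁻¹ * (M n x - r * R n x) ^ 2 := by positivity
        have h7 : 0 ≤ r⁻¹ * (M n x + r * R n x) ^ 2 := by positivity
        rw [abs_le]; constructor <;> linarith
      calc _ ≤ |2 * (M n x * R n x)| + |R n x ^ 2| := abs_add_le _ _
        _ ≤ (r⁻¹ * M n x ^ 2 + r * R n x ^ 2) + R n x ^ 2 := by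
          rw [abs_of_nonneg (sq_nonneg (R n x))]; linarith
        _ ≤ _ := by nlinarith
    calc _ ≤ ∫ x, |2 * (M n x * R n x) + R n x ^ 2| ∂m := abs_integral_le_integral_abs
      _ ≤ ∫ x, (r⁻¹ * M n x ^ 2 + (r + 1) * B ^ 2) ∂m := by
        refine integral_mono (integrable_of_continuous _ ?_) (integrable_of_continuous _ ?_) h1
        · exact ((continuous_const.mul ((hM n).mul (hR n))).add ((hR n).pow 2)).abs
        · exact (continuous_const.mul ((hM n).pow 2)).add continuous_const
      _ = _ := by
        rw [integral_add (integrable_of_continuous _ (by have := hM n; fun_prop))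
          (integrable_const _), integral_const_mul, hMs, integral_const, probReal_univ, one_smul,
          ← hrn]
        field_simp
  have hsum : ∫ x, (M n x + R n x) ^ 2 ∂m = n * s + ∫ x, (2 * (M n x * R n x) + R n x ^ 2) ∂m := by
    have hMn := hM n
    have hRn := hR n
    rw [← hMs, ← integral_add (f := fun x => M n x ^ 2)
      (integrable_of_continuous _ (by fun_prop)) (integrable_of_continuous _ (by fun_prop))]
    congr 1
    funext x
    ring
  have hfin : 1 / (n : ℝ) * ∫ x, (M n x + R n x) ^ 2 ∂m - s =
      1 / (n : ℝ) * ∫ x, (2 * (M n x * R n x) + R n x ^ 2) ∂m := by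
    rw [hsum]; field_simp; ring
  rw [Real.norm_eq_abs, hfin, abs_mul, abs_of_pos (by positivity : (0 : ℝ) < 1 / n)]
  calc _ ≤ 1 / (n : ℝ) * (r * s + (r + 1) * B ^ 2) := by gcongr
    _ ≤ 1 / (n : ℝ) * (r * s + (r + r) * B ^ 2) := by gcongr
    _ = _ := by rw [← hrn]; field_simp; ring

/-- The mean of a function on the edges. -/
def edgeMean (l φ : Fin 3 → ℝ) : ℝ := ∑ i, edgeWeight l i * φ i

/-- Martingale-coboundary decomposition. For the centred function `f`, put `g = (1 - q) f` and `h =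
q f`. The normalised transfer operator sends `g` to `-h`, because `q g` has total sum zero and so
its sum over the neighbours of an edge is minus its value there. Hence `D = g + h ∘ σ` is in the
kernel and `f = D + h - h ∘ σ`; the coboundary telescopes to a bounded term. -/
theorem tendsto_varianceSeq (hl : ∑ i, edgeProb l i = 1) (φ : Fin 3 → ℝ) :
    Tendsto (beltBuckle.varianceSeq (beltBuckle.edgeFun φ) (beltBuckle.edgeState l)) atTop
      (𝓝 (∑ i, edgeWeight l i * (1 - 2 * edgeProb l i) * (φ i - edgeMean l φ) ^ 2)) := by
  have := isProbabilityMeasure_stdState hl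
  rw [edgeState_eq hl]
  set f : Fin 3 → ℝ := fun i => φ i - edgeMean l φ with hf
  set g : Fin 3 → ℝ := fun i => (1 - edgeProb l i) * f i with hg
  set h : Fin 3 → ℝ := fun i => edgeProb l i * f i with hh
  have hmean : ∑ i, edgeProb l i * g i = 0 := by
    have h1 : ∑ i, edgeWeight l i * f i = 0 := by
      simp only [hf, mul_sub, Finset.sum_sub_distrib]
      rw [← Finset.sum_mul, sum_edgeWeight, one_mul, edgeMean, sub_self]
    have h2 : ∑ i, edgeProb l i * g i = totalWeight l * ∑ i, edgeWeight l i * f i := by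
      rw [Finset.mul_sum]
      refine Finset.sum_congr rfl fun i _ => ?_
      have := (totalWeight_pos l).ne'
      simp only [hg, edgeWeight]
      field_simp
    rw [h2, h1, mul_zero]
  have hPg : ∀ x : Path, ∑ k, stepProb l (x.1 0) k * beltBuckle.edgeFun g (prepend k x) =
      -beltBuckle.edgeFun h x := by
    intro x
    have h1 : ∀ k, stepProb l (x.1 0) k * beltBuckle.edgeFun g (prepend k x) =
        (fun i => edgeProb l i * g i) (nbr k (x.1 0)).1 / (1 - edgeProb l (x.1 0).1) := fun k => by
      simp only [stepProb, FiniteGraph.edgeFun, prepend_zero]; ring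
    simp only [h1]
    rw [← Finset.sum_div, sum_nbr (φ := fun i => edgeProb l i * g i), hmean, div_eq_iff (one_sub_edgeProb_pos _ _).ne']
    simp only [hg, hh, FiniteGraph.edgeFun]
    ring
  set D : Path → ℝ := fun x => beltBuckle.edgeFun g x + beltBuckle.edgeFun h (beltBuckle.shift x)
    with hD
  have hgc := continuous_edgeFun g
  have hhc := continuous_edgeFun h
  have hDc : Continuous D := hgc.add (hhc.comp continuous_shift)
  have hker : ∀ x : Path, ∑ k, stepProb l (x.1 0) k * D (prepend k x) = 0 := by
    intro x
    simp only [hD, mul_add, Finset.sum_add_distrib, shift_prepend]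
    rw [hPg, ← Finset.sum_mul, sum_stepProb hl]
    ring
  -- By duality `∫ g · (h ∘ σ) = -∫ h²`, so `∫ D² = ∫ (g² - h²)`, and `(1 - q)² - q² = 1 - 2q`.
  have hs : ∫ x, D x ^ 2 ∂stdState l =
      ∑ i, edgeWeight l i * (1 - 2 * edgeProb l i) * (φ i - edgeMean l φ) ^ 2 := by
    have h1 : ∀ x, D x ^ 2 = beltBuckle.edgeFun (fun i => g i ^ 2) x +
        (2 * (beltBuckle.edgeFun g x * beltBuckle.edgeFun h (beltBuckle.shift x)) +
          beltBuckle.edgeFun (fun i => h i ^ 2) (beltBuckle.shift x)) := fun x => by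
      simp only [hD, FiniteGraph.edgeFun]; ring
    have hcs := hhc.comp continuous_shift
    have h2c := continuous_edgeFun fun i => h i ^ 2
    have h3 : ∫ x, -beltBuckle.edgeFun h x * beltBuckle.edgeFun h x ∂stdState l =
        -∫ x, beltBuckle.edgeFun (fun i => h i ^ 2) x ∂stdState l := by
      rw [← integral_neg]
      congr 1
      funext x
      simp only [FiniteGraph.edgeFun]
      ring
    simp only [h1]
    have hsh := continuous_shift
    have hg2 := continuous_edgeFun fun i => g i ^ 2
    rw [integral_add, integral_add, integral_const_mul, integral_mul_comp_shift hl hgc hhc,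
      integral_comp_shift hl h2c]
    rotate_left
    iterate 4 exact integrable_of_continuous _ (by fun_prop)
    simp only [hPg]
    rw [h3, integral_edgeFun hl, integral_edgeFun hl, ← sub_eq_zero]
    simp only [hg, hh, hf, Fin.sum_univ_three]
    ring
  have hsum : ∀ n x, (∑ i ∈ Finset.range n, beltBuckle.edgeFun φ (beltBuckle.shift^[i] x)) -
      (n : ℝ) * ∫ y, beltBuckle.edgeFun φ y ∂stdState l = ergodicSum D n x +
      (beltBuckle.edgeFun h x - beltBuckle.edgeFun h (beltBuckle.shift^[n] x)) := by
    intro n x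
    rw [integral_edgeFun hl, ← edgeMean]
    induction n with
    | zero => simp [ergodicSum]
    | succ n ih =>
      have h1 : ergodicSum D (n + 1) x = ergodicSum D n x + D (beltBuckle.shift^[n] x) :=
        Finset.sum_range_succ _ _
      have h2 : D (beltBuckle.shift^[n] x) = beltBuckle.edgeFun φ (beltBuckle.shift^[n] x) -
          edgeMean l φ - beltBuckle.edgeFun h (beltBuckle.shift^[n] x) +
          beltBuckle.edgeFun h (beltBuckle.shift^[n + 1] x) := by
        rw [Function.iterate_succ_apply']
        simp only [hD, FiniteGraph.edgeFun, hg, hh, hf]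
        ring
      rw [Finset.sum_range_succ, h1, h2]
      push_cast
      linear_combination ih
  have hbound : ∀ (n : ℕ) (x : Path), |beltBuckle.edgeFun h x -
      beltBuckle.edgeFun h (beltBuckle.shift^[n] x)| ≤ 2 * ∑ i, |h i| := by
    intro n x
    have h1 : ∀ i, |h i| ≤ ∑ i, |h i| := fun i =>
      Finset.single_le_sum (f := fun i => |h i|) (fun _ _ => abs_nonneg _) (Finset.mem_univ i)
    refine (abs_sub _ _).trans ?_
    have h2 := h1 (x.1 0).1
    have h3 := h1 ((beltBuckle.shift^[n] x).1 0).1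
    simp only [FiniteGraph.edgeFun]
    linarith
  have hfinal := tendsto_variance_of_bounded (m := stdState l) (M := ergodicSum D)
    (R := fun n x => beltBuckle.edgeFun h x - beltBuckle.edgeFun h (beltBuckle.shift^[n] x))
    (continuous_ergodicSum hDc) (fun n => hhc.sub (hhc.comp (continuous_shift.iterate n)))
    (integral_ergodicSum_sq hl hDc hker) hbound
  rw [hs] at hfinal
  refine hfinal.congr fun n => ?_
  simp only [FiniteGraph.varianceSeq, hsum]

theorem pressureNormSq_eq (hl : ∑ i, edgeProb l i = 1) (φ : Fin 3 → ℝ) :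
    beltBuckle.pressureNormSq l φ =
      ∑ i, edgeWeight l i * (1 - 2 * edgeProb l i) * (φ i - edgeMean l φ) ^ 2 :=
  (tendsto_varianceSeq hl φ).limUnder_eq

lemma mem_tangentSpace_iff (hl : ∑ i, edgeProb l i = 1) (φ : Fin 3 → ℝ) :
    φ ∈ beltBuckle.tangentSpace l ↔ edgeMean l φ = 0 := by
  change ∫ x, beltBuckle.edgeFun φ x ∂beltBuckle.edgeState l = 0 ↔ _
  rw [edgeState_eq hl, integral_edgeFun hl, edgeMean]

end BeltBuckle
end

/-! ### Counting closed cycles and the entropy. -/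

noncomputable section

namespace BeltBuckle

/-- Nonempty finite sequences of directed edges. -/
abbrev EdgeSeq := Σ n : ℕ, Fin (n + 1) → Fin 3 × Bool

/-- The edge paths from `d` that can be continued by `e`, of length less than `T`. -/
def pathsBetween (l : Fin 3 → ℝ) (d e : Fin 3 × Bool) (T : ℝ) : Set EdgeSeq :=
  {c | c.2 0 = d ∧ (∀ i : Fin c.1, beltBuckle.Follows (c.2 i.castSucc) (c.2 i.succ)) ∧
    beltBuckle.Follows (c.2 (Fin.last _)) e ∧ ∑ i, l (c.2 i).1 < T}

/-- The sequence `d` followed by `c`. -/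
def consSeq (d : Fin 3 × Bool) (c : EdgeSeq) : EdgeSeq :=
  ⟨c.1 + 1, Fin.cons (α := fun _ => Fin 3 × Bool) d c.2⟩

lemma consSeq_injective (d : Fin 3 × Bool) : Function.Injective (consSeq d) := by
  rintro ⟨n, c⟩ ⟨n', c'⟩ h
  simp only [consSeq, Sigma.mk.injEq, Nat.add_right_cancel_iff] at h
  obtain ⟨rfl, h⟩ := h
  rw [(Fin.cons_right_injective (α := fun _ => Fin 3 × Bool) d) (eq_of_heq h)]

lemma single_mem_pathsBetween {l : Fin 3 → ℝ} {d e : Fin 3 × Bool} {T : ℝ} :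
    (⟨0, fun _ => d⟩ : EdgeSeq) ∈ pathsBetween l d e T ↔ beltBuckle.Follows d e ∧ l d.1 < T := by
  simp [pathsBetween]

lemma consSeq_mem_pathsBetween {l : Fin 3 → ℝ} {d e : Fin 3 × Bool} {T : ℝ} {c : EdgeSeq} :
    consSeq d c ∈ pathsBetween l d e T ↔
      beltBuckle.Follows d (c.2 0) ∧ c ∈ pathsBetween l (c.2 0) e (T - l d.1) := by
  obtain ⟨n, c⟩ := c
  simp only [pathsBetween, consSeq, mem_ofPred_eq, Fin.cons_zero, true_and, Fin.forall_fin_succ,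
    Fin.castSucc_zero, Fin.cons_succ, Fin.sum_univ_succ (n := n + 1), ← Fin.succ_castSucc,
    ← Fin.succ_last]
  rw [and_assoc, lt_sub_iff_add_lt']

/-- Renewal recursion: splitting off the first edge leaves either nothing or a path from one of the
two neighbours, with its length bound lowered by the length of `d`. -/
lemma pathsBetween_eq (l : Fin 3 → ℝ) (d e : Fin 3 × Bool) (T : ℝ) :
    pathsBetween l d e T = {c | c = ⟨0, fun _ => d⟩ ∧ beltBuckle.Follows d e ∧ l d.1 < T} ∪
      (consSeq d '' pathsBetween l (nbr true d) e (T - l d.1) ∪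
        consSeq d '' pathsBetween l (nbr false d) e (T - l d.1)) := by
  ext c
  constructor
  · intro hc
    obtain ⟨n, c⟩ := c
    cases n with
    | zero =>
      have h0 : c = fun _ => d := by
        funext i
        rw [Fin.eq_zero i]
        exact hc.1
      subst h0
      exact Or.inl ⟨rfl, single_mem_pathsBetween.1 hc⟩
    | succ n =>
      have h0 : (⟨n + 1, c⟩ : EdgeSeq) = consSeq d ⟨n, Fin.tail c⟩ := by
        rw [consSeq, ← show c 0 = d from hc.1]
        exact congrArg (Sigma.mk (n + 1)) (Fin.cons_self_tail c).symm
      rw [h0] at hc ⊢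
      obtain ⟨h1, h2⟩ := consSeq_mem_pathsBetween.1 hc
      obtain ⟨k, hk⟩ := exists_eq_nbr_of_follows h1
      have h3 : Fin.tail c 0 = nbr (!k) d := by
        rw [hk]; exact (nbr_not_nbr k _).symm
      refine Or.inr ?_
      change _ ∈ pathsBetween l (Fin.tail c 0) e (T - l d.1) at h2
      rw [h3] at h2
      cases k
      · exact Or.inl (mem_image_of_mem _ h2)
      · exact Or.inr (mem_image_of_mem _ h2)
  · rintro (⟨rfl, h⟩ | ⟨c, hc, rfl⟩ | ⟨c, hc, rfl⟩)
    · exact single_mem_pathsBetween.2 h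
    · exact consSeq_mem_pathsBetween.2 ⟨hc.1 ▸ follows_nbr _ _, hc.1.symm ▸ hc⟩
    · exact consSeq_mem_pathsBetween.2 ⟨hc.1 ▸ follows_nbr _ _, hc.1.symm ▸ hc⟩

lemma disjoint_pathsBetween (l : Fin 3 → ℝ) (d e : Fin 3 × Bool) (T : ℝ) :
    Disjoint (pathsBetween l (nbr true d) e T) (pathsBetween l (nbr false d) e T) :=
  Set.disjoint_left.2 fun _ h1 h2 => nbr_ne d (h1.1.symm.trans h2.1)

section Count

variable {l : Fin 3 → ℝ} {a b : ℝ}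

lemma pathsBetween_eq_empty (hpos : ∀ i, 0 < l i) (d e : Fin 3 × Bool) {T : ℝ} (hT : T ≤ 0) :
    pathsBetween l d e T = ∅ := by
  refine eq_empty_of_forall_notMem fun c hc => ?_
  have h1 : 0 < ∑ i, l (c.2 i).1 := Finset.sum_pos (fun i _ => hpos _) Finset.univ_nonempty
  exact absurd hc.2.2.2 (by linarith)

/-- The function `q_d e^T` solves the recursion of `pathsBetween_eq` without its one-edge term. It
is the comparison function for both the upper and the lower count. -/
lemma exp_mul_sum_edgeProb_nbr (hl : ∑ i, edgeProb l i = 1) (d : Fin 3 × Bool) (T : ℝ) :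
    edgeProb l (nbr true d).1 * Real.exp (T - l d.1) +
      edgeProb l (nbr false d).1 * Real.exp (T - l d.1) = edgeProb l d.1 * Real.exp T := by
  have h1 := sum_edgeProb_nbr hl d
  rw [Fintype.sum_bool] at h1
  rw [← add_mul, h1, sub_eq_add_neg T, Real.exp_add]
  linear_combination Real.exp T * exp_neg_mul_one_sub l d.1

/-- The number of paths grows at most like `T e^T`. -/
lemma finite_and_ncard_pathsBetween_le (ha : 0 < a) (hal : ∀ i, a ≤ l i)
    (hl : ∑ i, edgeProb l i = 1) {K : ℝ} (hK : ∀ i, 1 ≤ K * edgeProb l i) (e : Fin 3 × Bool) (N : ℕ) :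
    ∀ (T : ℝ) (d : Fin 3 × Bool), T ≤ N * a → (pathsBetween l d e T).Finite ∧
      ((pathsBetween l d e T).ncard : ℝ) ≤ N * K * (edgeProb l d.1 * Real.exp T) := by
  have hpos : ∀ i, 0 < l i := fun i => ha.trans_le (hal i)
  have hK0 : 0 < K := pos_of_mul_pos_left (zero_lt_one.trans_le (hK 0)) (edgeProb_pos l 0).le
  induction N with
  | zero =>
    intro T d hT
    rw [pathsBetween_eq_empty hpos d e (by simpa using hT)]
    simp
  | succ N ih =>
    intro T d hT
    rcases le_or_gt T 0 with hT0 | hT0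
    · rw [pathsBetween_eq_empty hpos d e hT0]
      have := edgeProb_pos l d.1
      simp only [finite_empty, ncard_empty, true_and, Nat.cast_zero]
      positivity
    have hT' : T - l d.1 ≤ N * a := by
      push_cast at hT
      linarith [hal d.1]
    obtain ⟨f1, n1⟩ := ih (T - l d.1) (nbr true d) hT'
    obtain ⟨f2, n2⟩ := ih (T - l d.1) (nbr false d) hT'
    have f0 : {c : EdgeSeq | c = ⟨0, fun _ => d⟩ ∧ beltBuckle.Follows d e ∧ l d.1 < T}.Finite :=
      (finite_singleton (⟨0, fun _ => d⟩ : EdgeSeq)).subset fun c hc => hc.1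
    have n0 : {c : EdgeSeq | c = ⟨0, fun _ => d⟩ ∧ beltBuckle.Follows d e ∧ l d.1 < T}.ncard ≤ 1 := by
      exact (ncard_le_ncard (fun c hc => hc.1) (finite_singleton _)).trans
        (ncard_singleton (⟨0, fun _ => d⟩ : EdgeSeq)).le
    rw [pathsBetween_eq]
    refine ⟨f0.union ((f1.image _).union (f2.image _)), ?_⟩
    have h1 := (ncard_union_le {c : EdgeSeq | c = ⟨0, fun _ => d⟩ ∧ beltBuckle.Follows d e ∧ l d.1 < T}
      (consSeq d '' pathsBetween l (nbr true d) e (T - l d.1) ∪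
        consSeq d '' pathsBetween l (nbr false d) e (T - l d.1))).trans
      (add_le_add n0 (ncard_union_le _ _))
    rw [ncard_image_of_injective _ (consSeq_injective d),
      ncard_image_of_injective _ (consSeq_injective d)] at h1
    have h2 := (Nat.cast_le (α := ℝ)).2 h1
    refine h2.trans ?_
    push_cast
    have h3 := exp_mul_sum_edgeProb_nbr hl d T
    -- The one-edge path contributes at most `1`, which is absorbed into one more multiple of the
    -- comparison function; this is why the bound carries the factor `N`.
    have h4 : 1 ≤ K * (edgeProb l d.1 * Real.exp T) := by
      rw [← mul_assoc]
      exact one_le_mul_of_one_le_of_one_le (hK _) (Real.one_le_exp hT0.le)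
    calc _ ≤ K * (edgeProb l d.1 * Real.exp T) + (N * K * (edgeProb l (nbr true d).1 *
          Real.exp (T - l d.1)) + N * K * (edgeProb l (nbr false d).1 * Real.exp (T - l d.1))) := by
          gcongr
      _ = _ := by rw [← mul_add, h3]; ring

lemma finite_pathsBetween (ha : 0 < a) (hal : ∀ i, a ≤ l i) (hl : ∑ i, edgeProb l i = 1)
    (d e : Fin 3 × Bool) (T : ℝ) : (pathsBetween l d e T).Finite := by
  obtain ⟨N, hN⟩ := exists_nat_ge (T / a)
  have hK : ∀ i, 1 ≤ (∑ i, (edgeProb l i)⁻¹) * edgeProb l i := fun i => by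
    rw [← inv_mul_cancel₀ (edgeProb_pos l i).ne']
    exact mul_le_mul_of_nonneg_right (Finset.single_le_sum (f := fun i => (edgeProb l i)⁻¹)
      (fun j _ => (inv_pos.2 (edgeProb_pos l j)).le) (Finset.mem_univ i)) (edgeProb_pos l i).le
  exact (finite_and_ncard_pathsBetween_le ha hal hl hK e N T d ((div_le_iff₀ ha).1 hN)).1

lemma nonempty_pathsBetween (hb : ∀ i, l i ≤ b) (hb0 : 0 < b) (d e : Fin 3 × Bool) {T : ℝ}
    (hT : 4 * b ≤ T) : (pathsBetween l d e T).Nonempty := by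
  have h1 : ∀ {d}, beltBuckle.Follows d e → ∀ {T}, b < T →
      (⟨0, fun _ => d⟩ : EdgeSeq) ∈ pathsBetween l d e T := fun h T hT =>
    single_mem_pathsBetween.2 ⟨h, (hb _).trans_lt hT⟩
  have h2 : ∀ {d a : Fin 3 × Bool}, beltBuckle.Follows d a → ∀ {T c}, c ∈ pathsBetween l a e (T - l d.1) →
      consSeq d c ∈ pathsBetween l d e T := fun h T c hc =>
    consSeq_mem_pathsBetween.2 ⟨hc.1.symm ▸ h, hc.1.symm ▸ hc⟩
  rcases exists_connection d e with h | ⟨a, ha, h⟩ | ⟨a, c, ha, hc, h⟩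
  · exact ⟨_, h1 h (by linarith)⟩
  · exact ⟨_, h2 ha (h1 h (by linarith [hb d.1]))⟩
  · exact ⟨_, h2 ha (h2 hc (h1 h (by linarith [hb d.1, hb a.1])))⟩

/-- The number of paths grows at least like `e^T`. -/
lemma le_ncard_pathsBetween (ha : 0 < a) (hal : ∀ i, a ≤ l i) (hb : ∀ i, l i ≤ b)
    (hl : ∑ i, edgeProb l i = 1) (e : Fin 3 × Bool) (N : ℕ) :
    ∀ (T : ℝ) (d : Fin 3 × Bool), 4 * b ≤ T → T ≤ 5 * b + N * a →
      Real.exp (-(5 * b)) * (edgeProb l d.1 * Real.exp T) ≤ (pathsBetween l d e T).ncard := by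
  have hfin := finite_pathsBetween ha hal hl
  have hb0 : 0 < b := ha.trans_le ((hal 0).trans (hb 0))
  -- On the window `[4b, 5b]` one path suffices: connecting paths have at most three edges, and
  -- `e^{-5b} q_d e^T ≤ 1`. The window has width `b`, so removing one edge from some `T > 5b` cannot
  -- jump below it.
  have hbase : ∀ (T : ℝ) (d : Fin 3 × Bool), 4 * b ≤ T → T ≤ 5 * b →
      Real.exp (-(5 * b)) * (edgeProb l d.1 * Real.exp T) ≤ (pathsBetween l d e T).ncard := by
    intro T d h1 h2
    have h3 : 1 ≤ (pathsBetween l d e T).ncard :=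
      (ncard_pos (hfin d e T)).2 (nonempty_pathsBetween hb hb0 d e h1)
    have h4 : (1 : ℝ) ≤ (pathsBetween l d e T).ncard := by exact_mod_cast h3
    refine le_trans ?_ h4
    have h5 : Real.exp (-(5 * b)) * Real.exp T ≤ 1 := by
      rw [← Real.exp_add]
      exact Real.exp_le_one_iff.2 (by linarith)
    have h6 := (edgeProb_lt_one l d.1).le
    have h7 := (edgeProb_pos l d.1).le
    calc _ = edgeProb l d.1 * (Real.exp (-(5 * b)) * Real.exp T) := by ring
      _ ≤ 1 := mul_le_one₀ h6 (by positivity) h5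
  induction N with
  | zero => intro T d h1 h2; exact hbase T d h1 (by simpa using h2)
  | succ N ih =>
    intro T d h1 h2
    rcases le_or_gt T (5 * b) with hT | hT
    · exact hbase T d h1 hT
    have h3 : 4 * b ≤ T - l d.1 := by linarith [hb d.1]
    have h4 : T - l d.1 ≤ 5 * b + N * a := by
      push_cast at h2
      linarith [hal d.1]
    have h5 : (consSeq d '' pathsBetween l (nbr true d) e (T - l d.1) ∪
        consSeq d '' pathsBetween l (nbr false d) e (T - l d.1)).ncard ≤
        (pathsBetween l d e T).ncard := by
      refine ncard_le_ncard ?_ (hfin d e T)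
      conv_rhs => rw [pathsBetween_eq]
      exact subset_union_right
    rw [ncard_union_eq ((disjoint_image_iff (consSeq_injective d)).2 (disjoint_pathsBetween _ _ _ _))
      ((hfin _ _ _).image _) ((hfin _ _ _).image _),
      ncard_image_of_injective _ (consSeq_injective d),
      ncard_image_of_injective _ (consSeq_injective d)] at h5
    have h6 := (Nat.cast_le (α := ℝ)).2 h5
    push_cast at h6
    have h7 := exp_mul_sum_edgeProb_nbr hl d T
    have h8 := ih _ (nbr true d) h3 h4
    have h9 := ih _ (nbr false d) h3 h4
    rw [← h7, mul_add]
    linarith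

lemma closedCycles_eq (l : Fin 3 → ℝ) (T : ℝ) :
    beltBuckle.closedCycles l T = ⋃ e, pathsBetween l e e T := by
  ext ⟨n, c⟩
  simp only [FiniteGraph.closedCycles, mem_iUnion, pathsBetween, mem_ofPred_eq]
  constructor
  · rintro ⟨h, hT⟩
    refine ⟨c 0, rfl, fun i => ?_, ?_, hT⟩
    · have := h i.castSucc
      rwa [Fin.coeSucc_eq_succ] at this
    · have := h (Fin.last n)
      rwa [Fin.last_add_one] at this
  · rintro ⟨e, rfl, h, hlast, hT⟩
    refine ⟨fun i => ?_, hT⟩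
    induction i using Fin.lastCases with
    | last => rwa [Fin.last_add_one]
    | cast i => rw [Fin.coeSucc_eq_succ]; exact h i

/-- A metric with `∑ 1 / (1 + e^{lᵢ}) = 1` has entropy one. -/
theorem hasEntropy_one (hpos : ∀ i, 0 < l i) (hl : ∑ i, edgeProb l i = 1) :
    beltBuckle.HasEntropy l 1 := by
  obtain ⟨i₀, hi₀⟩ := Finite.exists_min l
  obtain ⟨i₁, hi₁⟩ := Finite.exists_max l
  set a := l i₀
  set b := l i₁
  have ha : 0 < a := hpos i₀
  have hfin := finite_pathsBetween ha hi₀ hl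
  set K := ∑ i, (edgeProb l i)⁻¹ with hKdef
  have hK : ∀ i, 1 ≤ K * edgeProb l i := fun i => by
    rw [← inv_mul_cancel₀ (edgeProb_pos l i).ne']
    exact mul_le_mul_of_nonneg_right (Finset.single_le_sum (f := fun i => (edgeProb l i)⁻¹)
      (fun j _ => (inv_pos.2 (edgeProb_pos l j)).le) (Finset.mem_univ i)) (edgeProb_pos l i).le
  have hK0 : 0 < K := pos_of_mul_pos_left (zero_lt_one.trans_le (hK 0)) (edgeProb_pos l 0).le
  have hfinU : ∀ T, (⋃ e, pathsBetween l e e T).Finite := fun T => finite_iUnion fun e => hfin e e T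
  set c := Real.exp (-(5 * b)) * edgeProb l 0 with hc
  have hc0 : 0 < c := mul_pos (Real.exp_pos _) (edgeProb_pos _ _)
  -- The six directed edges are the possible base points of a cycle, and the number of recursion
  -- steps is at most `T / a + 1 ≤ (1 / a + 1) T` for `T ≥ 1`.
  set M := 6 * ((1 / a + 1) * K) with hM
  have hM0 : 0 < M := by positivity
  have hlow : ∀ T, 4 * b ≤ T → c * Real.exp T ≤ (beltBuckle.closedCycles l T).ncard := by
    intro T hT
    obtain ⟨N, hN⟩ := exists_nat_ge (T / a)
    have hb0 : 0 < b := hpos i₁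
    have h1 := le_ncard_pathsBetween ha hi₀ hi₁ hl (0, true) N T (0, true) hT (by
      linarith [(div_le_iff₀ ha).1 hN])
    rw [hc, mul_assoc]
    refine h1.trans ?_
    rw [closedCycles_eq]
    exact_mod_cast ncard_le_ncard (subset_iUnion (fun e => pathsBetween l e e T) (0, true)) (hfinU T)
  have hup : ∀ T, 1 ≤ T → ((beltBuckle.closedCycles l T).ncard : ℝ) ≤ M * T * Real.exp T := by
    intro T hT
    have hT0 : 0 ≤ T := by linarith
    have hN1 := Nat.le_ceil (T / a)
    have hN2 := (Nat.ceil_lt_add_one (div_nonneg hT0 ha.le)).le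
    set N := ⌈T / a⌉₊
    have h1 : ∀ e, ((pathsBetween l e e T).ncard : ℝ) ≤ (1 / a + 1) * K * T * Real.exp T := by
      intro e
      refine (finite_and_ncard_pathsBetween_le ha hi₀ hl hK e N T e ((div_le_iff₀ ha).1 hN1)).2.trans ?_
      have h2 : (N : ℝ) ≤ (1 / a + 1) * T := by
        refine hN2.trans ?_
        rw [add_mul, one_mul, div_mul_eq_mul_div, one_mul]
        linarith
      have h3 : edgeProb l e.1 * Real.exp T ≤ Real.exp T :=
        mul_le_of_le_one_left (Real.exp_pos _).le (edgeProb_lt_one _ _).le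
      have h4 := edgeProb_pos l e.1
      calc _ ≤ (1 / a + 1) * T * K * Real.exp T := by gcongr
        _ = _ := by ring
    rw [closedCycles_eq]
    have h5 := ncard_iUnion_le_of_fintype fun e => pathsBetween l e e T
    calc ((⋃ e, pathsBetween l e e T).ncard : ℝ) ≤ ∑ e, ((pathsBetween l e e T).ncard : ℝ) := by
          exact_mod_cast h5
      _ ≤ ∑ e : Fin 3 × Bool, (1 / a + 1) * K * T * Real.exp T := Finset.sum_le_sum fun e _ => h1 e
      _ = M * T * Real.exp T := by
        rw [Finset.sum_const, Finset.card_univ, Fintype.card_prod, Fintype.card_fin,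
          Fintype.card_bool, nsmul_eq_mul, hM]
        push_cast
        ring
  have hinv : Tendsto (fun T : ℝ => 1 / T) atTop (𝓝 0) := by
    simpa using tendsto_inv_atTop_zero (𝕜 := ℝ)
  have hlog : Tendsto (fun T : ℝ => Real.log T / T) atTop (𝓝 0) :=
    Real.isLittleO_log_id_atTop.tendsto_div_nhds_zero
  have hlowlim : Tendsto (fun T : ℝ => 1 / T * Real.log c + 1) atTop (𝓝 1) := by
    simpa using (hinv.mul_const (Real.log c)).add_const 1
  have huplim : Tendsto (fun T : ℝ => 1 / T * Real.log M + Real.log T / T + 1) atTop (𝓝 1) := by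
    simpa using ((hinv.mul_const (Real.log M)).add hlog).add_const 1
  refine tendsto_of_tendsto_of_tendsto_of_le_of_le' hlowlim huplim ?_ ?_
  · filter_upwards [eventually_ge_atTop (4 * b), eventually_gt_atTop 0] with T hT hT0
    have h1 := Real.log_le_log (by positivity) (hlow T hT)
    rw [Real.log_mul hc0.ne' (Real.exp_pos _).ne', Real.log_exp] at h1
    calc _ = 1 / T * (Real.log c + T) := by field_simp
      _ ≤ _ := by gcongr
  · filter_upwards [eventually_ge_atTop (4 * b), eventually_ge_atTop 1] with T hT hT1
    have hT0 : 0 < T := by linarith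
    have h0 : (0 : ℝ) < (beltBuckle.closedCycles l T).ncard :=
      lt_of_lt_of_le (by positivity) (hlow T hT)
    have h1 := Real.log_le_log h0 (hup T hT1)
    rw [Real.log_mul (by positivity) (Real.exp_pos _).ne', Real.log_exp,
      Real.log_mul hM0.ne' hT0.ne'] at h1
    calc _ ≤ 1 / T * (Real.log M + Real.log T + T) := by gcongr
      _ = _ := by field_simp

lemma hasEntropy_of_smul {h : ℝ} (hh : 0 < h) (H : beltBuckle.HasEntropy (h • l) 1) :
    beltBuckle.HasEntropy l h := by
  have h1 : ∀ T, beltBuckle.closedCycles (h • l) (h * T) = beltBuckle.closedCycles l T := by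
    intro T
    ext c
    simp only [FiniteGraph.closedCycles, mem_ofPred_eq, Pi.smul_apply, smul_eq_mul]
    rw [← Finset.mul_sum, mul_lt_mul_iff_right₀ hh]
  have h2 := (H.comp (tendsto_id.const_mul_atTop hh)).const_mul h
  rw [mul_one] at h2
  refine h2.congr fun T => ?_
  simp only [Function.comp_apply, id, h1]
  field_simp

/-- Every positive metric can be scaled to satisfy `∑ 1 / (1 + e^{lᵢ}) = 1`. -/
lemma exists_scale (hpos : ∀ i, 0 < l i) : ∃ h : ℝ, 0 < h ∧ ∑ i, edgeProb (h • l) i = 1 := by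
  set F : ℝ → ℝ := fun h => ∑ i, edgeProb (h • l) i with hF
  have hFc : Continuous F := by
    refine continuous_finsetSum _ fun i _ => ?_
    simp only [edgeProb, Pi.smul_apply, smul_eq_mul]
    exact continuous_const.div (by fun_prop) fun x => by positivity
  have hF0 : F 0 = 3 / 2 := by
    simp [hF, edgeProb]; norm_num
  have hlim : Tendsto F atTop (𝓝 0) := by
    have : Tendsto F atTop (𝓝 (∑ i : Fin 3, (0 : ℝ))) := by
      refine tendsto_finsetSum _ fun i _ => ?_
      simp only [edgeProb, Pi.smul_apply, smul_eq_mul, one_div]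
      refine tendsto_inv_atTop_zero.comp (tendsto_atTop_add_const_left _ _ ?_)
      exact Real.tendsto_exp_atTop.comp (tendsto_id.atTop_mul_const (hpos i))
    simpa using this
  obtain ⟨H, hH1, hH0⟩ := ((hlim.eventually (gt_mem_nhds one_pos)).and (eventually_gt_atTop 0)).exists
  obtain ⟨h, hh, hh1⟩ := intermediate_value_Icc' hH0.le hFc.continuousOn
    (show (1 : ℝ) ∈ Icc (F H) (F 0) from ⟨hH1.le, by rw [hF0]; norm_num⟩)
  refine ⟨h, lt_of_le_of_ne hh.1 ?_, hh1⟩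
  rintro rfl
  rw [hF0] at hh1
  norm_num at hh1

/-- For the converse, some multiple `h • l` satisfies the weight condition and so has entropy one.
Then `l` has entropy `h`, and uniqueness of limits forces `h = 1`. -/
theorem mem_moduliSpace_iff :
    l ∈ beltBuckle.moduliSpace ↔ (∀ i, 0 < l i) ∧ ∑ i, edgeProb l i = 1 := by
  refine ⟨fun ⟨hpos, H⟩ => ⟨hpos, ?_⟩, fun ⟨hpos, hl⟩ => ⟨hpos, hasEntropy_one hpos hl⟩⟩
  obtain ⟨h, hh, hsum⟩ := exists_scale hpos
  have h1 := hasEntropy_of_smul hh (hasEntropy_one (fun i => mul_pos hh (hpos i)) hsum)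
  obtain rfl : 1 = h := tendsto_nhds_unique H h1
  simpa using hsum

end Count

end BeltBuckle
end

/-! ### The chart and the coefficients of the metric. -/

noncomputable section

namespace BeltBuckle

/-- The coordinate domain `x, y > 0`. -/
def quadrant : Set (Fin 2 → ℝ) := {p | 0 < p 0 ∧ 0 < p 1}

lemma isOpen_quadrant : IsOpen quadrant :=
  (isOpen_lt continuous_const (continuous_apply 0)).inter
    (isOpen_lt continuous_const (continuous_apply 1))

/-- The derivative of `f` in the `i`-th coordinate is `f'`. -/
def HasPartialAt {F : Type*} [NormedAddCommGroup F] [NormedSpace ℝ F] (i : Fin 2)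
    (f : (Fin 2 → ℝ) → F) (f' : F) (p : Fin 2 → ℝ) : Prop :=
  HasDerivAt (fun t => f (Function.update p i t)) f' (p i)

lemma tendsto_update (i : Fin 2) (p : Fin 2 → ℝ) :
    Tendsto (fun t => Function.update p i t) (𝓝 (p i)) (𝓝 p) := by
  have h : Continuous fun t : ℝ => Function.update p i t := by fun_prop
  simpa using h.tendsto (p i)

namespace HasPartialAt

variable {F : Type*} [NormedAddCommGroup F] [NormedSpace ℝ F] {i : Fin 2}
  {f g : (Fin 2 → ℝ) → F} {f' : F} {u v : (Fin 2 → ℝ) → ℝ} {u' v' : ℝ} {p : Fin 2 → ℝ}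

lemma partialDeriv_eq (h : HasPartialAt i f f' p) : partialDeriv i f p = f' := h.deriv

lemma congr_of_eventuallyEq (h : HasPartialAt i f f' p) (hfg : g =ᶠ[𝓝 p] f) :
    HasPartialAt i g f' p :=
  HasDerivAt.congr_of_eventuallyEq h ((tendsto_update i p).eventually hfg)

lemma congr_of_quadrant (h : HasPartialAt i f f' p) (hp : p ∈ quadrant)
    (hfg : ∀ q ∈ quadrant, g q = f q) : HasPartialAt i g f' p :=
  h.congr_of_eventuallyEq (eventually_of_mem (isOpen_quadrant.mem_nhds hp) hfg)

lemma sub (hu : HasPartialAt i u u' p) (hv : HasPartialAt i v v' p) :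
    HasPartialAt i (fun q => u q - v q) (u' - v') p := HasDerivAt.sub hu hv

lemma const_mul (c : ℝ) (hu : HasPartialAt i u u' p) :
    HasPartialAt i (fun q => c * u q) (c * u') p := HasDerivAt.const_mul c hu

lemma mul (hu : HasPartialAt i u u' p) (hv : HasPartialAt i v v' p) :
    HasPartialAt i (fun q => u q * v q) (u' * v p + u p * v') p := by
  have := HasDerivAt.mul hu hv
  simp only [Function.update_eq_self] at this
  exact this

lemma div (hu : HasPartialAt i u u' p) (hv : HasPartialAt i v v' p) (h0 : v p ≠ 0) :
    HasPartialAt i (fun q => u q / v q) ((u' * v p - u p * v') / v p ^ 2) p := by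
  have := HasDerivAt.div hu hv (by simpa using h0)
  simp only [Function.update_eq_self] at this
  exact this

end HasPartialAt

section Chart

variable {p : Fin 2 → ℝ}

lemma one_lt_exp_of_quadrant (hp : p ∈ quadrant) :
    1 < Real.exp (p 0) ∧ 1 < Real.exp (p 1) :=
  ⟨Real.one_lt_exp_iff.2 hp.1, Real.one_lt_exp_iff.2 hp.2⟩

lemma exp_third_chart (hp : p ∈ quadrant) : Real.exp (beltChart p 2) =
    (Real.exp (p 0) + Real.exp (p 1) + 2) / (Real.exp (p 0) * Real.exp (p 1) - 1) := by
  obtain ⟨ha, hb⟩ := one_lt_exp_of_quadrant hp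
  have h1 : 0 < Real.exp (p 0) * Real.exp (p 1) - 1 := by nlinarith
  have h2 : beltChart p 2 = -Real.log ((Real.exp (p 0 + p 1) - 1) /
    (Real.exp (p 0) + Real.exp (p 1) + 2)) := rfl
  rw [h2, Real.exp_neg, Real.exp_add, Real.exp_log (by positivity), inv_div]

lemma edgeProb_chart_zero : edgeProb (beltChart p) 0 = 1 / (1 + Real.exp (p 0)) := rfl

lemma edgeProb_chart_one : edgeProb (beltChart p) 1 = 1 / (1 + Real.exp (p 1)) := rfl

lemma edgeProb_chart_two (hp : p ∈ quadrant) : edgeProb (beltChart p) 2 =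
    (Real.exp (p 0) * Real.exp (p 1) - 1) / ((Real.exp (p 0) + 1) * (Real.exp (p 1) + 1)) := by
  obtain ⟨ha, hb⟩ := one_lt_exp_of_quadrant hp
  have h1 : 0 < Real.exp (p 0) * Real.exp (p 1) - 1 := by nlinarith
  rw [edgeProb, exp_third_chart hp, div_eq_div_iff (by positivity) (by positivity)]
  field_simp
  ring

lemma sum_edgeProb_chart (hp : p ∈ quadrant) : ∑ i, edgeProb (beltChart p) i = 1 := by
  rw [Fin.sum_univ_three, edgeProb_chart_zero, edgeProb_chart_one, edgeProb_chart_two hp]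
  have := Real.exp_pos (p 0)
  have := Real.exp_pos (p 1)
  field_simp
  ring

/-- The metrics of pressure zero with `x, y > 0` are given by the chart. -/
lemma eq_chart {l : Fin 3 → ℝ} (h0 : 0 < l 0) (h1 : 0 < l 1) (hl : ∑ i, edgeProb l i = 1) :
    l = beltChart ![l 0, l 1] := by
  have hp : ![l 0, l 1] ∈ quadrant := ⟨h0, h1⟩
  have h2 := sum_edgeProb_chart hp
  rw [← hl, Fin.sum_univ_three, Fin.sum_univ_three, edgeProb_chart_zero, edgeProb_chart_one] at h2
  have h3 : edgeProb (beltChart ![l 0, l 1]) 2 = edgeProb l 2 := by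
    simp only [edgeProb, Matrix.cons_val_zero, Matrix.cons_val_one] at h2 ⊢
    linarith
  have h4 : l 2 = beltChart ![l 0, l 1] 2 := by
    simp only [edgeProb, one_div, inv_inj, add_right_inj, Real.exp_eq_exp] at h3
    exact h3.symm
  funext i
  fin_cases i
  exacts [rfl, rfl, h4]

/-- The chart solves `∑ q_i = 1` for the third length, with `e^{l_2} = (a + b + 2) / (ab - 1)`.
Positivity of that length is `ab - 1 < a + b + 2`. -/
theorem moduliSpace_eq : beltBuckle.moduliSpace = beltChart '' {p : Fin 2 → ℝ | 0 < p 0 ∧ 0 < p 1 ∧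
    Real.exp (p 0 + p 1) < 3 + Real.exp (p 0) + Real.exp (p 1)} := by
  have key : ∀ {p}, p ∈ quadrant → (0 < beltChart p 2 ↔
      Real.exp (p 0 + p 1) < 3 + Real.exp (p 0) + Real.exp (p 1)) := by
    intro p hp
    obtain ⟨ha, hb⟩ := one_lt_exp_of_quadrant hp
    have h1 : 0 < Real.exp (p 0) * Real.exp (p 1) - 1 := by nlinarith
    rw [← Real.one_lt_exp_iff, exp_third_chart hp, one_lt_div h1, Real.exp_add]
    constructor <;> intro h <;> linarith
  ext l
  rw [mem_moduliSpace_iff]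
  constructor
  · rintro ⟨hpos, hl⟩
    have h := eq_chart (hpos 0) (hpos 1) hl
    have hp : ![l 0, l 1] ∈ quadrant := ⟨hpos 0, hpos 1⟩
    exact ⟨_, ⟨hpos 0, hpos 1, (key hp).1 (h ▸ hpos 2)⟩, h.symm⟩
  · rintro ⟨p, ⟨h0, h1, h2⟩, rfl⟩
    refine ⟨fun i => ?_, sum_edgeProb_chart ⟨h0, h1⟩⟩
    fin_cases i
    exacts [h0, h1, (key ⟨h0, h1⟩).2 h2]

lemma hasPartialAt_chart_zero (hp : p ∈ quadrant) : HasPartialAt 0 beltChart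
    ![1, 0, -(Real.exp (p 0) * (Real.exp (p 1) + 1) ^ 2 /
      ((Real.exp (p 0) * Real.exp (p 1) - 1) * (Real.exp (p 0) + Real.exp (p 1) + 2)))] p := by
  obtain ⟨ha, hb⟩ := one_lt_exp_of_quadrant hp
  have h1 : 0 < Real.exp (p 0) * Real.exp (p 1) - 1 := by nlinarith
  have hf0 : (fun t => beltChart (Function.update p 0 t) 0) = fun t => t := by
    funext t; simp [beltChart]
  have hf1 : (fun t => beltChart (Function.update p 0 t) 1) = fun t => p 1 := by
    funext t; simp [beltChart]
  have hf2 : (fun t => beltChart (Function.update p 0 t) 2) = fun t => -Real.log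
      ((Real.exp (t + p 1) - 1) / (Real.exp t + Real.exp (p 1) + 2)) := by
    funext t; simp [beltChart]
  have hu : HasDerivAt (fun t => Real.exp (t + p 1) - 1)
      (Real.exp (p 0) * Real.exp (p 1)) (p 0) := by
    rw [← Real.exp_add]
    simpa using (((hasDerivAt_id (p 0)).add_const (p 1)).exp).sub_const 1
  have hv : HasDerivAt (fun t => Real.exp t + Real.exp (p 1) + 2) (Real.exp (p 0)) (p 0) :=
    ((Real.hasDerivAt_exp (p 0)).add_const _).add_const _
  have hne : (Real.exp (p 0 + p 1) - 1) / (Real.exp (p 0) + Real.exp (p 1) + 2) ≠ 0 := by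
    rw [Real.exp_add]; positivity
  have hd : HasDerivAt (fun t => -Real.log
      ((Real.exp (t + p 1) - 1) / (Real.exp t + Real.exp (p 1) + 2)))
      (-(Real.exp (p 0) * (Real.exp (p 1) + 1) ^ 2 / ((Real.exp (p 0) * Real.exp (p 1) - 1) *
        (Real.exp (p 0) + Real.exp (p 1) + 2)))) (p 0) := by
    refine (((hu.fun_div hv (by positivity)).log hne).fun_neg).congr_deriv ?_
    simp only [Real.exp_add]
    field_simp
    ring
  rw [HasPartialAt, hasDerivAt_pi]
  intro i
  fin_cases i
  · exact hf0 ▸ hasDerivAt_id (p 0)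
  · exact hf1 ▸ hasDerivAt_const (p 0) (p 1)
  · exact hf2 ▸ hd

lemma hasPartialAt_chart_one (hp : p ∈ quadrant) : HasPartialAt 1 beltChart
    ![0, 1, -(Real.exp (p 1) * (Real.exp (p 0) + 1) ^ 2 /
      ((Real.exp (p 0) * Real.exp (p 1) - 1) * (Real.exp (p 0) + Real.exp (p 1) + 2)))] p := by
  obtain ⟨ha, hb⟩ := one_lt_exp_of_quadrant hp
  have h1 : 0 < Real.exp (p 0) * Real.exp (p 1) - 1 := by nlinarith
  have hf0 : (fun t => beltChart (Function.update p 1 t) 0) = fun t => p 0 := by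
    funext t; simp [beltChart]
  have hf1 : (fun t => beltChart (Function.update p 1 t) 1) = fun t => t := by
    funext t; simp [beltChart]
  have hf2 : (fun t => beltChart (Function.update p 1 t) 2) = fun t => -Real.log
      ((Real.exp (p 0 + t) - 1) / (Real.exp (p 0) + Real.exp t + 2)) := by
    funext t; simp [beltChart]
  have hu : HasDerivAt (fun t => Real.exp (p 0 + t) - 1)
      (Real.exp (p 0) * Real.exp (p 1)) (p 1) := by
    rw [← Real.exp_add]
    simpa using (((hasDerivAt_id (p 1)).const_add (p 0)).exp).sub_const 1
  have hv : HasDerivAt (fun t => Real.exp (p 0) + Real.exp t + 2) (Real.exp (p 1)) (p 1) :=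
    ((Real.hasDerivAt_exp (p 1)).const_add _).add_const _
  have hne : (Real.exp (p 0 + p 1) - 1) / (Real.exp (p 0) + Real.exp (p 1) + 2) ≠ 0 := by
    rw [Real.exp_add]; positivity
  have hd : HasDerivAt (fun t => -Real.log
      ((Real.exp (p 0 + t) - 1) / (Real.exp (p 0) + Real.exp t + 2)))
      (-(Real.exp (p 1) * (Real.exp (p 0) + 1) ^ 2 / ((Real.exp (p 0) * Real.exp (p 1) - 1) *
        (Real.exp (p 0) + Real.exp (p 1) + 2)))) (p 1) := by
    refine (((hu.fun_div hv (by positivity)).log hne).fun_neg).congr_deriv ?_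
    simp only [Real.exp_add]
    field_simp
    ring
  rw [HasPartialAt, hasDerivAt_pi]
  intro i
  fin_cases i
  · exact hf0 ▸ hasDerivAt_const (p 1) (p 0)
  · exact hf1 ▸ hasDerivAt_id (p 1)
  · exact hf2 ▸ hd

lemma totalWeight_chart (hp : p ∈ quadrant) : totalWeight (beltChart p) =
    2 * (3 * (Real.exp (p 0) * Real.exp (p 1)) + Real.exp (p 0) ^ 2 * Real.exp (p 1) +
      Real.exp (p 0) * Real.exp (p 1) ^ 2 - 1) /
      ((Real.exp (p 0) + 1) ^ 2 * (Real.exp (p 1) + 1) ^ 2) := by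
  rw [totalWeight, Fin.sum_univ_three, edgeProb_chart_zero, edgeProb_chart_one,
    edgeProb_chart_two hp]
  have := Real.exp_pos (p 0)
  have := Real.exp_pos (p 1)
  field_simp
  ring

end Chart

/-- The polarization of the pressure metric on tangent vectors. -/
lemma pressureInner_eq {l : Fin 3 → ℝ} (hl : ∑ i, edgeProb l i = 1) {φ ψ : Fin 3 → ℝ}
    (hφ : edgeMean l φ = 0) (hψ : edgeMean l ψ = 0) : beltBuckle.pressureInner l φ ψ =
      (∑ i, edgeProb l i * (1 - edgeProb l i) * (1 - 2 * edgeProb l i) * (φ i * ψ i)) /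
        totalWeight l := by
  have hadd : edgeMean l (φ + ψ) = 0 := by
    have : edgeMean l (φ + ψ) = edgeMean l φ + edgeMean l ψ := by
      simp only [edgeMean, Pi.add_apply, mul_add, Finset.sum_add_distrib]
    rw [this, hφ, hψ, add_zero]
  simp only [FiniteGraph.pressureInner, pressureNormSq_eq hl, hφ, hψ, hadd, edgeWeight,
    Fin.sum_univ_three, Pi.add_apply]
  ring

lemma pressureNormSq_tangent {l : Fin 3 → ℝ} (hl : ∑ i, edgeProb l i = 1) {φ : Fin 3 → ℝ}
    (hφ : edgeMean l φ = 0) : beltBuckle.pressureNormSq l φ =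
      (∑ i, edgeProb l i * (1 - edgeProb l i) * (1 - 2 * edgeProb l i) * φ i ^ 2) /
        totalWeight l := by
  simp only [pressureNormSq_eq hl, hφ, edgeWeight, Fin.sum_univ_three]
  ring

section Metric

variable {p : Fin 2 → ℝ}

/-- Conceptually this is the derivative of `∑ q_i = 1`, since `q_i` changes at the rate `-q_i (1 -
q_i)` times that of `l_i`; here it is checked on the explicit partial derivatives. -/
lemma edgeMean_partialDeriv_chart (hp : p ∈ quadrant) (i : Fin 2) :
    edgeMean (beltChart p) (partialDeriv i beltChart p) = 0 := by
  obtain ⟨ha, hb⟩ := one_lt_exp_of_quadrant hp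
  have h1 : Real.exp (p 0) * Real.exp (p 1) - 1 ≠ 0 := by nlinarith
  have h2 : edgeMean (beltChart p) (partialDeriv i beltChart p) =
      (∑ j, edgeProb (beltChart p) j * (1 - edgeProb (beltChart p) j) *
        partialDeriv i beltChart p j) / totalWeight (beltChart p) := by
    simp only [edgeMean, edgeWeight]
    rw [Finset.sum_div]
    exact Finset.sum_congr rfl fun j _ => by ring
  rw [h2, div_eq_zero_iff]
  left
  rw [Fin.sum_univ_three, edgeProb_chart_zero, edgeProb_chart_one, edgeProb_chart_two hp]
  fin_cases i
  · rw [show partialDeriv ⟨0, _⟩ beltChart p = _ from (hasPartialAt_chart_zero hp).partialDeriv_eq]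
    simp only [Matrix.cons_val]
    field_simp
    ring
  · rw [show partialDeriv ⟨1, _⟩ beltChart p = _ from (hasPartialAt_chart_one hp).partialDeriv_eq]
    simp only [Matrix.cons_val]
    field_simp
    ring

/-- `3ab + a²b + ab² - 1`. -/
def weightPoly (a b : ℝ) : ℝ := 3 * (a * b) + a ^ 2 * b + a * b ^ 2 - 1

/-- The common denominator of the coefficients of the metric. -/
def metricDenom (a b : ℝ) : ℝ := 2 * weightPoly a b * ((a * b - 1) * (a + b + 2))

/-- The numerators of the coefficients of the metric. -/
def metricE (a b : ℝ) : ℝ := a * (b + 1) ^ 2 * (a ^ 2 * b + b + 2)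
/-- The numerator of the mixed coefficient. -/
def metricF (a b : ℝ) : ℝ := a * b * (a + 1) * (b + 1) * (3 + a + b - a * b)

lemma weightPoly_pos {a b : ℝ} (ha : 1 < a) (hb : 1 < b) : 0 < weightPoly a b := by
  have h1 : 0 < a := by linarith
  have h2 : 0 < b := by linarith
  have : 0 < a ^ 2 * b := by positivity
  have : 0 < a * b ^ 2 := by positivity
  unfold weightPoly
  nlinarith

lemma metricDenom_pos {a b : ℝ} (ha : 1 < a) (hb : 1 < b) : 0 < metricDenom a b := by
  have := weightPoly_pos ha hb
  have h1 : 0 < a * b - 1 := by nlinarith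
  have h2 : 0 < a + b + 2 := by linarith
  unfold metricDenom
  positivity

/-- Exchanging the two coordinates swaps the diagonal coefficients and preserves `metricF` and
`metricDenom`. Hence the second diagonal numerator is `metricE` with its arguments exchanged, and
half of the derivatives needed later come for free. -/
lemma beltMetric_eq (hp : p ∈ quadrant) : beltMetric p =
    !![metricE (Real.exp (p 0)) (Real.exp (p 1)) / metricDenom (Real.exp (p 0)) (Real.exp (p 1)),
      metricF (Real.exp (p 0)) (Real.exp (p 1)) / metricDenom (Real.exp (p 0)) (Real.exp (p 1));
      metricF (Real.exp (p 0)) (Real.exp (p 1)) / metricDenom (Real.exp (p 0)) (Real.exp (p 1)),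
      metricE (Real.exp (p 1)) (Real.exp (p 0)) / metricDenom (Real.exp (p 0)) (Real.exp (p 1))] := by
  obtain ⟨ha, hb⟩ := one_lt_exp_of_quadrant hp
  have h1 : Real.exp (p 0) * Real.exp (p 1) - 1 ≠ 0 := by nlinarith
  have h2 := (weightPoly_pos ha hb).ne'
  have h3 : Real.exp (p 0) + Real.exp (p 1) + 2 ≠ 0 := by positivity
  have h4 : Real.exp (p 0) + 1 ≠ 0 := by positivity
  have h5 : Real.exp (p 1) + 1 ≠ 0 := by positivity
  ext i j
  rw [beltMetric, Matrix.of_apply, pressureInner_eq (sum_edgeProb_chart hp)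
    (edgeMean_partialDeriv_chart hp i) (edgeMean_partialDeriv_chart hp j),
    totalWeight_chart hp, Fin.sum_univ_three, edgeProb_chart_zero, edgeProb_chart_one,
    edgeProb_chart_two hp]
  have d0 := (hasPartialAt_chart_zero hp).partialDeriv_eq
  have d1 := (hasPartialAt_chart_one hp).partialDeriv_eq
  unfold weightPoly at h2
  generalize Real.exp (p 0) = a at *
  generalize Real.exp (p 1) = b at *
  have h4' : 1 + a ≠ 0 := by rwa [add_comm]
  have h5' : 1 + b ≠ 0 := by rwa [add_comm]
  fin_cases i <;> fin_cases j <;>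
    simp only [Fin.zero_eta, Fin.mk_one, d0, d1, Matrix.cons_val, Matrix.of_apply, Fin.isValue,
      metricE, metricF, metricDenom, weightPoly] <;>
    field_simp <;> ring

end Metric

end BeltBuckle
end

/-! ### Brioschi's formula for a metric on the quadrant. -/

noncomputable section

namespace BeltBuckle

/-- The numerator of Brioschi's formula for the Gaussian curvature, where `k` stands for
`-E₁₁ / 2 + F₀₁ - G₀₀ / 2`. -/
def brioschi (E F G E0 E1 F0 F1 G0 G1 k : ℝ) : ℝ :=
  k * (E * G - F ^ 2) - E0 / 2 * ((F1 - G0 / 2) * G - F * (G1 / 2)) +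
    (F0 - E1 / 2) * ((F1 - G0 / 2) * F - E * (G1 / 2)) +
    E1 / 2 * (E1 / 2 * G - F * (G0 / 2)) - G0 / 2 * (E1 / 2 * F - E * (G0 / 2))

/-- Brioschi's formula. -/
theorem gaussianCurvature_eq_brioschi {g : (Fin 2 → ℝ) → Matrix (Fin 2) (Fin 2) ℝ}
    {E F G E0 E1 F0 F1 G0 G1 : (Fin 2 → ℝ) → ℝ} {e11 f01 g00 g01 : ℝ} {p : Fin 2 → ℝ}
    (hg : ∀ q ∈ quadrant, g q = !![E q, F q; F q, G q])
    (hD : ∀ q ∈ quadrant, E q * G q - F q ^ 2 ≠ 0)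
    (hE0 : ∀ q ∈ quadrant, HasPartialAt 0 E (E0 q) q) (hE1 : ∀ q ∈ quadrant, HasPartialAt 1 E (E1 q) q)
    (hF0 : ∀ q ∈ quadrant, HasPartialAt 0 F (F0 q) q) (hF1 : ∀ q ∈ quadrant, HasPartialAt 1 F (F1 q) q)
    (hG0 : ∀ q ∈ quadrant, HasPartialAt 0 G (G0 q) q) (hG1 : ∀ q ∈ quadrant, HasPartialAt 1 G (G1 q) q)
    (hp : p ∈ quadrant) (hE11 : HasPartialAt 1 E1 e11 p) (hF01 : HasPartialAt 0 F1 f01 p)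
    (hG00 : HasPartialAt 0 G0 g00 p) (hG01 : HasPartialAt 0 G1 g01 p)
    (hG10 : HasPartialAt 1 G0 g01 p) :
    gaussianCurvature g p = brioschi (E p) (F p) (G p) (E0 p) (E1 p) (F0 p) (F1 p) (G0 p) (G1 p)
      (-e11 / 2 + f01 - g00 / 2) / (E p * G p - F p ^ 2) ^ 2 := by
  have hpart : ∀ q ∈ quadrant,
      partialDeriv 0 (fun q => g q 0 0) q = E0 q ∧ partialDeriv 1 (fun q => g q 0 0) q = E1 q ∧
      partialDeriv 0 (fun q => g q 0 1) q = F0 q ∧ partialDeriv 1 (fun q => g q 0 1) q = F1 q ∧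
      partialDeriv 0 (fun q => g q 1 0) q = F0 q ∧ partialDeriv 1 (fun q => g q 1 0) q = F1 q ∧
      partialDeriv 0 (fun q => g q 1 1) q = G0 q ∧ partialDeriv 1 (fun q => g q 1 1) q = G1 q :=
    fun q hq =>
    ⟨((hE0 q hq).congr_of_quadrant hq fun q hq => by rw [hg q hq]; rfl).partialDeriv_eq,
      ((hE1 q hq).congr_of_quadrant hq fun q hq => by rw [hg q hq]; rfl).partialDeriv_eq,
      ((hF0 q hq).congr_of_quadrant hq fun q hq => by rw [hg q hq]; rfl).partialDeriv_eq,
      ((hF1 q hq).congr_of_quadrant hq fun q hq => by rw [hg q hq]; rfl).partialDeriv_eq,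
      ((hF0 q hq).congr_of_quadrant hq fun q hq => by rw [hg q hq]; rfl).partialDeriv_eq,
      ((hF1 q hq).congr_of_quadrant hq fun q hq => by rw [hg q hq]; rfl).partialDeriv_eq,
      ((hG0 q hq).congr_of_quadrant hq fun q hq => by rw [hg q hq]; rfl).partialDeriv_eq,
      ((hG1 q hq).congr_of_quadrant hq fun q hq => by rw [hg q hq]; rfl).partialDeriv_eq⟩
  have hinv : ∀ q ∈ quadrant, (g q)⁻¹ = (E q * G q - F q ^ 2)⁻¹ • !![G q, -F q; -F q, E q] := by
    intro q hq
    rw [hg q hq, Matrix.inv_def, Matrix.det_fin_two_of, Matrix.adjugate_fin_two_of,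
      Ring.inverse_eq_inv', sq]
  have hchr : ∀ q ∈ quadrant,
      christoffel g 0 0 0 q = (G q * E0 q - F q * (2 * F0 q - E1 q)) /
        (2 * (E q * G q - F q ^ 2)) ∧
      christoffel g 1 0 0 q = (E q * (2 * F0 q - E1 q) - F q * E0 q) /
        (2 * (E q * G q - F q ^ 2)) ∧
      christoffel g 0 0 1 q = (G q * E1 q - F q * G0 q) / (2 * (E q * G q - F q ^ 2)) ∧
      christoffel g 1 0 1 q = (E q * G0 q - F q * E1 q) / (2 * (E q * G q - F q ^ 2)) ∧
      christoffel g 0 1 0 q = (G q * E1 q - F q * G0 q) / (2 * (E q * G q - F q ^ 2)) ∧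
      christoffel g 1 1 0 q = (E q * G0 q - F q * E1 q) / (2 * (E q * G q - F q ^ 2)) ∧
      christoffel g 0 1 1 q = (G q * (2 * F1 q - G0 q) - F q * G1 q) /
        (2 * (E q * G q - F q ^ 2)) ∧
      christoffel g 1 1 1 q = (E q * G1 q - F q * (2 * F1 q - G0 q)) /
        (2 * (E q * G q - F q ^ 2)) := by
    intro q hq
    obtain ⟨h1, h2, h3, h4, h5, h6, h7, h8⟩ := hpart q hq
    have hDq := hD q hq
    simp only [christoffel, Fin.sum_univ_two, hinv q hq, h1, h2, h3, h4, h5, h6, h7, h8,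
      Matrix.smul_apply, Matrix.of_apply, Matrix.cons_val', Matrix.cons_val_zero,
      Matrix.cons_val_one, Matrix.cons_val_fin_one, smul_eq_mul]
    refine ⟨?_, ?_, ?_, ?_, ?_, ?_, ?_, ?_⟩ <;> (field_simp; ring)
  have hD0 : ∀ q ∈ quadrant, 2 * (E q * G q - F q ^ 2) ≠ 0 := fun q hq =>
    mul_ne_zero two_ne_zero (hD q hq)
  have pD0 := (((hE0 p hp).mul (hG0 p hp)).sub ((hF0 p hp).mul (hF0 p hp))).const_mul 2
  have pD1 := (((hE1 p hp).mul (hG1 p hp)).sub ((hF1 p hp).mul (hF1 p hp))).const_mul 2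
  simp only [← sq] at pD0 pD1
  have pF0 := (hF01.const_mul 2).sub hG00
  -- Only four Christoffel symbols are differentiated in the curvature component. The mixed
  -- derivative `g01` of `G` enters their derivatives but cancels, so it is absent from `brioschi`.
  have c011 := ((((hG0 p hp).mul pF0).sub ((hF0 p hp).mul hG01)).div pD0
    (hD0 p hp)).congr_of_quadrant hp fun q hq => (hchr q hq).2.2.2.2.2.2.1
  have c111 := ((((hE0 p hp).mul hG01).sub ((hF0 p hp).mul pF0)).div pD0
    (hD0 p hp)).congr_of_quadrant hp fun q hq => (hchr q hq).2.2.2.2.2.2.2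
  have c001 := ((((hG1 p hp).mul hE11).sub ((hF1 p hp).mul hG10)).div pD1
    (hD0 p hp)).congr_of_quadrant hp fun q hq => (hchr q hq).2.2.1
  have c101 := ((((hE1 p hp).mul hG10).sub ((hF1 p hp).mul hE11)).div pD1
    (hD0 p hp)).congr_of_quadrant hp fun q hq => (hchr q hq).2.2.2.1
  obtain ⟨h1, h2, h3, h4, h5, h6, h7, h8⟩ := hchr p hp
  simp only [gaussianCurvature, riemannTensor, Fin.sum_univ_two]
  rw [show partialDeriv 0 (christoffel g 0 1 1) p = _ from c011.partialDeriv_eq,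
    show partialDeriv 0 (christoffel g 1 1 1) p = _ from c111.partialDeriv_eq,
    show partialDeriv 1 (christoffel g 0 0 1) p = _ from c001.partialDeriv_eq,
    show partialDeriv 1 (christoffel g 1 0 1) p = _ from c101.partialDeriv_eq,
    h1, h2, h3, h4, h5, h6, h7, h8, hg p hp, Matrix.det_fin_two_of]
  simp only [Matrix.of_apply, Matrix.cons_val', Matrix.cons_val_zero, Matrix.cons_val_one,
    Matrix.cons_val_fin_one]
  have hDp := hD p hp
  have hDs : E p * G p - F p * F p = E p * G p - F p ^ 2 := by ring
  rw [hDs]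
  generalize hDD : E p * G p - F p ^ 2 = D at *
  simp only [brioschi, hDD]
  field_simp
  subst hDD
  ring

end BeltBuckle
end

/-! ### Derivatives of the metric coefficients and the curvature identity. -/

noncomputable section

namespace BeltBuckle

/-- A function of `a = e^x` and `b = e^y`, in terms of `(x, y)`. -/
def expPull (φ : ℝ → ℝ → ℝ) (q : Fin 2 → ℝ) : ℝ := φ (Real.exp (q 0)) (Real.exp (q 1))

/-- In the variable `a = e^x` the derivative in `x` is `a ∂ₐ`, which keeps polynomials polynomial.
-/
lemma hasPartialAt_zero_expPull {φ ψ : ℝ → ℝ → ℝ} (hd : ∀ b, Differentiable ℝ fun a => φ a b)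
    (h : ∀ a b, deriv (fun a => φ a b) a * a = ψ a b) (p : Fin 2 → ℝ) :
    HasPartialAt 0 (expPull φ) (expPull ψ p) p := by
  have := ((hd (Real.exp (p 1)) (Real.exp (p 0))).hasDerivAt).comp (p 0) (Real.hasDerivAt_exp (p 0))
  rw [h] at this
  simpa [HasPartialAt, Function.comp_def, expPull] using this

lemma hasPartialAt_one_expPull {φ ψ : ℝ → ℝ → ℝ} (hd : ∀ a, Differentiable ℝ fun b => φ a b)
    (h : ∀ a b, deriv (fun b => φ a b) b * b = ψ a b) (p : Fin 2 → ℝ) :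
    HasPartialAt 1 (expPull φ) (expPull ψ p) p := by
  have := ((hd (Real.exp (p 0)) (Real.exp (p 1))).hasDerivAt).comp (p 1) (Real.hasDerivAt_exp (p 1))
  rw [h] at this
  simpa [HasPartialAt, Function.comp_def, expPull] using this

/-! The polynomials obtained by applying `a ∂ₐ` and `b ∂_b` (suffixes `x` and `y`). -/

/-- `x`-derivative of `metricE`. -/
def metricEx (a b : ℝ) : ℝ := a * (b + 1) ^ 2 * (3 * a ^ 2 * b + b + 2)

/-- `y`-derivative of `metricE`. -/
def metricEy (a b : ℝ) : ℝ := a * b * (b + 1) * (3 * a ^ 2 * b + a ^ 2 + 3 * b + 5)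

/-- `xy`-derivative of `metricE`. -/
def metricExy (a b : ℝ) : ℝ := a * b * (b + 1) * (9 * a ^ 2 * b + 3 * a ^ 2 + 3 * b + 5)

/-- `yy`-derivative of `metricE`. -/
def metricEyy (a b : ℝ) : ℝ :=
  a * b * ((2 * b + 1) * (3 * a ^ 2 * b + a ^ 2 + 3 * b + 5) + 3 * b * (b + 1) * (a ^ 2 + 1))

/-- `x`-derivative of `metricF`. -/
def metricFx (a b : ℝ) : ℝ :=
  a * b * (b + 1) * ((2 * a + 1) * (3 + a + b - a * b) + (a + 1) * a * (1 - b))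

/-- `xy`-derivative of `metricF`. -/
def metricFxy (a b : ℝ) : ℝ :=
  a * b * ((2 * b + 1) * ((2 * a + 1) * (3 + a + b - a * b) + (a + 1) * a * (1 - b)) +
    b * (b + 1) * ((2 * a + 1) * (1 - a) - a * (a + 1)))

/-- `x`-derivative of `metricDenom`. -/
def metricDenomx (a b : ℝ) : ℝ :=
  2 * ((3 * (a * b) + 2 * (a ^ 2 * b) + a * b ^ 2) * ((a * b - 1) * (a + b + 2)) +
    weightPoly a b * (2 * (a ^ 2 * b) + a * b ^ 2 + 2 * (a * b) - a))

/-- `xx`-derivative of `metricDenom`. -/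
def metricDenomxx (a b : ℝ) : ℝ :=
  2 * ((3 * (a * b) + 4 * (a ^ 2 * b) + a * b ^ 2) * ((a * b - 1) * (a + b + 2)) +
    2 * (3 * (a * b) + 2 * (a ^ 2 * b) + a * b ^ 2) *
      (2 * (a ^ 2 * b) + a * b ^ 2 + 2 * (a * b) - a) +
    weightPoly a b * (4 * (a ^ 2 * b) + a * b ^ 2 + 2 * (a * b) - a))

/-- `xy`-derivative of `metricDenom`. -/
def metricDenomxy (a b : ℝ) : ℝ :=
  2 * ((3 * (a * b) + 2 * (a ^ 2 * b) + 2 * (a * b ^ 2)) * ((a * b - 1) * (a + b + 2)) +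
    (3 * (a * b) + 2 * (a ^ 2 * b) + a * b ^ 2) *
      (a ^ 2 * b + 2 * (a * b ^ 2) + 2 * (a * b) - b) +
    (3 * (a * b) + a ^ 2 * b + 2 * (a * b ^ 2)) *
      (2 * (a ^ 2 * b) + a * b ^ 2 + 2 * (a * b) - a) +
    weightPoly a b * (2 * (a ^ 2 * b) + 2 * (a * b ^ 2) + 2 * (a * b)))

lemma metricF_comm (a b : ℝ) : metricF a b = metricF b a := by unfold metricF; ring

lemma metricFxy_comm (a b : ℝ) : metricFxy a b = metricFxy b a := by unfold metricFxy; ring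

lemma metricDenom_comm (a b : ℝ) : metricDenom a b = metricDenom b a := by
  unfold metricDenom weightPoly; ring

lemma metricDenomxy_comm (a b : ℝ) : metricDenomxy a b = metricDenomxy b a := by
  unfold metricDenomxy weightPoly; ring

section Derivatives

lemma deriv_metricE_left (a b : ℝ) : deriv (fun a => metricE a b) a * a = metricEx a b := by
  unfold metricE
  simp (disch := fun_prop) [metricEx]
  ring

lemma deriv_metricE_right (a b : ℝ) : deriv (fun b => metricE a b) b * b = metricEy a b := by
  unfold metricE
  simp (disch := fun_prop) [metricEy]
  ring

lemma deriv_metricEy_left (a b : ℝ) : deriv (fun a => metricEy a b) a * a = metricExy a b := by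
  unfold metricEy
  simp (disch := fun_prop) [metricExy]
  ring

lemma deriv_metricEx_right (a b : ℝ) : deriv (fun b => metricEx a b) b * b = metricExy a b := by
  unfold metricEx
  simp (disch := fun_prop) [metricExy]
  ring

lemma deriv_metricEy_right (a b : ℝ) : deriv (fun b => metricEy a b) b * b = metricEyy a b := by
  unfold metricEy
  simp (disch := fun_prop) [metricEyy]
  ring

lemma deriv_metricF_left (a b : ℝ) : deriv (fun a => metricF a b) a * a = metricFx a b := by
  unfold metricF
  simp (disch := fun_prop) [metricFx]
  ring

lemma deriv_metricFx_right (a b : ℝ) : deriv (fun b => metricFx a b) b * b = metricFxy a b := by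
  unfold metricFx
  simp (disch := fun_prop) [metricFxy]
  ring

lemma deriv_metricDenom_left (a b : ℝ) :
    deriv (fun a => metricDenom a b) a * a = metricDenomx a b := by
  unfold metricDenom weightPoly
  simp (disch := fun_prop) [metricDenomx, weightPoly]
  ring

lemma deriv_metricDenomx_left (a b : ℝ) :
    deriv (fun a => metricDenomx a b) a * a = metricDenomxx a b := by
  unfold metricDenomx weightPoly
  simp (disch := fun_prop) [metricDenomxx, weightPoly]
  ring

lemma deriv_metricDenomx_right (a b : ℝ) :
    deriv (fun b => metricDenomx a b) b * b = metricDenomxy a b := by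
  unfold metricDenomx weightPoly
  simp (disch := fun_prop) [metricDenomxy, weightPoly]
  ring

end Derivatives

section Quotients

variable {u ui uj m mi mj : (Fin 2 → ℝ) → ℝ} {uij mij : ℝ} {i : Fin 2} {p : Fin 2 → ℝ}

/-- The numerator of a first derivative of `u / m`. -/
def quotDeriv (u ui m mi : ℝ) : ℝ := ui * m - u * mi

/-- The numerator of a second derivative of `u / m`. -/
def quotDeriv₂ (u ui uj uij m mi mj mij : ℝ) : ℝ :=
  (uij * m + uj * mi - (ui * mj + u * mij)) * m - 2 * mi * (uj * m - u * mj)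

lemma quotDeriv₂_comm (u ui uj uij m mi mj mij : ℝ) :
    quotDeriv₂ u ui uj uij m mi mj mij = quotDeriv₂ u uj ui uij m mj mi mij := by
  unfold quotDeriv₂; ring

lemma HasPartialAt.quot (hu : HasPartialAt i u (ui p) p) (hm : HasPartialAt i m (mi p) p)
    (h0 : m p ≠ 0) :
    HasPartialAt i (fun q => u q / m q) (quotDeriv (u p) (ui p) (m p) (mi p) / m p ^ 2) p :=
  hu.div hm h0

/-- One factor `m` cancels from the quotient rule, leaving `m³` instead of `m⁴`; this keeps the
final polynomial identity small and `brioschi_div` homogeneous. -/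
lemma HasPartialAt.quot₂ (hu : HasPartialAt i u (ui p) p) (huj : HasPartialAt i uj uij p)
    (hm : HasPartialAt i m (mi p) p) (hmj : HasPartialAt i mj mij p) (h0 : m p ≠ 0) :
    HasPartialAt i (fun q => quotDeriv (u q) (uj q) (m q) (mj q) / m q ^ 2)
      (quotDeriv₂ (u p) (ui p) (uj p) uij (m p) (mi p) (mj p) mij / m p ^ 3) p := by
  have h := ((huj.mul hm).sub (hu.mul hmj)).div (hm.mul hm) (mul_ne_zero h0 h0)
  simp only [← sq] at h
  have hv : ((uij * m p + uj p * mi p - (ui p * mj p + u p * mij)) * m p ^ 2 -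
      (uj p * m p - u p * mj p) * (mi p * m p + m p * mi p)) / (m p ^ 2) ^ 2 =
      quotDeriv₂ (u p) (ui p) (uj p) uij (m p) (mi p) (mj p) mij / m p ^ 3 := by
    unfold quotDeriv₂
    field_simp
    ring
  rw [hv] at h
  exact h

/-- Every monomial has total weight five, counting one for a coefficient, two for a first derivative
and three for a second derivative. -/
lemma brioschi_div (E F G E0 E1 F0 F1 G0 G1 e f g : ℝ) {m : ℝ} (hm : m ≠ 0) :
    brioschi (E / m) (F / m) (G / m) (E0 / m ^ 2) (E1 / m ^ 2) (F0 / m ^ 2) (F1 / m ^ 2)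
      (G0 / m ^ 2) (G1 / m ^ 2) (-(e / m ^ 3) / 2 + f / m ^ 3 - g / m ^ 3 / 2) =
    brioschi E F G E0 E1 F0 F1 G0 G1 (-e / 2 + f - g / 2) / m ^ 5 := by
  unfold brioschi
  field_simp

end Quotients

/-- The discriminant of the numerators of the metric. -/
def metricDisc (a b : ℝ) : ℝ :=
  2 * (a * b) * (a + 1) ^ 2 * (b + 1) ^ 2 * (a * b - 1) ^ 2 * (a + b + 2)

/-- The factored form makes the sign visible and gives both nondegeneracy and positive definiteness.
-/
lemma metricE_mul_sub_sq (a b : ℝ) :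
    metricE a b * metricE b a - metricF a b ^ 2 = metricDisc a b := by
  unfold metricE metricF metricDisc; ring

lemma metricDisc_pos {a b : ℝ} (ha : 1 < a) (hb : 1 < b) : 0 < metricDisc a b := by
  have h1 : 0 < a * b - 1 := by nlinarith
  have h2 : 0 < a + b + 2 := by linarith
  unfold metricDisc
  positivity

/-- The Brioschi numerator of the metric in terms of `a` and `b`. -/
def metricBrioschi (a b : ℝ) : ℝ :=
  brioschi (metricE a b) (metricF a b) (metricE b a)
    (quotDeriv (metricE a b) (metricEx a b) (metricDenom a b) (metricDenomx a b))
    (quotDeriv (metricE a b) (metricEy a b) (metricDenom a b) (metricDenomx b a))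
    (quotDeriv (metricF a b) (metricFx a b) (metricDenom a b) (metricDenomx a b))
    (quotDeriv (metricF a b) (metricFx b a) (metricDenom a b) (metricDenomx b a))
    (quotDeriv (metricE b a) (metricEy b a) (metricDenom a b) (metricDenomx a b))
    (quotDeriv (metricE b a) (metricEx b a) (metricDenom a b) (metricDenomx b a))
    (-quotDeriv₂ (metricE a b) (metricEy a b) (metricEy a b) (metricEyy a b) (metricDenom a b)
        (metricDenomx b a) (metricDenomx b a) (metricDenomxx b a) / 2 +
      quotDeriv₂ (metricF a b) (metricFx a b) (metricFx b a) (metricFxy a b) (metricDenom a b)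
        (metricDenomx a b) (metricDenomx b a) (metricDenomxy a b) -
      quotDeriv₂ (metricE b a) (metricEy b a) (metricEy b a) (metricEyy b a) (metricDenom a b)
        (metricDenomx a b) (metricDenomx a b) (metricDenomxx a b) / 2)

/-- The numerator of the curvature. -/
def curvatureNum (a b : ℝ) : ℝ :=
  5 + 6 * a + 3 * a ^ 2 + 6 * b + 3 * b ^ 2 + 3 * (a * b) + 45 * (a ^ 2 * b ^ 2)
    + 19 * (a ^ 3 * b ^ 3) + 11 * (a ^ 2 * b) + 9 * (a ^ 3 * b) + 3 * (a ^ 4 * b)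
    + 11 * (a * b ^ 2) + 33 * (a ^ 3 * b ^ 2) + 8 * (a ^ 4 * b ^ 2) + 9 * (a * b ^ 3)
    + 33 * (a ^ 2 * b ^ 3) + 3 * (a ^ 4 * b ^ 3) + 3 * (a * b ^ 4) + 8 * (a ^ 2 * b ^ 4)
    + 3 * (a ^ 3 * b ^ 4)

-- The whole curvature computation as one polynomial identity: with `m` the common denominator,
-- Brioschi's quotient is `metricBrioschi / (m · metricDisc²)`, and this compares it with the
-- claimed fraction after clearing denominators.
set_option maxHeartbeats 4000000 in
lemma metricBrioschi_mul (a b : ℝ) :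
    metricBrioschi a b * (4 * (a + 1) ^ 2 * (b + 1) ^ 2 * weightPoly a b) =
      curvatureNum a b * metricDenom a b * metricDisc a b ^ 2 := by
  unfold metricBrioschi brioschi quotDeriv quotDeriv₂ metricE metricF metricEx metricEy metricEyy
    metricFx metricFxy metricDenomx metricDenomxx metricDenomxy metricDenom metricDisc weightPoly
    curvatureNum
  ring

end BeltBuckle
end

/-! ### The curvature formula, its bounds, and positivity and smoothness of the metric. -/

noncomputable section

namespace BeltBuckle

lemma beltCurvature_eq_div {p : Fin 2 → ℝ} (hp : p ∈ quadrant) :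
    beltCurvature p = metricBrioschi (Real.exp (p 0)) (Real.exp (p 1)) /
      metricDenom (Real.exp (p 0)) (Real.exp (p 1)) ^ 5 /
      (metricDisc (Real.exp (p 0)) (Real.exp (p 1)) /
        metricDenom (Real.exp (p 0)) (Real.exp (p 1)) ^ 2) ^ 2 := by
  have dE0 := fun q => hasPartialAt_zero_expPull (φ := metricE) (ψ := metricEx)
    (fun b => by unfold metricE; fun_prop) deriv_metricE_left q
  have dE1 := fun q => hasPartialAt_one_expPull (φ := metricE) (ψ := metricEy)
    (fun b => by unfold metricE; fun_prop) deriv_metricE_right q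
  have dE11 := fun q => hasPartialAt_one_expPull (φ := metricEy) (ψ := metricEyy)
    (fun b => by unfold metricEy; fun_prop) deriv_metricEy_right q
  have dG0 := fun q => hasPartialAt_zero_expPull (φ := fun a b => metricE b a)
    (ψ := fun a b => metricEy b a) (fun b => by unfold metricE; fun_prop)
    (fun a b => deriv_metricE_right b a) q
  have dG1 := fun q => hasPartialAt_one_expPull (φ := fun a b => metricE b a)
    (ψ := fun a b => metricEx b a) (fun b => by unfold metricE; fun_prop)
    (fun a b => deriv_metricE_left b a) q
  have dG00 := fun q => hasPartialAt_zero_expPull (φ := fun a b => metricEy b a)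
    (ψ := fun a b => metricEyy b a) (fun b => by unfold metricEy; fun_prop)
    (fun a b => deriv_metricEy_right b a) q
  have dG01 := fun q => hasPartialAt_zero_expPull (φ := fun a b => metricEx b a)
    (ψ := fun a b => metricExy b a) (fun b => by unfold metricEx; fun_prop)
    (fun a b => deriv_metricEx_right b a) q
  have dG10 := fun q => hasPartialAt_one_expPull (φ := fun a b => metricEy b a)
    (ψ := fun a b => metricExy b a) (fun b => by unfold metricEy; fun_prop)
    (fun a b => deriv_metricEy_left b a) q
  have dF0 := fun q => hasPartialAt_zero_expPull (φ := metricF) (ψ := metricFx)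
    (fun b => by unfold metricF; fun_prop) deriv_metricF_left q
  have dF1 := fun q => hasPartialAt_one_expPull (φ := metricF) (ψ := fun a b => metricFx b a)
    (fun b => by unfold metricF; fun_prop)
    (fun a b => by simp only [metricF_comm a]; exact deriv_metricF_left b a) q
  have dF01 := fun q => hasPartialAt_zero_expPull (φ := fun a b => metricFx b a) (ψ := metricFxy)
    (fun b => by unfold metricFx; fun_prop)
    (fun a b => by rw [metricFxy_comm]; exact deriv_metricFx_right b a) q
  have dm0 := fun q => hasPartialAt_zero_expPull (φ := metricDenom) (ψ := metricDenomx)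
    (fun b => by unfold metricDenom weightPoly; fun_prop) deriv_metricDenom_left q
  have dm1 := fun q => hasPartialAt_one_expPull (φ := metricDenom) (ψ := fun a b => metricDenomx b a)
    (fun b => by unfold metricDenom weightPoly; fun_prop)
    (fun a b => by simp only [metricDenom_comm a]; exact deriv_metricDenom_left b a) q
  have dm00 := fun q => hasPartialAt_zero_expPull (φ := metricDenomx) (ψ := metricDenomxx)
    (fun b => by unfold metricDenomx weightPoly; fun_prop) deriv_metricDenomx_left q
  have dm10 := fun q => hasPartialAt_one_expPull (φ := metricDenomx) (ψ := metricDenomxy)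
    (fun b => by unfold metricDenomx weightPoly; fun_prop) deriv_metricDenomx_right q
  have dm01 := fun q => hasPartialAt_zero_expPull (φ := fun a b => metricDenomx b a)
    (ψ := metricDenomxy) (fun b => by unfold metricDenomx weightPoly; fun_prop)
    (fun a b => by rw [metricDenomxy_comm]; exact deriv_metricDenomx_right b a) q
  have dm11 := fun q => hasPartialAt_one_expPull (φ := fun a b => metricDenomx b a)
    (ψ := fun a b => metricDenomxx b a) (fun b => by unfold metricDenomx weightPoly; fun_prop)
    (fun a b => deriv_metricDenomx_left b a) q
  have hm : ∀ q ∈ quadrant, expPull metricDenom q ≠ 0 := fun q hq =>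
    (metricDenom_pos (one_lt_exp_of_quadrant hq).1 (one_lt_exp_of_quadrant hq).2).ne'
  have hdisc : ∀ q : Fin 2 → ℝ, expPull metricE q / expPull metricDenom q *
      (expPull (fun a b => metricE b a) q / expPull metricDenom q) -
      (expPull metricF q / expPull metricDenom q) ^ 2 =
      expPull metricDisc q / expPull metricDenom q ^ 2 := fun q => by
    have : expPull metricDisc q = expPull metricE q * expPull (fun a b => metricE b a) q -
      expPull metricF q ^ 2 := (metricE_mul_sub_sq _ _).symm
    rw [this]
    ring
  have hK := gaussianCurvature_eq_brioschi (g := beltMetric)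
    (E := fun q => expPull metricE q / expPull metricDenom q)
    (F := fun q => expPull metricF q / expPull metricDenom q)
    (G := fun q => expPull (fun a b => metricE b a) q / expPull metricDenom q)
    (fun q hq => beltMetric_eq hq)
    (fun q hq => by
      rw [hdisc]
      exact div_ne_zero (metricDisc_pos (one_lt_exp_of_quadrant hq).1
        (one_lt_exp_of_quadrant hq).2).ne' (pow_ne_zero 2 (hm q hq)))
    (fun q hq => (dE0 q).quot (dm0 q) (hm q hq)) (fun q hq => (dE1 q).quot (dm1 q) (hm q hq))
    (fun q hq => (dF0 q).quot (dm0 q) (hm q hq)) (fun q hq => (dF1 q).quot (dm1 q) (hm q hq))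
    (fun q hq => (dG0 q).quot (dm0 q) (hm q hq)) (fun q hq => (dG1 q).quot (dm1 q) (hm q hq))
    hp ((dE1 p).quot₂ (dE11 p) (dm1 p) (dm11 p) (hm p hp))
    ((dF0 p).quot₂ (dF01 p) (dm0 p) (dm01 p) (hm p hp))
    ((dG0 p).quot₂ (dG00 p) (dm0 p) (dm00 p) (hm p hp))
    ((dG0 p).quot₂ (dG01 p) (dm0 p) (dm01 p) (hm p hp))
    (by
      rw [quotDeriv₂_comm]
      exact (dG1 p).quot₂ (dG10 p) (dm1 p) (dm10 p) (hm p hp))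
  beta_reduce at hK
  rw [hdisc, brioschi_div _ _ _ _ _ _ _ _ _ _ _ _ (hm p hp)] at hK
  exact hK

theorem beltCurvature_eq {p : Fin 2 → ℝ} (hp : p ∈ quadrant) :
    beltCurvature p = beltCurvatureFormula (Real.exp (p 0)) (Real.exp (p 1)) := by
  obtain ⟨ha, hb⟩ := one_lt_exp_of_quadrant hp
  rw [beltCurvature_eq_div hp]
  generalize Real.exp (p 0) = a at *
  generalize Real.exp (p 1) = b at *
  have hm := (metricDenom_pos ha hb).ne'
  have hd := (metricDisc_pos ha hb).ne'
  have hq := (weightPoly_pos ha hb).ne'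
  have hmul := metricBrioschi_mul a b
  have h1 : metricBrioschi a b / metricDenom a b ^ 5 / (metricDisc a b / metricDenom a b ^ 2) ^ 2 =
      metricBrioschi a b / (metricDenom a b * metricDisc a b ^ 2) := by
    field_simp
  change _ = curvatureNum a b / (4 * (a + 1) ^ 2 * (b + 1) ^ 2 * weightPoly a b)
  rw [h1, div_eq_div_iff (by positivity) (by positivity), hmul]
  ring

section Bounds

variable {a b : ℝ}

/-- The curvature is comparable to a constant. -/
lemma curvatureFormula_bounds (ha : 1 < a) (hb : 1 < b) :
    1 / 1000 ≤ beltCurvatureFormula a b ∧ beltCurvatureFormula a b ≤ 1000 := by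
  have hq := weightPoly_pos ha hb
  change 1 / 1000 ≤ curvatureNum a b / (4 * (a + 1) ^ 2 * (b + 1) ^ 2 * weightPoly a b) ∧
    curvatureNum a b / (4 * (a + 1) ^ 2 * (b + 1) ^ 2 * weightPoly a b) ≤ 1000
  have hden : 0 < 4 * (a + 1) ^ 2 * (b + 1) ^ 2 * weightPoly a b := by
    have : 0 < a + 1 := by linarith
    have : 0 < b + 1 := by linarith
    positivity
  -- With `s, t > 0` as variables, each difference to be shown nonnegative expands with positive
  -- coefficients only. The constants `1/1000` and `1000` are not sharp.
  obtain ⟨s, rfl⟩ : ∃ s, a = 1 + s := ⟨a - 1, by ring⟩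
  obtain ⟨t, rfl⟩ : ∃ t, b = 1 + t := ⟨b - 1, by ring⟩
  have hs : 0 < s := by linarith
  have ht : 0 < t := by linarith
  constructor
  · rw [le_div_iff₀ hden, ← sub_nonneg]
    unfold curvatureNum weightPoly
    ring_nf
    positivity
  · rw [div_le_iff₀ hden, ← sub_nonneg]
    unfold curvatureNum weightPoly
    ring_nf
    positivity

end Bounds

/-- Completing the square, the quadratic form is a positive multiple of `(E x_0 + F x_1)² + disc ·
x_1²`. The formula with weights `1 - 2 q_i` would not suffice: `q_2` exceeds `1/2` where the third
length is negative. -/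
theorem beltMetric_posDef {p : Fin 2 → ℝ} (hp : p ∈ quadrant) : (beltMetric p).PosDef := by
  obtain ⟨ha, hb⟩ := one_lt_exp_of_quadrant hp
  rw [beltMetric_eq hp]
  generalize Real.exp (p 0) = a at *
  generalize Real.exp (p 1) = b at *
  have hm := metricDenom_pos ha hb
  have hd := metricDisc_pos ha hb
  have hE : 0 < metricE a b := by unfold metricE; positivity
  refine Matrix.PosDef.of_dotProduct_mulVec_pos ?_ fun x hx => ?_
  · ext i j
    fin_cases i <;> fin_cases j <;> simp
  · have h1 : star x ⬝ᵥ (!![metricE a b / metricDenom a b, metricF a b / metricDenom a b;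
        metricF a b / metricDenom a b, metricE b a / metricDenom a b]).mulVec x =
        ((metricE a b * x 0 + metricF a b * x 1) ^ 2 + metricDisc a b * x 1 ^ 2) /
          (metricE a b * metricDenom a b) := by
      rw [← metricE_mul_sub_sq]
      simp [Matrix.mulVec, dotProduct, Fin.sum_univ_two]
      field_simp
      ring
    rw [h1]
    refine div_pos ?_ (mul_pos hE hm)
    by_cases h : x 1 = 0
    · have h0 : x 0 ≠ 0 := fun h0 => hx (by ext i; fin_cases i <;> simp [h, h0])
      rw [h]
      have : 0 < (metricE a b * x 0) ^ 2 := by positivity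
      linarith
    · have : 0 < metricDisc a b * x 1 ^ 2 := by positivity
      have := sq_nonneg (metricE a b * x 0 + metricF a b * x 1)
      linarith

theorem contDiffOn_beltMetric (i j : Fin 2) :
    ContDiffOn ℝ (⊤ : ℕ∞) (fun p => beltMetric p i j) quadrant := by
  have h0 : ContDiff ℝ (⊤ : ℕ∞) fun p : Fin 2 → ℝ => Real.exp (p 0) := by fun_prop
  have h1 : ContDiff ℝ (⊤ : ℕ∞) fun p : Fin 2 → ℝ => Real.exp (p 1) := by fun_prop
  have hdiv : ∀ φ : ℝ → ℝ → ℝ, ContDiff ℝ (⊤ : ℕ∞) (expPull φ) →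
      ContDiffOn ℝ (⊤ : ℕ∞) (fun p => expPull φ p / expPull metricDenom p) quadrant := by
    intro φ hφ
    refine hφ.contDiffOn.div ?_ fun q hq => (metricDenom_pos (one_lt_exp_of_quadrant hq).1
      (one_lt_exp_of_quadrant hq).2).ne'
    unfold expPull metricDenom weightPoly
    fun_prop
  have hE := hdiv metricE (by unfold expPull metricE; fun_prop)
  have hF := hdiv metricF (by unfold expPull metricF; fun_prop)
  have hG := hdiv (fun a b => metricE b a) (by unfold expPull metricE; fun_prop)
  fin_cases i <;> fin_cases j
  · exact hE.congr fun p hp => by rw [beltMetric_eq hp]; rfl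
  · exact hF.congr fun p hp => by rw [beltMetric_eq hp]; rfl
  · exact hF.congr fun p hp => by rw [beltMetric_eq hp]; rfl
  · exact hG.congr fun p hp => by rw [beltMetric_eq hp]; rfl

end BeltBuckle
end

/-! ### The limit of the curvature, the diagonal path and incompleteness. -/

noncomputable section

namespace BeltBuckle

/-- The leading parts of numerator and denominator are `3 a³b³(a + b)` and `4 a³b³(a + b)`. The
explicit rate gives a joint limit in both variables, without relating their growth. -/
lemma abs_curvatureFormula_sub_le {a b : ℝ} (ha : 1 < a) (hb : 1 < b) :
    |beltCurvatureFormula a b - 3 / 4| ≤ 100 * (a⁻¹ + b⁻¹) := by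
  have hq := weightPoly_pos ha hb
  have ha0 : 0 < a := by linarith
  have hb0 : 0 < b := by linarith
  have hP : 0 < (a + 1) ^ 2 * (b + 1) ^ 2 * weightPoly a b := by positivity
  have h1 : beltCurvatureFormula a b - 3 / 4 =
      (curvatureNum a b - 3 * ((a + 1) ^ 2 * (b + 1) ^ 2 * weightPoly a b)) /
        (4 * ((a + 1) ^ 2 * (b + 1) ^ 2 * weightPoly a b)) := by
    change curvatureNum a b / (4 * (a + 1) ^ 2 * (b + 1) ^ 2 * weightPoly a b) - 3 / 4 = _
    field_simp
  have h2 : a⁻¹ + b⁻¹ = (a + b) / (a * b) := by field_simp; ring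
  rw [h1, h2, abs_div, abs_of_pos (by positivity : 0 < 4 * ((a + 1) ^ 2 * (b + 1) ^ 2 *
    weightPoly a b)), div_le_iff₀ (by positivity), mul_div_assoc', div_mul_eq_mul_div,
    le_div_iff₀ (by positivity), ← abs_of_pos (mul_pos ha0 hb0), ← abs_mul, abs_le]
  obtain ⟨s, rfl⟩ : ∃ s, a = 1 + s := ⟨a - 1, by ring⟩
  obtain ⟨t, rfl⟩ : ∃ t, b = 1 + t := ⟨b - 1, by ring⟩
  have hs : 0 < s := by linarith
  have ht : 0 < t := by linarith
  unfold curvatureNum weightPoly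
  constructor
  · rw [← sub_nonneg]
    ring_nf
    positivity
  · rw [← sub_nonneg]
    ring_nf
    positivity

theorem tendsto_beltCurvature :
    Tendsto (fun q : ℝ × ℝ => beltCurvature ![q.1, q.2]) (atTop ×ˢ atTop) (𝓝 (3 / 4)) := by
  have hinv : Tendsto (fun x : ℝ => (Real.exp x)⁻¹) atTop (𝓝 0) :=
    tendsto_inv_atTop_zero.comp Real.tendsto_exp_atTop
  have hlim : Tendsto (fun q : ℝ × ℝ => 100 * ((Real.exp q.1)⁻¹ + (Real.exp q.2)⁻¹))
      (atTop ×ˢ atTop) (𝓝 0) := by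
    simpa using ((hinv.comp tendsto_fst).add (hinv.comp tendsto_snd)).const_mul 100
  rw [tendsto_iff_norm_sub_tendsto_zero]
  refine squeeze_zero' (.of_forall fun _ => norm_nonneg _) ?_ hlim
  filter_upwards [(eventually_gt_atTop 0).prod_mk (eventually_gt_atTop 0)] with q hq
  have hp : ![q.1, q.2] ∈ quadrant := hq
  rw [beltCurvature_eq hp, Real.norm_eq_abs]
  obtain ⟨ha, hb⟩ := one_lt_exp_of_quadrant hp
  exact abs_curvatureFormula_sub_le ha hb

section Diagonal

variable {x : ℝ}

lemma diagonal_mem_quadrant (hx : 0 < x) : ![x, x] ∈ quadrant := ⟨hx, hx⟩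

lemma sum_edgeProb_diagonal (hx : 0 < x) : ∑ i, edgeProb (beltDiagonal x) i = 1 :=
  sum_edgeProb_chart (diagonal_mem_quadrant hx)

lemma beltDiagonal_mem_moduliSpace (hx : 0 < x) (hx3 : x < Real.log 3) :
    beltDiagonal x ∈ beltBuckle.moduliSpace := by
  rw [moduliSpace_eq]
  refine ⟨![x, x], ⟨hx, hx, ?_⟩, rfl⟩
  have h1 : Real.exp x < 3 := (Real.lt_log_iff_exp_lt (by norm_num)).1 hx3
  have h2 := Real.exp_pos x
  simp only [Matrix.cons_val_zero, Matrix.cons_val_one, Real.exp_add]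
  nlinarith

/-- The first length has a positive minimum on a nonempty compact `K`, while it equals `x` on the
diagonal. -/
lemma eventually_beltDiagonal_notMem {K : Set (Fin 3 → ℝ)} (hK : IsCompact K)
    (hsub : K ⊆ beltBuckle.moduliSpace) : ∀ᶠ x in 𝓝[>] (0 : ℝ), beltDiagonal x ∉ K := by
  rcases K.eq_empty_or_nonempty with rfl | hne
  · simp
  obtain ⟨l, hl, hmin⟩ := hK.exists_isMinOn hne (continuous_apply (0 : Fin 3)).continuousOn
  filter_upwards [nhdsWithin_le_nhds (gt_mem_nhds ((hsub hl).1 0))] with x hx hxK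
  exact absurd (hmin hxK) (not_le.2 hx)

lemma third_diagonal (hx : 0 < x) : beltDiagonal x 2 = -Real.log ((Real.exp x - 1) / 2) := by
  have h1 : 1 < Real.exp x := Real.one_lt_exp_iff.2 hx
  have h2 : beltDiagonal x 2 =
    -Real.log ((Real.exp (x + x) - 1) / (Real.exp x + Real.exp x + 2)) := rfl
  rw [h2, Real.exp_add]
  congr 2
  field_simp
  ring

lemma edgeProb_diagonal_two (hx : 0 < x) :
    edgeProb (beltDiagonal x) 2 = (Real.exp x - 1) / (Real.exp x + 1) := by
  have h := edgeProb_chart_two (diagonal_mem_quadrant hx)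
  simp only [Matrix.cons_val_zero, Matrix.cons_val_one] at h
  refine h.trans ?_
  field_simp
  ring

lemma hasDerivAt_diagonal (hx : 0 < x) : HasDerivAt beltDiagonal
    ![1, 1, -(Real.exp x / (Real.exp x - 1))] x := by
  have h1 : 0 < Real.exp x - 1 := sub_pos.2 (Real.one_lt_exp_iff.2 hx)
  rw [hasDerivAt_pi]
  have h2 : HasDerivAt (fun t => beltDiagonal t 2) (-(Real.exp x / (Real.exp x - 1))) x := by
    have hd : HasDerivAt (fun t => -Real.log ((Real.exp t - 1) / 2))
        (-(Real.exp x / (Real.exp x - 1))) x := by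
      refine (((((Real.hasDerivAt_exp x).sub_const 1).div_const 2).log
        (by positivity)).fun_neg).congr_deriv ?_
      field_simp
    refine hd.congr_of_eventuallyEq ?_
    filter_upwards [lt_mem_nhds hx] with t ht using third_diagonal ht
  intro i
  fin_cases i
  exacts [hasDerivAt_id x, hasDerivAt_id x, h2]

lemma contDiffOn_diagonal : ContDiffOn ℝ 1 beltDiagonal (Ioi 0) := by
  rw [contDiffOn_pi]
  have h2 : ContDiffOn ℝ 1 (fun t => beltDiagonal t 2) (Ioi 0) := by
    have : ContDiffOn ℝ 1 (fun t => -Real.log ((Real.exp t - 1) / 2)) (Ioi 0) := by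
      refine (ContDiffOn.log (by fun_prop) fun t ht => ?_).neg
      have : 0 < Real.exp t - 1 := sub_pos.2 (Real.one_lt_exp_iff.2 ht)
      positivity
    exact this.congr fun t ht => third_diagonal ht
  intro i
  fin_cases i
  exacts [contDiffOn_id, contDiffOn_id, h2]

lemma edgeMean_smul (l φ : Fin 3 → ℝ) (r : ℝ) : edgeMean l (r • φ) = r * edgeMean l φ := by
  simp only [edgeMean, Pi.smul_apply, smul_eq_mul, Finset.mul_sum]
  exact Finset.sum_congr rfl fun i _ => by ring

lemma pressureNormSq_smul {l : Fin 3 → ℝ} (hl : ∑ i, edgeProb l i = 1) (φ : Fin 3 → ℝ) (r : ℝ) :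
    beltBuckle.pressureNormSq l (r • φ) = r ^ 2 * beltBuckle.pressureNormSq l φ := by
  rw [pressureNormSq_eq hl, pressureNormSq_eq hl, edgeMean_smul, Finset.mul_sum]
  refine Finset.sum_congr rfl fun i _ => ?_
  simp only [Pi.smul_apply, smul_eq_mul]
  ring

/-- Tangent vectors, in terms of the weights of the edges. -/
lemma edgeMean_eq_zero_iff (l φ : Fin 3 → ℝ) : edgeMean l φ = 0 ↔
    ∑ i, edgeProb l i * (1 - edgeProb l i) * φ i = 0 := by
  have : edgeMean l φ = (∑ i, edgeProb l i * (1 - edgeProb l i) * φ i) / totalWeight l := by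
    simp only [edgeMean, edgeWeight, Finset.sum_div]
    exact Finset.sum_congr rfl fun j _ => by ring
  rw [this, div_eq_zero_iff, or_iff_left (totalWeight_pos l).ne']

lemma pressureNormSq_diagonal (hx : 0 < x) :
    beltBuckle.pressureNormSq (beltDiagonal x) (deriv beltDiagonal x) =
      Real.exp x / ((Real.exp x - 1) * (2 * Real.exp x - 1)) := by
  have h1 : 0 < Real.exp x - 1 := sub_pos.2 (Real.one_lt_exp_iff.2 hx)
  have h0 := Real.exp_pos x
  have h2 : 0 < 2 * Real.exp x - 1 := by linarith
  have e0 : edgeProb (beltDiagonal x) 0 = 1 / (1 + Real.exp x) := rfl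
  have e1 : edgeProb (beltDiagonal x) 1 = 1 / (1 + Real.exp x) := rfl
  rw [(hasDerivAt_diagonal hx).deriv, pressureNormSq_tangent (sum_edgeProb_diagonal hx), totalWeight]
  · simp only [Fin.sum_univ_three, e0, e1, edgeProb_diagonal_two hx, Matrix.cons_val]
    have h3 : 1 / (1 + Real.exp x) * (1 - 1 / (1 + Real.exp x)) +
        1 / (1 + Real.exp x) * (1 - 1 / (1 + Real.exp x)) +
        (Real.exp x - 1) / (Real.exp x + 1) * (1 - (Real.exp x - 1) / (Real.exp x + 1)) =
        2 * (2 * Real.exp x - 1) / (Real.exp x + 1) ^ 2 := by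
      field_simp
      ring
    rw [h3]
    field_simp
    ring
  · rw [edgeMean_eq_zero_iff]
    simp only [Fin.sum_univ_three, e0, e1, edgeProb_diagonal_two hx, Matrix.cons_val]
    field_simp
    ring

/-- From `e^x - 1 ≥ x` and `e^x ≤ 2 e^x - 1`. The resulting speed bound `x^{-1/2}` is integrable at
`0`. -/
lemma pressureNormSq_diagonal_le (hx : 0 < x) :
    beltBuckle.pressureNormSq (beltDiagonal x) (deriv beltDiagonal x) ≤ x⁻¹ := by
  have h1 : x + 1 ≤ Real.exp x := Real.add_one_le_exp x
  rw [pressureNormSq_diagonal hx, ← one_div, div_le_div_iff₀ (by nlinarith) hx]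
  nlinarith

theorem lintegral_diagonal_lt_top : ∫⁻ x in Ioc (0 : ℝ) 1, ENNReal.ofReal (Real.sqrt
    (beltBuckle.pressureNormSq (beltDiagonal x) (deriv beltDiagonal x))) < ⊤ := by
  have hint : IntegrableOn (fun x : ℝ => x ^ (-(1 / 2) : ℝ)) (Ioc 0 1) :=
    (intervalIntegrable_iff_integrableOn_Ioc_of_le zero_le_one).1
      (intervalIntegral.intervalIntegrable_rpow' (by norm_num))
  refine lt_of_le_of_lt (setLIntegral_mono' measurableSet_Ioc fun x hx => ?_)
    hint.setLIntegral_lt_top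
  refine ENNReal.ofReal_le_ofReal ((Real.sqrt_le_sqrt (pressureNormSq_diagonal_le hx.1)).trans ?_)
  rw [Real.sqrt_inv, Real.rpow_neg hx.1.le, Real.sqrt_eq_rpow]

end Diagonal

section Incomplete

/-- The distance between points of the diagonal. -/
lemma pressureDist_diagonal_le {s s' : ℝ} (hs : 0 < s) (hs1 : s ≤ 1) (hs' : 0 < s') (hs1' : s' ≤ 1) :
    beltBuckle.pressureDist (beltDiagonal (s ^ 2)) (beltDiagonal (s' ^ 2)) ≤
      ENNReal.ofReal (2 * |s' - s|) := by
  -- In the parameter `r = √x` the speed bound `x^{-1/2}` becomes the constant `2`, so interpolating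
  -- `r` linearly gives length at most `2 |s' - s|`.
  set r : ℝ → ℝ := fun t => s + t * (s' - s) with hr
  have hrpos : ∀ t ∈ Icc (0 : ℝ) 1, 0 < r t ∧ r t ≤ 1 := by
    intro t ht
    have h1 : r t = (1 - t) * s + t * s' := by simp only [hr]; ring
    have h2 : 0 ≤ 1 - t := sub_nonneg.2 ht.2
    have h3 := ht.1
    rw [h1]
    constructor
    · rcases eq_or_lt_of_le h3 with h | h
      · rw [← h]; simpa using hs
      · have := mul_pos h hs'
        have := mul_nonneg h2 hs.le
        linarith
    · nlinarith
  have hlog : (1 : ℝ) < Real.log 3 := by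
    rw [Real.lt_log_iff_exp_lt (by norm_num)]
    exact Real.exp_one_lt_d9.trans (by norm_num)
  have hcurve : beltBuckle.IsModuliCurve (fun t => beltDiagonal (r t ^ 2))
      (beltDiagonal (s ^ 2)) (beltDiagonal (s' ^ 2)) := by
    refine ⟨?_, fun t ht => ?_, by simp [hr], by simp [hr]⟩
    · refine contDiffOn_diagonal.comp (by simp only [hr]; fun_prop) fun t ht => ?_
      exact pow_pos (hrpos t ht).1 2
    · obtain ⟨h1, h2⟩ := hrpos t ht
      exact beltDiagonal_mem_moduliSpace (pow_pos h1 2) (by nlinarith)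
  refine (iInf₂_le (f := fun γ (_ : beltBuckle.IsModuliCurve γ (beltDiagonal (s ^ 2))
    (beltDiagonal (s' ^ 2))) => beltBuckle.pressureLength γ) _ hcurve).trans ?_
  have hspeed : ∀ t ∈ Icc (0 : ℝ) 1, ENNReal.ofReal (Real.sqrt (beltBuckle.pressureNormSq
      (beltDiagonal (r t ^ 2)) (derivWithin (fun t => beltDiagonal (r t ^ 2)) (Icc 0 1) t))) ≤
      ENNReal.ofReal (2 * |s' - s|) := by
    intro t ht
    obtain ⟨h1, h2⟩ := hrpos t ht
    have hr2 : HasDerivAt (fun t => r t ^ 2) (2 * r t * (s' - s)) t := by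
      have h3 : HasDerivAt r (s' - s) t := by
        simpa [hr] using ((hasDerivAt_id t).mul_const (s' - s)).const_add s
      simpa using h3.fun_pow 2
    have hd : HasDerivAt (fun t => beltDiagonal (r t ^ 2))
        ((2 * r t * (s' - s)) • deriv beltDiagonal (r t ^ 2)) t :=
      HasDerivAt.scomp (h := fun t => r t ^ 2) t
        (hasDerivAt_diagonal (pow_pos h1 2)).differentiableAt.hasDerivAt hr2
    rw [hd.hasDerivWithinAt.derivWithin (uniqueDiffOn_Icc zero_lt_one t ht),
      pressureNormSq_smul (sum_edgeProb_diagonal (pow_pos h1 2))]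
    refine ENNReal.ofReal_le_ofReal (Real.sqrt_le_iff.2 ⟨by positivity, ?_⟩)
    calc _ ≤ (2 * r t * (s' - s)) ^ 2 * (r t ^ 2)⁻¹ := by
          gcongr
          exact pressureNormSq_diagonal_le (pow_pos h1 2)
      _ = _ := by
        rw [mul_pow 2 |s' - s|, sq_abs]
        field_simp
  calc beltBuckle.pressureLength (fun t => beltDiagonal (r t ^ 2))
      ≤ ∫⁻ _ in Icc (0 : ℝ) 1, ENNReal.ofReal (2 * |s' - s|) :=
        setLIntegral_mono' measurableSet_Icc hspeed
    _ = _ := by simp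

/-- A function on the moduli space that is Lipschitz for the pressure metric. -/
def thirdWeight (l : Fin 3 → ℝ) : ℝ := 2 * (edgeProb l 2 * (1 - edgeProb l 2))

lemma hasDerivWithinAt_edgeProb {γ : ℝ → Fin 3 → ℝ} {γ' : Fin 3 → ℝ} {s : Set ℝ} {t : ℝ}
    (h : HasDerivWithinAt γ γ' s t) (i : Fin 3) : HasDerivWithinAt (fun t => edgeProb (γ t) i)
      (-(edgeProb (γ t) i * (1 - edgeProb (γ t) i) * γ' i)) s t := by
  have h1 := (((hasDerivWithinAt_pi.1 h i).exp).const_add 1).fun_inv (by positivity)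
  simp only [edgeProb, one_div]
  refine h1.congr_deriv ?_
  field_simp
  ring

lemma totalWeight_le_one {l : Fin 3 → ℝ} (hl : ∑ i, edgeProb l i = 1) : totalWeight l ≤ 1 := by
  rw [← hl]
  refine Finset.sum_le_sum fun i _ => ?_
  have := edgeProb_pos l i
  nlinarith

lemma edgeProb_lt_half {l : Fin 3 → ℝ} {i : Fin 3} (h : 0 < l i) : edgeProb l i < 1 / 2 := by
  rw [edgeProb, one_div_lt_one_div (by positivity) two_pos]
  linarith [Real.one_lt_exp_iff.2 h]

/-- The left side is the squared derivative of `thirdWeight` along `φ`. Using `q_2 (1 - q_2)` rather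
than `q_2` yields the factor `1 - 2 q_2`, which matches the weight in the norm that degenerates as
`q_2 → 1/2`. The remaining factors, `4 (1 - 2q) q (1 - q)` and the total weight, are at most one. -/
lemma sq_le_pressureNormSq {l φ : Fin 3 → ℝ} (hl : l ∈ beltBuckle.moduliSpace)
    (hφ : ∑ i, edgeProb l i * (1 - edgeProb l i) * φ i = 0) :
    (2 * (1 - 2 * edgeProb l 2) * (edgeProb l 2 * (1 - edgeProb l 2) * φ 2)) ^ 2 ≤
      beltBuckle.pressureNormSq l φ := by
  obtain ⟨hpos, hsum⟩ := mem_moduliSpace_iff.1 hl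
  rw [pressureNormSq_tangent hsum ((edgeMean_eq_zero_iff l φ).2 hφ),
    le_div_iff₀ (totalWeight_pos l)]
  have hterm : ∀ i, 0 ≤ edgeProb l i * (1 - edgeProb l i) * (1 - 2 * edgeProb l i) * φ i ^ 2 := by
    intro i
    have h1 := edgeProb_pos l i
    have h2 := one_sub_edgeProb_pos l i
    have h3 : 0 < 1 - 2 * edgeProb l i := by linarith [edgeProb_lt_half (hpos i)]
    positivity
  have h1 := edgeProb_pos l 2
  have h2 := one_sub_edgeProb_pos l 2
  have h3 : 0 < 1 - 2 * edgeProb l 2 := by linarith [edgeProb_lt_half (hpos 2)]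
  have h4 := totalWeight_le_one hsum
  have h5 : 4 * (1 - 2 * edgeProb l 2) * (edgeProb l 2 * (1 - edgeProb l 2)) ≤ 1 := by
    have h6 : 4 * (edgeProb l 2 * (1 - edgeProb l 2)) ≤ 1 := by
      nlinarith [sq_nonneg (1 - 2 * edgeProb l 2)]
    have h7 : 1 - 2 * edgeProb l 2 ≤ 1 := by linarith
    calc _ = (1 - 2 * edgeProb l 2) * (4 * (edgeProb l 2 * (1 - edgeProb l 2))) := by ring
      _ ≤ 1 := mul_le_one₀ h7 (by positivity) h6
  calc _ ≤ (2 * (1 - 2 * edgeProb l 2) * (edgeProb l 2 * (1 - edgeProb l 2) * φ 2)) ^ 2 :=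
        mul_le_of_le_one_right (sq_nonneg _) h4
    _ = (4 * (1 - 2 * edgeProb l 2) * (edgeProb l 2 * (1 - edgeProb l 2))) *
        (edgeProb l 2 * (1 - edgeProb l 2) * (1 - 2 * edgeProb l 2) * φ 2 ^ 2) := by ring
    _ ≤ edgeProb l 2 * (1 - edgeProb l 2) * (1 - 2 * edgeProb l 2) * φ 2 ^ 2 :=
        mul_le_of_le_one_left (hterm 2) h5
    _ ≤ _ := Finset.single_le_sum (f := fun i => edgeProb l i * (1 - edgeProb l i) *
        (1 - 2 * edgeProb l i) * φ i ^ 2) (fun i _ => hterm i) (Finset.mem_univ 2)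

/-- Along any admissible curve the derivative of `thirdWeight` is bounded by the speed, and
integration bounds its increment by the length. The curve's velocity is tangent because `∑ q_i = 1`
holds all along it. -/
lemma enorm_thirdWeight_sub_le (l₁ l₂ : Fin 3 → ℝ) :
    ‖thirdWeight l₂ - thirdWeight l₁‖ₑ ≤ beltBuckle.pressureDist l₁ l₂ := by
  refine le_iInf₂ fun γ hγ => ?_
  obtain ⟨hsm, hmaps, rfl, rfl⟩ := hγ
  have hsmooth : ContDiffOn ℝ 1 (fun t => thirdWeight (γ t)) (Icc 0 1) := by
    have h2 : ContDiffOn ℝ 1 (fun t => γ t 2) (Icc 0 1) := contDiffOn_pi.1 hsm 2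
    have h3 : ContDiffOn ℝ 1 (fun t => edgeProb (γ t) 2) (Icc 0 1) :=
      contDiffOn_const.div (contDiffOn_const.add h2.exp) fun t _ => by positivity
    exact contDiffOn_const.mul (h3.mul (contDiffOn_const.sub h3))
  refine (enorm_sub_le_lintegral_derivWithin_Icc_of_contDiffOn_Icc hsmooth zero_le_one).trans
    (setLIntegral_mono' measurableSet_Icc fun t ht => ?_)
  have huniq := uniqueDiffOn_Icc (zero_lt_one (α := ℝ)) t ht
  have hγ' := ((hsm.differentiableOn one_ne_zero) t ht).hasDerivWithinAt
  have hq := hasDerivWithinAt_edgeProb hγ'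
  set φ := derivWithin γ (Icc 0 1) t
  have htan : ∑ i, edgeProb (γ t) i * (1 - edgeProb (γ t) i) * φ i = 0 := by
    have h1 := HasDerivWithinAt.fun_sum (u := Finset.univ) fun i _ => hq i
    have h2 : HasDerivWithinAt (fun t => ∑ i, edgeProb (γ t) i) 0 (Icc 0 1) t :=
      (hasDerivWithinAt_const t (Icc 0 1) (1 : ℝ)).congr
        (fun u hu => (mem_moduliSpace_iff.1 (hmaps hu)).2) (mem_moduliSpace_iff.1 (hmaps ht)).2
    have h3 := huniq.eq_deriv _ h1 h2
    rwa [Finset.sum_neg_distrib, neg_eq_zero] at h3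
  have hd : HasDerivWithinAt (fun t => thirdWeight (γ t))
      (-(2 * (1 - 2 * edgeProb (γ t) 2) *
        (edgeProb (γ t) 2 * (1 - edgeProb (γ t) 2) * φ 2))) (Icc 0 1) t := by
    refine (((hq 2).fun_mul ((hq 2).const_sub 1)).const_mul 2).congr_deriv ?_
    ring
  rw [hd.derivWithin huniq, enorm_neg, Real.enorm_eq_ofReal_abs]
  refine ENNReal.ofReal_le_ofReal (Real.abs_le_sqrt ?_)
  exact sq_le_pressureNormSq (hmaps ht) htan

/-- The diagonal points at `x = 1 / (n + 1)²` form a Cauchy sequence. By the Lipschitz bound a limit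
in the moduli space would have `thirdWeight` zero, yet this function is positive everywhere. -/
theorem not_isPressureComplete : ¬ beltBuckle.IsPressureComplete := by
  intro hcomplete
  set s : ℕ → ℝ := fun n => 1 / ((n : ℝ) + 1) with hs
  have hs0 : ∀ n, 0 < s n := fun n => Nat.one_div_pos_of_nat
  have hs1 : ∀ n, s n ≤ 1 := fun n => by
    rw [hs, div_le_one (by positivity)]
    linarith [(Nat.cast_nonneg n : (0 : ℝ) ≤ n)]
  have hslim : Tendsto s atTop (𝓝 0) := tendsto_one_div_add_atTop_nhds_zero_nat
  have hlog : (1 : ℝ) < Real.log 3 := by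
    rw [Real.lt_log_iff_exp_lt (by norm_num)]
    exact Real.exp_one_lt_d9.trans (by norm_num)
  have hmem : ∀ n, beltDiagonal (s n ^ 2) ∈ beltBuckle.moduliSpace := fun n =>
    beltDiagonal_mem_moduliSpace (pow_pos (hs0 n) 2) (by nlinarith [hs0 n, hs1 n])
  obtain ⟨l, hl, hlim⟩ := hcomplete (fun n => beltDiagonal (s n ^ 2)) hmem (by
    intro ε hε
    have h1 : Tendsto (fun p : ℕ × ℕ => ENNReal.ofReal (2 * |s p.2 - s p.1|)) atTop (𝓝 0) := by
      rw [← prod_atTop_atTop_eq, ← ENNReal.ofReal_zero]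
      refine ENNReal.tendsto_ofReal ?_
      have h2 : Tendsto (fun p : ℕ × ℕ => s p.2 - s p.1) (atTop ×ˢ atTop) (𝓝 (0 - 0)) :=
        (hslim.comp tendsto_snd).sub (hslim.comp tendsto_fst)
      simpa using h2.abs.const_mul 2
    obtain ⟨⟨N, N'⟩, hN⟩ := eventually_atTop.1 (h1.eventually (gt_mem_nhds hε))
    refine ⟨max N N', fun m hm n hn => lt_of_le_of_lt
      (pressureDist_diagonal_le (hs0 m) (hs1 m) (hs0 n) (hs1 n)) (hN (m, n) ?_)⟩
    exact ⟨(le_max_left _ _).trans hm, (le_max_right _ _).trans hn⟩)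
  have hconv : Tendsto (fun n => thirdWeight (beltDiagonal (s n ^ 2))) atTop (𝓝 (thirdWeight l)) := by
    rw [tendsto_iff_edist_tendsto_0]
    refine tendsto_of_tendsto_of_tendsto_of_le_of_le tendsto_const_nhds hlim
      (fun _ => zero_le) fun n => ?_
    rw [edist_comm, edist_eq_enorm_sub]
    exact enorm_thirdWeight_sub_le _ _
  have hzero : Tendsto (fun n => thirdWeight (beltDiagonal (s n ^ 2))) atTop (𝓝 0) := by
    have hc : Continuous fun x : ℝ => 2 * ((Real.exp x - 1) / (Real.exp x + 1) *
        (1 - (Real.exp x - 1) / (Real.exp x + 1))) := by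
      have : Continuous fun x : ℝ => (Real.exp x - 1) / (Real.exp x + 1) :=
        Continuous.div (by fun_prop) (by fun_prop) fun x => by positivity
      fun_prop
    have h1 := (hc.tendsto 0).comp (by simpa using hslim.pow 2 : Tendsto (fun n => s n ^ 2) atTop (𝓝 0))
    simp only [Real.exp_zero, sub_self, zero_div, zero_mul, mul_zero] at h1
    refine h1.congr fun n => ?_
    rw [Function.comp_apply, thirdWeight, edgeProb_diagonal_two (pow_pos (hs0 n) 2)]
  have hpos : 0 < thirdWeight l :=
    mul_pos two_pos (mul_pos (edgeProb_pos l 2) (one_sub_edgeProb_pos l 2))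
  exact hpos.ne' (tendsto_nhds_unique hconv hzero)

end Incomplete

end BeltBuckle
end

theorem proposition4p5 :
    -- the moduli space is the surface parametrized by the chart
    beltBuckle.moduliSpace = beltChart '' {p : Fin 2 → ℝ | 0 < p 0 ∧ 0 < p 1 ∧
        Real.exp (p 0 + p 1) < 3 + Real.exp (p 0) + Real.exp (p 1)} ∧
    -- equilibrium states, variances and tangent vectors are well defined for all `x, y > 0`
    (∀ p : Fin 2 → ℝ, 0 < p 0 → 0 < p 1 →
      (∃! m : Measure beltBuckle.shiftSpace, beltBuckle.IsEquilibriumState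
        (fun x => -beltBuckle.edgeFun (beltChart p) x) m) ∧
      (∀ φ : Fin 3 → ℝ, Tendsto
        (beltBuckle.varianceSeq (beltBuckle.edgeFun φ) (beltBuckle.edgeState (beltChart p)))
        atTop (𝓝 (beltBuckle.pressureNormSq (beltChart p) φ))) ∧
      (∀ i, partialDeriv i beltChart p ∈ beltBuckle.tangentSpace (beltChart p))) ∧
    -- the first fundamental form is a smooth Riemannian metric
    (∀ i j, ContDiffOn ℝ (⊤ : ℕ∞) (fun p => beltMetric p i j)
      {p : Fin 2 → ℝ | 0 < p 0 ∧ 0 < p 1}) ∧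
    (∀ p : Fin 2 → ℝ, 0 < p 0 → 0 < p 1 → (beltMetric p).PosDef) ∧
    -- the curvature lies between two positive constants on the moduli space
    (∃ c₀ c₁ : ℝ, 0 < c₀ ∧ ∀ l ∈ beltBuckle.moduliSpace,
      c₀ ≤ beltCurvature ![l 0, l 1] ∧ beltCurvature ![l 0, l 1] ≤ c₁) ∧
    -- the explicit curvature, and its limit
    (∀ p : Fin 2 → ℝ, 0 < p 0 → 0 < p 1 →
      beltCurvature p = beltCurvatureFormula (Real.exp (p 0)) (Real.exp (p 1))) ∧
    Tendsto (fun q : ℝ × ℝ => beltCurvature ![q.1, q.2]) (atTop ×ˢ atTop) (𝓝 (3 / 4)) ∧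
    -- incompleteness
    ¬ beltBuckle.IsPressureComplete ∧
    -- the diagonal path leaves every compact subset of the moduli space in finite length
    (∀ x : ℝ, 0 < x → x < Real.log 3 → beltDiagonal x ∈ beltBuckle.moduliSpace) ∧
    (∀ K : Set (Fin 3 → ℝ), IsCompact K → K ⊆ beltBuckle.moduliSpace →
      ∀ᶠ x in 𝓝[>] (0 : ℝ), beltDiagonal x ∉ K) ∧
    ∫⁻ x in Ioc (0 : ℝ) 1, ENNReal.ofReal (Real.sqrt
      (beltBuckle.pressureNormSq (beltDiagonal x) (deriv beltDiagonal x))) < ⊤ := by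
  refine ⟨BeltBuckle.moduliSpace_eq, fun p h0 h1 => ?_, BeltBuckle.contDiffOn_beltMetric,
    fun p h0 h1 => BeltBuckle.beltMetric_posDef ⟨h0, h1⟩, ⟨1 / 1000, 1000, by norm_num, ?_⟩,
    fun p h0 h1 => BeltBuckle.beltCurvature_eq ⟨h0, h1⟩, BeltBuckle.tendsto_beltCurvature,
    BeltBuckle.not_isPressureComplete, fun x => BeltBuckle.beltDiagonal_mem_moduliSpace,
    fun K => BeltBuckle.eventually_beltDiagonal_notMem, BeltBuckle.lintegral_diagonal_lt_top⟩
  · have hl := BeltBuckle.sum_edgeProb_chart (p := p) ⟨h0, h1⟩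
    refine ⟨BeltBuckle.existsUnique_isEquilibriumState hl, fun φ => ?_, fun i =>
      (BeltBuckle.mem_tangentSpace_iff hl _).2 (BeltBuckle.edgeMean_partialDeriv_chart ⟨h0, h1⟩ i)⟩
    -- `pressureNormSq` is defined by `limUnder`, so the existence of a limit is all that is needed
    -- here.
    exact tendsto_nhds_limUnder ⟨_, BeltBuckle.tendsto_varianceSeq hl φ⟩
  · intro l hl
    have hpos := (BeltBuckle.mem_moduliSpace_iff.1 hl).1
    have hq : ![l 0, l 1] ∈ BeltBuckle.quadrant := ⟨hpos 0, hpos 1⟩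
    have hab := BeltBuckle.one_lt_exp_of_quadrant hq
    rw [BeltBuckle.beltCurvature_eq hq]
    exact BeltBuckle.curvatureFormula_bounds hab.1 hab.2
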